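/- **Setting.** Let $2\le k\le n-2$. For a permutation of $[n]$, $\ell$ denotes the number of inversions and $s_{ij}$ the transposition of $i$ and $j$. Let $w=w((2,2),k)\in S_n$ be the permutation with $w_{k-1}=k+1$, $w_k=k+2$, $w_{k+1}=k-1$, $w_{k+2}=k$ and $w_i=i$ otherwise. The Fomin–Kirillov algebra $\mathcal E_n$ is the associative $\mathbb C$-algebra generated by $x_{ij}$, $1\le i<j\le n$, with the relations $$x_{ij}^2=0,\quad x_{ij}x_{jl}=x_{il}x_{ij}+x_{jl}x_{il},\quad x_{jl}x_{ij}=x_{ij}x_{il}+x_{il}x_{jl}\ (i<j<l),\quad x_{ij}x_{lm}=x_{lm}x_{ij}\ (i,j,l,m\text{ distinct}).$$ The algebra $\mathcal E_n^q$ over $\mathbb C[q_1,\dots,q_{n-1}]$ has the same generators and relations, except that $x_{i,i+1}^2=q_i$ (and still $x_{ij}^2=0$ for $j-i\ge 2$). In both algebras the Dunkl elements $\theta_i=-\sum_{j<i}x_{ji}+\sum_{l>i}x_{il}$ commute pairwise. Let $\mathfrak S_w\in\mathbb Z[x_1,\dots,x_n]$ be the Schubert polynomial, and let $\mathfrak S_w^q$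 be the quantum Schubert polynomial: if $\mathfrak S_w=\sum\alpha_{i_1,\dots,i_{n-1}}e_{i_1}(x_1)\cdots e_{i_{n-1}}(x_1,\dots,x_{n-1})$ (the unique such expansion with $0\le i_m\le m$), then $\mathfrak S_w^q=\sum\alpha_{i_1,\dots,i_{n-1}}E^1_{i_1}\cdots E^{n-1}_{i_{n-1}}$, where $E_0^m=1$, $E_i^m=0$ for $i<0$ or $i>m$, and $E_i^m=E_i^{m-1}+x_mE_{i-1}^{m-1}+q_{m-1}E_{i-2}^{m-2}$. For sequences $I=(i_1,\dots,i_4)$ in $\{1,\dots,k\}$ and $J=(j_1,\dots,j_4)$ in $\{k+1,\dots,n\}$ write $x_{IJ}=x_{i_1j_1}x_{i_2j_2}x_{i_3j_3}x_{i_4j_4}$. Two such formal monomials are equivalent, $x_{IJ}\sim x_{I'J'}$, if one is obtained from the other by repeatedly exchanging neighbouring letters that have no index in common. Let $|I|$, $|J|$ be the numbers of distinct entries. **Theorem.** In $\mathcal E_n$, $$\mathfrak S_w(\theta_1,\dots,\theta_n)=s_{(2,2)}(\theta_1,\dots,\theta_k)=\sum c_{IJ}\,x_{IJ},$$ and in $\mathcal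 E_n^q$, with the same coefficients, $$\mathfrak S_w^q(\theta_1,\dots,\theta_n)=\sum c_{IJ}\,x_{IJ}.$$ Both sums run over the equivalence classes of the monomials $x_{IJ}$ (one representative from each), and $$c_{IJ}=\begin{cases}2,&|I|=|J|=4,\\ 0,&\text{if some index of } I \text{ or of } J \text{ has multiplicity } \ge 3,\\ 0,&\text{if } x_{IJ} \text{ is equivalent to a monomial with two equal neighbouring letters},\\ 0,&\text{if } x_{IJ}\sim x_{aj_1}x_{bj_1}x_{bj_2}x_{cj_2}\text{ with } a,b,c \text{ distinct and } j_1\neq j_2,\\ 0,&\text{if } x_{IJ}\sim x_{i_1a}x_{i_1b}x_{i_2b}x_{i_3c}\text{ with } a,b,c\text{ distinct and } i_1\ne i_2,\ i_1\neq i_3\ (i_2=i_3\text{ is allowed}),\\ 0,&\text{if } x_{IJ}\sim x_{i_1a}x_{i_1b}x_{i_2c}x_{i_3c}\text{ with } a,b,c\text{ distinct and } i_1,i_2,i_3 \text{ distinct},\\ 1,&\text{otherwise.}\end{cases}$$ Consequently, in the quantum cohomology ring $QH^*(Fl_n,\mathbb Z)=\mathbb Z[q_1,\dots,q_{n-1}][x_1,\dots,x_n]/\langle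 E_1^n,\dots,E_n^n\rangle$, where the Schubert class $\sigma_\pi$ is the coset of $\mathfrak S_\pi^q$, we have for every $\pi\in S_n$ $$\sigma_w*\sigma_\pi=\sum c_{IJ}\,t_{IJ}(\sigma_\pi),\qquad t_{IJ}=t_{i_1j_1}t_{i_2j_2}t_{i_3j_3}t_{i_4j_4},$$ with the same range of summation. Here, for $i<j$, the $\mathbb Z[q]$-linear operator $t_{ij}$ maps $\sigma_v$ to $\sigma_{vs_{ij}}$ if $\ell(vs_{ij})=\ell(v)+1$, to $q_iq_{i+1}\cdots q_{j-1}\,\sigma_{vs_{ij}}$ if $\ell(vs_{ij})=\ell(v)-2(j-i)+1$, and to $0$ otherwise. -/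

import Mathlib

noncomputable section

namespace FominKirillov

/-! ### Symmetric and Schubert polynomials -/

section Polynomials

variable (R : Type) [CommRing R]

/-- The elementary symmetric polynomial `e_i(x_1, …, x_m)` of the first `m` of the `n` variables. -/
def elemSym (n m i : ℕ) : MvPolynomial (Fin n) R :=
  ∑ s ∈ Finset.powersetCard i (Finset.univ.filter fun a : Fin n => a.val < m),
    ∏ a ∈ s, MvPolynomial.X a

/-- Semistandard fillings of a Young diagram by the numbers `0, …, k - 1`: rows weakly increase,
columns strictly increase. -/
def IsSemistandard {k : ℕ} (μ : YoungDiagram) (T : μ.cells → Fin k) : Prop :=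
  (∀ c d : μ.cells, c.1.1 = d.1.1 → c.1.2 ≤ d.1.2 → T c ≤ T d) ∧
  (∀ c d : μ.cells, c.1.2 = d.1.2 → c.1.1 < d.1.1 → T c < T d)

open Classical in
/-- The Schur polynomial `s_μ(x_1, …, x_k)`. -/
def schur (k : ℕ) (μ : YoungDiagram) : MvPolynomial (Fin k) R :=
  ∑ T ∈ Finset.univ.filter (fun T : μ.cells → Fin k => IsSemistandard μ T),
    ∏ c, MvPolynomial.X (T c)

variable {R}

theorem sub_dvd_sub_rename_swap {n : ℕ} (i j : Fin n) (f : MvPolynomial (Fin n) R) :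
    (MvPolynomial.X i - MvPolynomial.X j : MvPolynomial (Fin n) R) ∣
      f - MvPolynomial.rename (Equiv.swap i j) f := by
  induction f using MvPolynomial.induction_on with
  | C a => simp
  | add p q hp hq =>
    rw [map_add, add_sub_add_comm]
    exact dvd_add hp hq
  | mul_X p l hp =>
    have h1 : (MvPolynomial.X i - MvPolynomial.X j : MvPolynomial (Fin n) R) ∣
        MvPolynomial.X l - MvPolynomial.X (Equiv.swap i j l) := by
      by_cases hi : l = i
      · subst hi; simp
      · by_cases hj : l = j
        · subst hj
          rw [Equiv.swap_apply_right, ← dvd_neg, neg_sub]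
        · rw [Equiv.swap_apply_of_ne_of_ne hi hj, sub_self]
          exact dvd_zero _
    rw [map_mul, MvPolynomial.rename_X]
    have h2 : p * MvPolynomial.X l - MvPolynomial.rename (Equiv.swap i j) p *
          MvPolynomial.X (Equiv.swap i j l) =
        (p - MvPolynomial.rename (Equiv.swap i j) p) * MvPolynomial.X l +
          MvPolynomial.rename (Equiv.swap i j) p *
            (MvPolynomial.X l - MvPolynomial.X (Equiv.swap i j l)) := by ring
    rw [h2]
    exact dvd_add (hp.mul_right _) (h1.mul_left _)

/-- The divided difference `(f - s_{ij} f) / (x_i - x_j)`, the unique `g` with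
`f - s_{ij} f = (x_i - x_j) g` (for `i ≠ j`). -/
def dividedDiff {n : ℕ} (i j : Fin n) (f : MvPolynomial (Fin n) R) : MvPolynomial (Fin n) R :=
  (sub_dvd_sub_rename_swap i j f).choose

/-- `w` has an ascent at the (zero-based) position `i`. -/
def IsAscent {n : ℕ} (w : Equiv.Perm (Fin n)) (i : ℕ) : Prop :=
  ∃ h : i + 1 < n, w ⟨i, by omega⟩ < w ⟨i + 1, h⟩

/-- A quantity that drops when an ascent is turned into a descent. -/
def ascentWeight {n : ℕ} (w : Equiv.Perm (Fin n)) : ℕ := ∑ a : Fin n, a.val * (w a).val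

theorem ascentWeight_lt {n : ℕ} (w : Equiv.Perm (Fin n)) (i j : Fin n) (hij : i < j)
    (h : w i < w j) : ascentWeight (w * Equiv.swap i j) < ascentWeight w := by
  unfold ascentWeight
  have hne : i ≠ j := ne_of_lt hij
  have key : ∀ f : Fin n → ℕ, ∑ a, f a = f i + (f j + ∑ a ∈ (Finset.univ.erase i).erase j, f a) := by
    intro f
    rw [Finset.add_sum_erase _ f (by simp [hne.symm]), Finset.add_sum_erase _ f (by simp)]
  rw [key, key (fun a => a.val * (w a).val)]
  have h3 : ∑ a ∈ (Finset.univ.erase i).erase j, a.val * ((w * Equiv.swap i j) a).val =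
      ∑ a ∈ (Finset.univ.erase i).erase j, a.val * (w a).val := by
    refine Finset.sum_congr rfl fun a ha => ?_
    simp only [Finset.mem_erase, Finset.mem_univ, and_true] at ha
    rw [Equiv.Perm.mul_apply, Equiv.swap_apply_of_ne_of_ne ha.2 ha.1]
  rw [h3]
  simp only [Equiv.Perm.mul_apply, Equiv.swap_apply_left, Equiv.swap_apply_right]
  have h4 : i.val < j.val := hij
  have h5 : (w i).val < (w j).val := h
  nlinarith

open Classical in
/-- The Schubert polynomial of `w`. It is `x_1^{n-1} x_2^{n-2} ⋯ x_{n-1}` for the longest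
permutation (the only one without ascents), and for any other `w` it is `∂_i` of the Schubert
polynomial of `w s_i`, where `i` is the first ascent of `w`. -/
def schubert (R : Type) [CommRing R] {n : ℕ} (w : Equiv.Perm (Fin n)) : MvPolynomial (Fin n) R :=
  if h : ∃ i, IsAscent w i then
    have hi : IsAscent w (Nat.find h) := Nat.find_spec h
    dividedDiff (⟨Nat.find h, by have := hi.1; omega⟩ : Fin n) ⟨Nat.find h + 1, hi.1⟩
      (schubert R (w * Equiv.swap ⟨Nat.find h, by have := hi.1; omega⟩ ⟨Nat.find h + 1, hi.1⟩))
  else ∏ a : Fin n, MvPolynomial.X a ^ (n - 1 - a.val)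
termination_by ascentWeight w
decreasing_by
  exact ascentWeight_lt _ _ _ (by simp [Fin.lt_def]) hi.2

/-! ### Quantum Schubert polynomials -/

variable (R)

/-- The coefficient ring `R[q_1, …, q_{n-1}]`; the variable with index `m` is `q_{m+1}`. -/
abbrev QCoeff (n : ℕ) : Type := MvPolynomial (Fin (n - 1)) R

/-- The polynomial `x_{m+1}`. -/
def xVar (n m : ℕ) : MvPolynomial (Fin n) (QCoeff R n) :=
  if h : m < n then MvPolynomial.X ⟨m, h⟩ else 0

/-- The polynomial `q_{m+1}`. -/
def qVar (n m : ℕ) : MvPolynomial (Fin n) (QCoeff R n) :=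
  if h : m < n - 1 then MvPolynomial.C (MvPolynomial.X ⟨m, h⟩) else 0

/-- The quantum elementary polynomial `E_i^m = E_i(x_1, …, x_m; q)` (for `m ≤ n`), given by
`E_i^m = E_i^{m-1} + x_m E_{i-1}^{m-1} + q_{m-1} E_{i-2}^{m-2}`. The arguments are `m` and `i`. -/
def quantumElem (n : ℕ) : ℕ → ℕ → MvPolynomial (Fin n) (QCoeff R n)
  | _, 0 => 1
  | 0, _ + 1 => 0
  | m + 1, 1 => quantumElem n m 1 + xVar R n m
  | 1, _ + 2 => 0
  | m + 2, i + 2 => quantumElem n (m + 1) (i + 2) + xVar R n (m + 1) * quantumElem n (m + 1) (i + 1)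
      + qVar R n m * quantumElem n m i

/-- Index sequences `(i_1, …, i_{n-1})` with `0 ≤ i_m ≤ m`. -/
abbrev ElemIndex (n : ℕ) : Type := (m : Fin (n - 1)) → Fin (m.val + 2)

/-- `e_{i_1, …, i_{n-1}} = e_{i_1}(x_1) e_{i_2}(x_1, x_2) ⋯ e_{i_{n-1}}(x_1, …, x_{n-1})`. -/
def elemProd {n : ℕ} (I : ElemIndex n) : MvPolynomial (Fin n) R :=
  ∏ m : Fin (n - 1), elemSym R n (m.val + 1) (I m).val

/-- `E_{i_1, …, i_{n-1}} = E_{i_1}^1 E_{i_2}^2 ⋯ E_{i_{n-1}}^{n-1}`. -/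
def quantumElemProd {n : ℕ} (I : ElemIndex n) : MvPolynomial (Fin n) (QCoeff R n) :=
  ∏ m : Fin (n - 1), quantumElem R n (m.val + 1) (I m).val

variable {R}

open Classical in
/-- The quantum Schubert polynomial: expand the Schubert polynomial (in the unique way) as a linear
combination of the `e_{i_1, …, i_{n-1}}` and replace each of them by `E_{i_1, …, i_{n-1}}`. -/
def quantumSchubert (R : Type) [CommRing R] {n : ℕ} (w : Equiv.Perm (Fin n)) : MvPolynomial (Fin n) (QCoeff R n) :=
  if h : ∃ α : ElemIndex n → R, schubert R w = ∑ I, α I • elemProd R I then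
    ∑ I, MvPolynomial.C (MvPolynomial.C (h.choose I)) * quantumElemProd R I
  else 0

end Polynomials

/-! ### The Fomin–Kirillov algebras -/

section Algebra

/-- Index pairs of the generators `x_{ij}`, `i < j`. -/
abbrev Gen (n : ℕ) : Type := {p : Fin n × Fin n // p.1 < p.2}

/-- The generator `x_{ij}` in the free algebra. -/
def freeGen (R : Type) [CommRing R] {n : ℕ} {i j : Fin n} (h : i < j) : FreeAlgebra R (Gen n) :=
  FreeAlgebra.ι R ⟨(i, j), h⟩

/-- The defining relations, with `x_{ij}^2 = p_{ij}` for given elements `p_{ij}` of the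
(automatically central) coefficient ring. -/
inductive Rel (R : Type) [CommRing R] {n : ℕ} (p : Fin n → Fin n → R) :
    FreeAlgebra R (Gen n) → FreeAlgebra R (Gen n) → Prop
  | square {i j : Fin n} (h : i < j) :
      Rel R p (freeGen R h * freeGen R h) (algebraMap R _ (p i j))
  | triangle {i j k : Fin n} (hij : i < j) (hjk : j < k) :
      Rel R p (freeGen R hij * freeGen R hjk)
        (freeGen R (hij.trans hjk) * freeGen R hij + freeGen R hjk * freeGen R (hij.trans hjk))
  | triangle_rev {i j k : Fin n} (hij : i < j) (hjk : j < k) :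
      Rel R p (freeGen R hjk * freeGen R hij)
        (freeGen R hij * freeGen R (hij.trans hjk) + freeGen R (hij.trans hjk) * freeGen R hjk)
  | comm {i j k l : Fin n} (hij : i < j) (hkl : k < l)
      (hik : i ≠ k) (hil : i ≠ l) (hjk : j ≠ k) (hjl : j ≠ l) :
      Rel R p (freeGen R hij * freeGen R hkl) (freeGen R hkl * freeGen R hij)

/-- The algebra over `R` with generators `x_{ij}` and the relations above. -/
def FKAlgebra (R : Type) [CommRing R] {n : ℕ} (p : Fin n → Fin n → R) : Type :=
  RingQuot (Rel R p)

instance {R : Type} [CommRing R] {n : ℕ} (p : Fin n → Fin n → R) : Ring (FKAlgebra R p) :=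
  inferInstanceAs (Ring (RingQuot (Rel R p)))

instance {R : Type} [CommRing R] {n : ℕ} (p : Fin n → Fin n → R) : Algebra R (FKAlgebra R p) :=
  inferInstanceAs (Algebra R (RingQuot (Rel R p)))

/-- The quotient map from the free algebra. -/
def FKAlgebra.mk {R : Type} [CommRing R] {n : ℕ} (p : Fin n → Fin n → R) :
    FreeAlgebra R (Gen n) →ₐ[R] FKAlgebra R p :=
  RingQuot.mkAlgHom R (Rel R p)

/-- The generator `x_{ij}`; it is `0` by convention unless `i < j`. -/
def gen {R : Type} [CommRing R] {n : ℕ} (p : Fin n → Fin n → R) (i j : Fin n) : FKAlgebra R p :=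
  if h : i < j then FKAlgebra.mk p (freeGen R h) else 0

/-- The Dunkl element `θ_i = - ∑_{j < i} x_{ji} + ∑_{k > i} x_{ik}`. -/
def dunkl {R : Type} [CommRing R] {n : ℕ} (p : Fin n → Fin n → R) (i : Fin n) : FKAlgebra R p :=
  -(∑ j ∈ Finset.univ.filter (fun j => j < i), gen p j i) +
    ∑ k ∈ Finset.univ.filter (fun k => i < k), gen p i k

section Commutation

variable {R : Type} [CommRing R] {n : ℕ} (p : Fin n → Fin n → R)

/-- The antisymmetric family that extends the generators: `x_{ij}` for `i < j` and `-x_{ji}` for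
`i > j`. -/
def sgen (i j : Fin n) : FKAlgebra R p := gen p i j - gen p j i

theorem sgen_neg (i j : Fin n) : sgen p j i = - sgen p i j := by simp [sgen]

theorem gen_eq {i j : Fin n} (h : i < j) : gen p i j = FKAlgebra.mk p (freeGen R h) := by
  simp [gen, h]
theorem gen_zero {i j : Fin n} (h : ¬ i < j) : gen p i j = 0 := by simp [gen, h]

theorem dunkl_eq (i : Fin n) : dunkl p i = ∑ j, sgen p i j := by
  unfold dunkl sgen
  rw [Finset.sum_sub_distrib, neg_add_eq_sub, Finset.sum_filter, Finset.sum_filter]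
  congr 1 <;> refine Finset.sum_congr rfl fun j _ => ?_ <;> split_ifs with h <;> simp [gen, h]

theorem gen_tri {i j k : Fin n} (hij : i < j) (hjk : j < k) :
    gen p i j * gen p j k = gen p i k * gen p i j + gen p j k * gen p i k := by
  rw [gen_eq p hij, gen_eq p hjk, gen_eq p (hij.trans hjk)]
  simp only [← map_mul, ← map_add]
  exact RingQuot.mkAlgHom_rel R (Rel.triangle hij hjk)
theorem gen_tri_rev {i j k : Fin n} (hij : i < j) (hjk : j < k) :
    gen p j k * gen p i j = gen p i j * gen p i k + gen p i k * gen p j k := by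
  rw [gen_eq p hij, gen_eq p hjk, gen_eq p (hij.trans hjk)]
  simp only [← map_mul, ← map_add]
  exact RingQuot.mkAlgHom_rel R (Rel.triangle_rev hij hjk)
theorem gen_comm {i j k l : Fin n}
      (hik : i ≠ k) (hil : i ≠ l) (hjk : j ≠ k) (hjl : j ≠ l) :
    Commute (gen p i j) (gen p k l) := by
  by_cases hij : i < j
  · by_cases hkl : k < l
    · rw [gen_eq p hij, gen_eq p hkl, Commute, SemiconjBy]
      simp only [← map_mul]
      exact RingQuot.mkAlgHom_rel R (Rel.comm hij hkl hik hil hjk hjl)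
    · rw [gen_zero p hkl]; exact Commute.zero_right _
  · rw [gen_zero p hij]; exact Commute.zero_left _

theorem sgen_cyc {i j k : Fin n} (hij : i ≠ j) (hjk : j ≠ k) (hik : i ≠ k) :
    sgen p i j * sgen p j k + sgen p j k * sgen p k i + sgen p k i * sgen p i j = 0 := by
  unfold sgen
  rcases lt_or_gt_of_ne hij with h1 | h1 <;> rcases lt_or_gt_of_ne hjk with h2 | h2 <;>
    rcases lt_or_gt_of_ne hik with h3 | h3
  all_goals first
    | (exfalso; exact lt_asymm (h1.trans h2) h3)
    | (exfalso; exact lt_asymm (h2.trans h1) h3)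
    | skip
  · simp only [gen_zero p h1.not_gt, gen_zero p h2.not_gt, gen_zero p h3.not_gt]
    have := gen_tri p h1 h2
    simp only [sub_zero, zero_sub, mul_neg, neg_mul, this]; abel
  · simp only [gen_zero p h1.not_gt, gen_zero p h2.not_gt, gen_zero p h3.not_gt]
    have := gen_tri_rev p h3 h2
    simp only [sub_zero, zero_sub, mul_neg, neg_mul, this]; abel
  · simp only [gen_zero p h1.not_gt, gen_zero p h2.not_gt, gen_zero p h3.not_gt]
    have := gen_tri p h3 h1
    simp only [sub_zero, zero_sub, mul_neg, neg_mul, this]; abel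
  · simp only [gen_zero p h1.not_gt, gen_zero p h2.not_gt, gen_zero p h3.not_gt]
    have := gen_tri_rev p h1 h3
    simp only [sub_zero, zero_sub, mul_neg, neg_mul, this]; abel
  · simp only [gen_zero p h1.not_gt, gen_zero p h2.not_gt, gen_zero p h3.not_gt]
    have := gen_tri p h2 h3
    simp only [sub_zero, zero_sub, mul_neg, neg_mul, this]; abel
  · simp only [gen_zero p h1.not_gt, gen_zero p h2.not_gt, gen_zero p h3.not_gt]
    have := gen_tri_rev p h2 h1
    simp only [sub_zero, zero_sub, mul_neg, neg_mul, neg_neg, this]; abel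

theorem sgen_comm {i j k l : Fin n} (hik : i ≠ k) (hil : i ≠ l) (hjk : j ≠ k) (hjl : j ≠ l) :
    Commute (sgen p i j) (sgen p k l) :=
  ((gen_comm p hik hil hjk hjl).sub_right (gen_comm p hil hik hjl hjk)).sub_left
    ((gen_comm p hjk hjl hik hil).sub_right (gen_comm p hjl hjk hil hik))

/-- The Dunkl elements commute pairwise, so that polynomials can be evaluated at them. -/
theorem dunkl_commute (i j : Fin n) : Commute (dunkl p i) (dunkl p j) := by
  by_cases hij : i = j
  · rw [hij]
  have hii : ∀ a, sgen p a a = 0 := fun a => sub_self _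
  rw [commute_iff_lie_eq, dunkl_eq, dunkl_eq, Ring.lie_def, Finset.sum_mul_sum, Finset.sum_mul_sum,
    Finset.sum_comm (s := Finset.univ) (t := Finset.univ) (f := fun a b => sgen p j a * sgen p i b),
    ← Finset.sum_sub_distrib]
  simp only [← Finset.sum_sub_distrib]
  -- only the terms with a common index survive
  have hz : ∀ a b, sgen p i a * sgen p j b - sgen p j b * sgen p i a =
      (if a = j then sgen p i j * sgen p j b - sgen p j b * sgen p i j else 0) +
      (if b = i then sgen p i a * sgen p j i - sgen p j i * sgen p i a else 0) +
      (if a = b then sgen p i a * sgen p j a - sgen p j a * sgen p i a else 0) := by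
    intro a b
    by_cases h1 : a = j
    · subst h1
      by_cases h2 : b = i
      · subst h2
        simp [Ne.symm hij, sgen_neg p b a]
      · by_cases h3 : a = b
        · subst h3; simp [h2, hii]
        · simp [h2, h3]
    · by_cases h2 : b = i
      · subst h2
        by_cases h3 : a = b
        · subst h3; simp [h1, hii]
        · simp [h1, h3]
      · by_cases h3 : a = b
        · subst h3; simp [h1, h2]
        · simp only [h1, h2, h3, if_false, add_zero]
          exact sub_eq_zero.2 (sgen_comm p hij (Ne.symm h2) h1 h3)
  rw [Finset.sum_congr rfl fun a _ => Finset.sum_congr rfl fun b _ => hz a b]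
  simp only [Finset.sum_add_distrib]
  simp only [Finset.sum_ite_eq, Finset.sum_ite_eq', Finset.mem_univ, if_true]
  rw [Finset.sum_comm (γ := Fin n)]
  simp only [Finset.sum_ite_eq', Finset.mem_univ, if_true]
  rw [← Finset.sum_add_distrib, ← Finset.sum_add_distrib]
  refine Finset.sum_eq_zero fun c _ => ?_
  by_cases h1 : c = i
  · subst h1; simp [hii, sgen_neg p c j]
  by_cases h2 : c = j
  · subst h2; simp [hii, sgen_neg p c i]
  have e1 := sgen_cyc p hij (Ne.symm h2) (Ne.symm h1)
  have e2 := sgen_cyc p h2 (Ne.symm hij) h1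
  rw [sgen_neg p i j, sgen_neg p j c, sgen_neg p c i] at e2
  rw [sgen_neg p c i, sgen_neg p i j]
  have e3 := congrArg₂ (· - ·) e1 e2
  simp only [mul_neg, neg_mul, neg_neg, sub_zero] at e3 ⊢
  rw [← e3]; abel

end Commutation

/-- The parameters of the classical algebra `ℰ_n` over `ℂ`: all squares vanish. -/
def classicalParam (n : ℕ) : Fin n → Fin n → ℂ := fun _ _ => 0

/-- The parameters of the quantum algebra `ℰ_n^q` over `ℂ[q_1, …, q_{n-1}]`:
`x_{i,i+1}^2 = q_i`, and the other squares vanish. -/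
def quantumParam (n : ℕ) : Fin n → Fin n → QCoeff ℂ n := fun i j =>
  if h : i.val + 1 = j.val then MvPolynomial.X ⟨i.val, by have := j.isLt; omega⟩ else 0

/-- The value of a polynomial at a family `θ_1, …, θ_m` of pairwise commuting elements of an
algebra; the monomial `x^a` has the value `θ_1^{a_1} ⋯ θ_m^{a_m}`. -/
def evalAt {R A : Type} [CommRing R] [Ring A] [Algebra R A] {m : ℕ} (θ : Fin m → A)
    (f : MvPolynomial (Fin m) R) : A :=
  ∑ a ∈ f.support, f.coeff a • (List.ofFn fun i => θ i ^ a i).prod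

end Algebra

/-! ### The Grassmannian permutation and the explicit expansion -/

section Expansion

/-- The shape `(2, 2)`. -/
def boxShape : YoungDiagram := YoungDiagram.ofRowLens [2, 2] (by simp [List.SortedGE, Antitone])

/-- The permutation `w((2,2),k)`: in one-based notation `w_{k-1} = k+1`, `w_k = k+2`,
`w_{k+1} = k-1`, `w_{k+2} = k` and `w_i = i` otherwise. -/
def boxPerm (n k : ℕ) (hk : 2 ≤ k) (hn : k + 2 ≤ n) : Equiv.Perm (Fin n) :=
  Equiv.swap ⟨k - 2, by omega⟩ ⟨k, by omega⟩ * Equiv.swap ⟨k - 1, by omega⟩ ⟨k + 1, by omega⟩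

/-- Index pairs `(i, j)` with `i ∈ {1, …, k}` and `j ∈ {k+1, …, n}` (here zero-based). -/
abbrev Box (n k : ℕ) : Type := {p : Fin n × Fin n // p.1.val < k ∧ k ≤ p.2.val}

/-- A pair of sequences `I = (i_1, …, i_4)`, `J = (j_1, …, j_4)`, that is, a formal monomial
`x_{IJ} = x_{i_1 j_1} x_{i_2 j_2} x_{i_3 j_3} x_{i_4 j_4}`. -/
abbrev Word (n k : ℕ) : Type := Fin 4 → Box n k

variable {n k : ℕ}

/-- The first index of the letter at position `t`. -/
def Word.row (u : Word n k) (t : Fin 4) : Fin n := (u t).1.1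

/-- The second index of the letter at position `t`. -/
def Word.col (u : Word n k) (t : Fin 4) : Fin n := (u t).1.2

/-- `v` arises from `u` by exchanging two neighbouring letters without a common index. -/
def CommStep (u v : Word n k) : Prop :=
  ∃ s t : Fin 4, s.val + 1 = t.val ∧ u.row s ≠ u.row t ∧ u.col s ≠ u.col t ∧
    v = u ∘ Equiv.swap s t

/-- Equality up to commutations. -/
def commSetoid (n k : ℕ) : Setoid (Word n k) := Relation.EqvGen.setoid CommStep

/-- `u ∼ v`. -/
def CommEquiv (u v : Word n k) : Prop := commSetoid n k u v

/-- The commutation classes of words. -/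
abbrev CommClass (n k : ℕ) : Type := Quotient (commSetoid n k)

instance : Fintype (CommClass n k) := Fintype.ofFinite _

/-- `u = x_{i_1 j_1} x_{i_2 j_2} x_{i_3 j_3} x_{i_4 j_4}` for the listed indices. -/
def Word.Spells (u : Word n k) (i j : Fin 4 → Fin n) : Prop := u.row = i ∧ u.col = j

open Classical in
/-- Some index of `I` or of `J` has multiplicity at least three. -/
def HasTriple (u : Word n k) : Prop :=
  ∃ a : Fin n, 3 ≤ (Finset.univ.filter fun t => u.row t = a).card ∨
    3 ≤ (Finset.univ.filter fun t => u.col t = a).card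

/-- Up to commutations, `u` contains a square `x_{ij} x_{ij}`. -/
def HasSquare (u : Word n k) : Prop :=
  ∃ v, CommEquiv u v ∧ ∃ s t : Fin 4, s.val + 1 = t.val ∧ v s = v t

/-- `u ∼ x_{a c} x_{b c} x_{b d} x_{e d}` with distinct `a, b, e`. -/
def ZigzagCol (u : Word n k) : Prop :=
  ∃ v, CommEquiv u v ∧ ∃ a b e c d : Fin n, a ≠ b ∧ a ≠ e ∧ b ≠ e ∧ c ≠ d ∧
    v.Spells ![a, b, b, e] ![c, c, d, d]

/-- `u ∼ x_{i a} x_{i b} x_{i' b} x_{i'' c}` with distinct `a, b, c` (and `i ≠ i', i''`, but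
`i' = i''` is allowed). -/
def ZigzagRow (u : Word n k) : Prop :=
  ∃ v, CommEquiv u v ∧ ∃ i i' i'' a b c : Fin n, a ≠ b ∧ a ≠ c ∧ b ≠ c ∧ i ≠ i' ∧ i ≠ i'' ∧
    v.Spells ![i, i, i', i''] ![a, b, b, c]

/-- `u ∼ x_{i a} x_{i b} x_{i' c} x_{i'' c}` with distinct `a, b, c` and distinct `i, i', i''`. -/
def TwoPairs (u : Word n k) : Prop :=
  ∃ v, CommEquiv u v ∧ ∃ i i' i'' a b c : Fin n, a ≠ b ∧ a ≠ c ∧ b ≠ c ∧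
    i ≠ i' ∧ i ≠ i'' ∧ i' ≠ i'' ∧ v.Spells ![i, i, i', i''] ![a, b, c, c]

open Classical in
/-- The coefficient `c_{IJ}`; it depends only on the commutation class of `x_{IJ}`. -/
def coeff (u : Word n k) : ℕ :=
  if Function.Injective u.row ∧ Function.Injective u.col then 2
  else if HasTriple u ∨ HasSquare u ∨ ZigzagCol u ∨ ZigzagRow u ∨ TwoPairs u then 0
  else 1

/-- The sum `∑ c_{IJ} F_{IJ}` over the commutation classes, for a quantity `F_{IJ}` that depends
only on the class. -/
def classSum {M : Type} [AddCommMonoid M] (F : Word n k → M) : M :=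
  ∑ C : CommClass n k, coeff C.out • F C.out

/-- The monomial `x_{IJ}` in a Fomin–Kirillov algebra. -/
def monomial {R : Type} [CommRing R] (p : Fin n → Fin n → R) (u : Word n k) : FKAlgebra R p :=
  (List.ofFn fun t => gen p (u.row t) (u.col t)).prod

end Expansion

/-! ### Quantum cohomology of the flag manifold -/

section Cohomology

/-- The number of inversions of a permutation. -/
def len {n : ℕ} (w : Equiv.Perm (Fin n)) : ℕ :=
  (Finset.univ.filter fun a : Fin n × Fin n => a.1 < a.2 ∧ w a.2 < w a.1).card

/-- The quantum cohomology ring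
`QH*(Fl_n, ℤ) = ℤ[q_1, …, q_{n-1}][x_1, …, x_n] / ⟨E_1^n, …, E_n^n⟩`. -/
abbrev QH (n : ℕ) : Type :=
  MvPolynomial (Fin n) (QCoeff ℤ n) ⧸
    Ideal.span (Set.range fun i : Fin n => quantumElem ℤ n n (i.val + 1))

/-- The Schubert class `σ_w`, the coset of the quantum Schubert polynomial. -/
def schubertClass {n : ℕ} (w : Equiv.Perm (Fin n)) : QH n :=
  Ideal.Quotient.mk _ (quantumSchubert ℤ w)

/-- Formal `ℤ[q]`-linear combinations of the symbols `σ_w`. -/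
abbrev SchubertModule (n : ℕ) : Type := Equiv.Perm (Fin n) →₀ QCoeff ℤ n

/-- The `ℤ[q]`-linear map that sends the symbol `σ_w` to the Schubert class `σ_w`. -/
def toQH (n : ℕ) : SchubertModule n →ₗ[QCoeff ℤ n] QH n :=
  Finsupp.linearCombination (QCoeff ℤ n) schubertClass

/-- `q_{ij} = q_i q_{i+1} ⋯ q_{j-1}`. -/
def qProd {n : ℕ} (i j : Fin n) : QCoeff ℤ n :=
  ∏ m ∈ Finset.univ.filter (fun m : Fin (n - 1) => i.val ≤ m.val ∧ m.val < j.val), MvPolynomial.X m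

/-- The quantum Bruhat operator `t_{ij}` (for `i < j`): it maps `σ_w` to `σ_{w s_{ij}}` if
`ℓ(w s_{ij}) = ℓ(w) + 1`, to `q_{ij} σ_{w s_{ij}}` if `ℓ(w s_{ij}) = ℓ(w) - 2(j - i) + 1`, and to
`0` otherwise. -/
def bruhatOp {n : ℕ} (i j : Fin n) : Module.End (QCoeff ℤ n) (SchubertModule n) :=
  Finsupp.linearCombination (QCoeff ℤ n) fun w : Equiv.Perm (Fin n) =>
    if len (w * Equiv.swap i j) = len w + 1 then Finsupp.single (w * Equiv.swap i j) 1
    else if (len (w * Equiv.swap i j) : ℤ) = len w - 2 * ((j.val : ℤ) - i.val) + 1 then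
      Finsupp.single (w * Equiv.swap i j) (qProd i j)
    else 0

/-- The operator `t_{IJ} = t_{i_1 j_1} t_{i_2 j_2} t_{i_3 j_3} t_{i_4 j_4}`. -/
def bruhatMonomial {n k : ℕ} (u : Word n k) : Module.End (QCoeff ℤ n) (SchubertModule n) :=
  (List.ofFn fun t => bruhatOp (u.row t) (u.col t)).prod

end Cohomology

end FominKirillov

end

set_option linter.unusedSectionVars false

noncomputable section

namespace FominKirillov

/-! Write E_i^m for the elementary or quantum elementary polynomials evaluated at the Dunkl
elements. The Schubert polynomial of w is e_2^k e_2^{k+1} - e_1^k e_3^{k+1}. It equals the dual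
Jacobi–Trudi determinant e_2 e_2 - e_1 e_3 in the first k variables, because the terms containing
x_{k+1} cancel. It is already a combination of standard products, so its quantization is E_2^k
E_2^{k+1} - E_1^k E_3^{k+1}. By the recursion of the E_i^m and commutativity this is (E_2^k)^2 -
E_1^k E_3^k + q_k (E_2^k - E_1^k E_1^{k-1}), and q = 0 gives the classical case.

Inside the algebra, E_1^k, 2 E_2^k and 6 E_3^k are explicit sums of words in the x_{ai} with a ≤ k <
i and distinct rows a. This Pieri-type formula follows by induction on k, moving one index from the
columns to the rows (`ElemRec.eq_sumTwo`, `ElemRec.eq_sumThree`). Hence 12 times the polynomial is a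
weighted sum over words of length four plus a multiple of q_k. Certain combinations of word types
are equal, by the relations, to minus that multiple of q_k (`BoxRel.weightTypes_eq`). Subtracting
them absorbs the quantum term and leaves the single weight `wordWeight`. This weight depends only on
which indices coincide, so a finite check (`classWeight_table`) shows that its total over each
commutation class is 12 c_{IJ}. The factor 12 comes from the symmetrised sums and is removed at the
end.

For the identification of the Schubert polynomial and for quantum cohomology, the algebra acts on
formal combinations of permutations by quantum Bruhat operators (`stepHom`). At q = 0 the operator
`demazure` intertwines this action with divided differences, so the Schubert polynomial of v sends
the identity to v (`polyOp_schubert`). For generic q, E_i^m acts on vectors without early descents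
as e_i^m does at q = 0 (`polyOp_quantumElem`), so quantum Schubert polynomials do the same. The
products of the E_i^m span modulo the ideal of relations, and a surjection between free modules of
the same rank n! is injective. Therefore the ideal is the kernel of f ↦ f(θ)·id
(`mem_quantumIdeal_iff`), and a product of Schubert classes can be read off by applying the
expansion of the first factor to the permutation of the second. -/

/-! ### Commutation classes of words of length four -/

/-- The Boolean kernel of a family indexed by `Fin 4`. -/
abbrev EqMat : Type := Fin 4 → Fin 4 → Bool

def eqMat {α : Type*} [DecidableEq α] (f : Fin 4 → α) : EqMat := fun s t => decide (f s = f t)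

/-- Reindexing of a kernel. -/
def EqMat.pull (R : EqMat) (a : Fin 4 → Fin 4) : EqMat := fun s t => R (a s) (a t)

/-- `a` inverts only pairs of letters without a common index. -/
def Admissible (R C : EqMat) (a : Fin 4 → Fin 4) : Prop :=
  ∀ s t, s < t → a t < a s → R (a s) (a t) = false ∧ C (a s) (a t) = false

instance (R C : EqMat) (a : Fin 4 → Fin 4) : Decidable (Admissible R C a) := by
  unfold Admissible; infer_instance

/-- `R` is the kernel of the pattern `(a, b, c, d)`. -/
def EqMat.Is (R : EqMat) (a b c d : ℕ) : Prop :=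
  R 0 1 = (a == b) ∧ R 0 2 = (a == c) ∧ R 0 3 = (a == d) ∧ R 1 2 = (b == c) ∧ R 1 3 = (b == d) ∧
    R 2 3 = (c == d)

instance (R : EqMat) (a b c d : ℕ) : Decidable (R.Is a b c d) := by
  unfold EqMat.Is; infer_instance

/-- Twice the coefficient of a two-letter word in the second row-distinct sum, symmetrised. -/
def weightTwo (R C : EqMat) (s t : Fin 4) : ℤ :=
  if R s t then 0 else if C s t then 2 else 1

/-- The multiplicity of a three-letter word in 6 E_3: one for the product of row sums, one for each
pair of equal columns, and two more from the cyclic terms when all columns agree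
(`offThree_tripleSum`). -/
def weightThree (R C : EqMat) (s t u : Fin 4) : ℤ :=
  if R s t || R t u || R s u then 0
  else 1 + (if C s t then 1 else 0) + (if C t u then 1 else 0) + (if C s u then 1 else 0) +
    (if C s t && C t u then 2 else 0)

/-- The indicator of a pattern. -/
def EqMat.ind (R : EqMat) (a b c d : ℕ) : ℤ := if R.Is a b c d then 1 else 0

/-- The contribution of the types with two different rows. -/
def weightTypesTwo (R C : EqMat) : ℤ :=
  R.ind 0 0 1 1 * (2 * C.ind 0 0 1 0 + C.ind 0 0 1 1 + 2 * C.ind 0 1 0 0 - 2 * C.ind 0 1 1 0 +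
    2 * C.ind 0 0 1 2) +
  R.ind 0 1 0 1 * (2 * C.ind 0 0 0 0 + 2 * C.ind 0 0 0 1 + 2 * C.ind 0 1 1 1) +
  R.ind 0 1 1 0 * (2 * C.ind 0 0 0 0)

/-- The contribution of the types with three different rows. -/
def weightTypesThree (R C : EqMat) : ℤ :=
  R.ind 0 0 1 2 * (C.ind 0 0 1 2 - 2 * C.ind 0 0 0 0 - 2 * C.ind 0 1 0 1 - 2 * C.ind 0 1 1 1) +
  R.ind 0 1 1 2 * (2 * C.ind 0 0 0 0 + 2 * C.ind 0 0 0 1 + 2 * C.ind 0 0 1 0 +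
    2 * C.ind 0 0 1 1) +
  R.ind 0 1 2 1 * (2 * C.ind 0 0 0 0) +
  R.ind 0 1 0 2 * (2 * C.ind 0 0 0 1)

/-- A weight on words whose sum over each commutation class is twelve times the coefficient. -/
def wordWeight (R C : EqMat) : ℤ :=
  3 * (weightTwo R C 0 1 * weightTwo R C 2 3) - 2 * weightThree R C 1 2 3 -
    6 * weightTypesTwo R C - 6 * weightTypesThree R C

/-- The pattern of a word that has a square or one of the forbidden zigzags. -/
def Forbidden (R C : EqMat) : Prop :=
  (R 0 1 && C 0 1 || R 1 2 && C 1 2 || R 2 3 && C 2 3) = true ∨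
  (R.Is 0 1 1 2 ∧ C.Is 0 0 1 1) ∨
  (C.Is 0 1 1 2 ∧ R 0 1 = true ∧ R 0 2 = false ∧ R 0 3 = false) ∨
  (R.Is 0 0 1 2 ∧ C.Is 0 1 2 2)

instance (R C : EqMat) : Decidable (Forbidden R C) := by unfold Forbidden; infer_instance

def EqMat.Triple (R : EqMat) : Prop :=
  (R 0 1 && R 1 2 || R 0 1 && R 1 3 || R 0 2 && R 2 3 || R 1 2 && R 2 3) = true

instance (R : EqMat) : Decidable R.Triple := by unfold EqMat.Triple; infer_instance

/-- The permutations of `Fin 4`, by their values. -/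
def permTable : List (Fin 4 → Fin 4) :=
  [![0,1,2,3], ![0,1,3,2], ![0,2,1,3], ![0,2,3,1], ![0,3,1,2], ![0,3,2,1],
   ![1,0,2,3], ![1,0,3,2], ![1,2,0,3], ![1,2,3,0], ![1,3,0,2], ![1,3,2,0],
   ![2,0,1,3], ![2,0,3,1], ![2,1,0,3], ![2,1,3,0], ![2,3,0,1], ![2,3,1,0],
   ![3,0,1,2], ![3,0,2,1], ![3,1,0,2], ![3,1,2,0], ![3,2,0,1], ![3,2,1,0]]

/-- Representatives of the kernels of families indexed by `Fin 4`. -/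
def kernelTable : List (Fin 4 → Fin 4) :=
  [![0,0,0,0], ![0,0,0,3], ![0,0,2,0], ![0,0,2,2], ![0,0,2,3],
   ![0,1,0,0], ![0,1,0,1], ![0,1,0,3], ![0,1,1,0], ![0,1,1,1], ![0,1,1,3],
   ![0,1,2,0], ![0,1,2,1], ![0,1,2,2], ![0,1,2,3]]

/-- The coefficient of a word in terms of the kernels of its index sequences. -/
def kernelCoeff (R C : EqMat) : ℤ :=
  if R.Is 0 1 2 3 ∧ C.Is 0 1 2 3 then 2
  else if R.Triple ∨ C.Triple ∨
    ∃ a ∈ permTable, Admissible R C a ∧ Forbidden (R.pull a) (C.pull a) then 0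
  else 1

/-- Each word of a commutation class comes from exactly one admissible permutation
(`sum_commClass`), so this is the total of `wordWeight` over the class. -/
def classWeight (R C : EqMat) : ℤ :=
  (permTable.map fun a => if Admissible R C a then wordWeight (R.pull a) (C.pull a) else 0).sum

/-- The combinatorial core. Admissibility, weight and coefficient only see which indices coincide,
so 15 · 15 pairs of kernels with 24 permutations each cover all words. -/
theorem classWeight_table :
    ∀ r ∈ kernelTable, ∀ c ∈ kernelTable,
      classWeight (eqMat r) (eqMat c) = 12 * kernelCoeff (eqMat r) (eqMat c) := by
  decide +kernel

/-- Replace each label by the first position that carries it. The resulting maps are idempotent and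
never exceed the identity, and `kernelTable` lists all fifteen of them. -/
theorem exists_kernelTable {α : Type*} [DecidableEq α] (r : Fin 4 → α) :
    ∃ f ∈ kernelTable, eqMat r = eqMat f := by
  have h : ∀ t, ∃ s, r s = r t ∧ ∀ s', r s' = r t → s ≤ s' := by
    intro t
    obtain ⟨s, hs, hm⟩ := Finset.exists_min_image (Finset.univ.filter fun s => r s = r t) id
      ⟨t, by simp⟩
    exact ⟨s, by simpa using hs, fun s' h => hm s' (by simpa using h)⟩
  choose f hf hm using h
  have key : ∀ f : Fin 4 → Fin 4, (∀ t, f t ≤ t) → (∀ t, f (f t) = f t) → f ∈ kernelTable := by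
    decide +kernel
  refine ⟨f, key f (fun t => hm t t rfl) fun t => le_antisymm (hm _ _ rfl) (hm _ _ ?_), ?_⟩
  · rw [hf, hf]
  · funext s t
    simp only [eqMat, decide_eq_decide]
    refine ⟨fun h => le_antisymm (hm _ _ ?_) (hm _ _ ?_), fun h => ?_⟩
    · rw [hf, h]
    · rw [hf, h]
    · rw [← hf s, h, hf]

theorem mem_permTable (f : Fin 4 → Fin 4) : f ∈ permTable ↔ Function.Injective f := by
  have : ∀ f : Fin 4 → Fin 4, f ∈ permTable ↔ ∀ s t, f s = f t → s = t := by decide +kernel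
  exact this f

theorem sum_permTable {M : Type*} [AddCommMonoid M] (G : (Fin 4 → Fin 4) → M) :
    (permTable.map G).sum = ∑ σ : Equiv.Perm (Fin 4), G σ := by
  have hn : permTable.Nodup := by decide +kernel
  rw [← List.sum_toFinset G hn]
  symm
  refine Finset.sum_bij (fun σ _ => ⇑σ) (fun σ _ => ?_) (fun σ _ τ _ h => ?_) (fun f hf => ?_)
    (fun _ _ => rfl)
  · simpa [mem_permTable] using σ.injective
  · exact DFunLike.coe_injective h
  · rw [List.mem_toFinset, mem_permTable] at hf
    exact ⟨Equiv.ofBijective f (Finite.injective_iff_bijective.1 hf), Finset.mem_univ _, rfl⟩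

variable {n k : ℕ}

/-- `σ` only inverts pairs of letters of `u` that commute. -/
def Word.Adm (u : Word n k) (σ : Equiv.Perm (Fin 4)) : Prop :=
  Admissible (eqMat u.row) (eqMat u.col) σ

theorem Word.adm_iff (u : Word n k) (σ : Equiv.Perm (Fin 4)) :
    u.Adm σ ↔ ∀ s t, s < t → σ t < σ s → u.row (σ s) ≠ u.row (σ t) ∧ u.col (σ s) ≠ u.col (σ t) := by
  simp [Word.Adm, Admissible, eqMat]

/-- Bubble sort: a descent of σ at neighbouring positions exchanges two commuting letters. Undoing
it keeps σ admissible and raises `ascentWeight`, which is bounded above. -/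
theorem commEquiv_of_adm (u : Word n k) (σ : Equiv.Perm (Fin 4)) (h : u.Adm σ) :
    CommEquiv u (u ∘ σ) := by
  obtain ⟨N, hN⟩ : ∃ N, N = ∑ a : Fin 4, a.val * 3 - ascentWeight σ := ⟨_, rfl⟩
  induction N using Nat.strong_induction_on generalizing σ with
  | _ N ih =>
  by_cases hσ : ∀ s t : Fin 4, s.val + 1 = t.val → σ s < σ t
  · have h1 : σ = 1 := by
      have h01 := hσ 0 1 rfl
      have h12 := hσ 1 2 rfl
      have h23 := hσ 2 3 rfl
      ext t
      simp only [Fin.lt_def] at h01 h12 h23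
      have := (σ 3).isLt
      fin_cases t <;> simp <;> omega
    rw [h1]
    exact (commSetoid n k).refl u
  · push Not at hσ
    obtain ⟨s, t, hst, hle⟩ := hσ
    have hlt : s < t := by rw [Fin.lt_def]; omega
    have hd : σ t < σ s := lt_of_le_of_ne hle (fun e => hlt.ne' (σ.injective e))
    set τ := σ * Equiv.swap s t with hτ
    have e1 : τ s = σ t := by simp [hτ]
    have e2 : τ t = σ s := by simp [hτ]
    have hback : τ * Equiv.swap s t = σ := by simp [hτ, mul_assoc]
    have hw : ascentWeight σ < ascentWeight τ := by
      conv_lhs => rw [← hback]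
      exact ascentWeight_lt τ s t hlt (by rw [e1, e2]; exact hd)
    have hb : ascentWeight τ ≤ ∑ a : Fin 4, a.val * 3 :=
      Finset.sum_le_sum fun a _ => Nat.mul_le_mul_left _ (by have := (τ a).isLt; omega)
    have hτa : u.Adm τ := by
      rw [Word.adm_iff] at h ⊢
      intro x y hxy hτxy
      have hx : τ x = σ (Equiv.swap s t x) := rfl
      have hy : τ y = σ (Equiv.swap s t y) := rfl
      rw [hx, hy] at hτxy ⊢
      refine h _ _ ?_ hτxy
      -- Exchanging two neighbouring positions reverses no pair of positions other than themselves.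
      have hcase : x = s ∧ y = t ∨ Equiv.swap s t x < Equiv.swap s t y := by
        clear * - hst hxy
        revert s t x y
        decide +kernel
      rcases hcase with ⟨rfl, rfl⟩ | h'
      · rw [Equiv.swap_apply_left, Equiv.swap_apply_right] at hτxy
        exact absurd hτxy hd.not_gt
      · exact h'
    have hne := (u.adm_iff σ).1 h s t hlt hd
    refine (commSetoid n k).trans (ih _ (by omega) τ hτa rfl) (Relation.EqvGen.rel _ _ ?_)
    refine ⟨s, t, hst, ?_, ?_, ?_⟩
    · simpa [Word.row, e1, e2] using hne.1.symm
    · simpa [Word.col, e1, e2] using hne.2.symm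
    · rw [Function.comp_assoc]
      congr 1
      rw [← Equiv.Perm.coe_mul, hback]

/-- Admissible permutations contain the single exchanges and are closed under inverses and
composition, because a pair inverted by a composite is inverted at one of its two stages. -/
theorem adm_of_commEquiv {u v : Word n k} (h : CommEquiv u v) :
    ∃ σ : Equiv.Perm (Fin 4), u.Adm σ ∧ v = u ∘ σ := by
  change Relation.EqvGen CommStep u v at h
  induction h with
  | rel u v h =>
    obtain ⟨s, t, hst, h1, h2, h3⟩ := h
    refine ⟨Equiv.swap s t, ?_, h3⟩
    rw [Word.adm_iff]
    intro x y hxy hlt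
    have hcase : x = s ∧ y = t := by
      clear * - hst hxy hlt
      revert s t x y
      decide +kernel
    rw [hcase.1, hcase.2, Equiv.swap_apply_left, Equiv.swap_apply_right]
    exact ⟨h1.symm, h2.symm⟩
  | refl u =>
    exact ⟨1, by rw [Word.adm_iff]; intro x y h h'; exact absurd h h'.not_gt, rfl⟩
  | symm u v _ ih =>
    obtain ⟨σ, h, rfl⟩ := ih
    refine ⟨σ⁻¹, ?_, by funext x; simp⟩
    rw [Word.adm_iff] at h ⊢
    intro x y hxy hlt
    have := h (σ⁻¹ y) (σ⁻¹ x) hlt (by simpa using hxy)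
    have e : ∀ z, σ (σ⁻¹ z) = z := fun z => by simp
    rw [e, e] at this
    have e' : ∀ z, (u ∘ σ) (σ⁻¹ z) = u z := fun z => by simp
    simp only [Word.row, Word.col, e'] at this ⊢
    exact ⟨this.1.symm, this.2.symm⟩
  | trans u v w _ _ ih1 ih2 =>
    obtain ⟨σ, h, rfl⟩ := ih1
    obtain ⟨τ, h', rfl⟩ := ih2
    refine ⟨σ * τ, ?_, rfl⟩
    rw [Word.adm_iff] at h h' ⊢
    intro x y hxy hlt
    rcases lt_trichotomy (τ x) (τ y) with h1 | h1 | h1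
    · exact h _ _ h1 hlt
    · exact absurd (τ.injective h1) hxy.ne
    · exact h' x y hxy h1

/-- An admissible permutation is determined by the word it produces. -/
theorem adm_injective (u : Word n k) {σ τ : Equiv.Perm (Fin 4)} (hσ : u.Adm σ) (hτ : u.Adm τ)
    (h : u ∘ σ = u ∘ τ) : σ = τ := by
  rw [Word.adm_iff] at hσ hτ
  have key : ∀ x y, x < y → (σ x < σ y ∧ τ x < τ y) ∨ (σ x ≠ σ y ∧ u (σ x) ≠ u (σ y)) := by
    intro x y hxy
    by_cases h1 : u (σ x) = u (σ y)
    · left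
      have h2 : u (τ x) = u (τ y) := by
        rw [← Function.comp_apply (f := u), ← Function.comp_apply (f := u) (g := τ), ← h]; exact h1
      constructor
      · refine lt_of_le_of_ne (le_of_not_gt fun h' => (hσ x y hxy h').1 ?_)
          (fun e => hxy.ne (σ.injective e))
        simp [Word.row, h1]
      · refine lt_of_le_of_ne (le_of_not_gt fun h' => (hτ x y hxy h').1 ?_)
          (fun e => hxy.ne (τ.injective e))
        simp [Word.row, h2]
    · exact Or.inr ⟨fun e => h1 (by rw [e]), h1⟩
  -- the permutation `π = σ⁻¹ τ` preserves letters of `u ∘ σ` and is monotone on each of them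
  set π := σ⁻¹ * τ with hπ
  have hu : ∀ x, u (σ (π x)) = u (σ x) := by
    intro x
    have := congrFun h x
    simpa [hπ] using this.symm
  have hm : ∀ x y, x < y → u (σ x) = u (σ y) → π x < π y := by
    intro x y hxy he
    have h1 : τ x < τ y := by
      rcases key x y hxy with h1 | h1
      · exact h1.2
      · exact absurd he h1.2
    rcases lt_trichotomy (π x) (π y) with h2 | h2 | h2
    · exact h2
    · exact absurd (π.injective h2) hxy.ne
    · rcases key _ _ h2 with h3 | h3
      · have h4 : σ (π y) = τ y := by simp [hπ]
        have h5 : σ (π x) = τ x := by simp [hπ]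
        rw [h4, h5] at h3
        exact absurd h3.1 h1.not_gt
      · exact absurd (by rw [hu, hu, he]) h3.2
  -- A position moved down by π carries the same letter as its image, so by monotonicity the image
  -- moves down as well, and well-founded induction excludes this. Moves upwards are excluded in the
  -- same way.
  have hfix : ∀ x, π x = x := by
    have hlt : ∀ x, ¬ π x < x := by
      intro x
      induction x using WellFoundedLT.induction with
      | _ x ih =>
        intro hx
        exact ih _ hx (hm _ _ hx (hu x))
    have hgt : ∀ x, ¬ x < π x := by
      intro x
      induction x using WellFoundedGT.induction with
      | _ x ih =>
        intro hx
        exact ih _ hx (hm _ _ hx (hu x).symm)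
    intro x
    exact le_antisymm (le_of_not_gt (hgt x)) (le_of_not_gt (hlt x))
  have : π = 1 := Equiv.ext hfix
  rw [hπ, inv_mul_eq_one] at this
  exact this

open Classical in
theorem sum_commClass {M : Type*} [AddCommMonoid M] (u : Word n k) (G : Word n k → M) :
    ∑ v ∈ Finset.univ.filter (fun v => CommEquiv u v), G v =
      ∑ σ ∈ Finset.univ.filter (fun σ => u.Adm σ), G (u ∘ σ) := by
  symm
  refine Finset.sum_bij (fun σ _ => u ∘ σ) (fun σ hσ => ?_) (fun σ hσ τ hτ h => ?_)
    (fun v hv => ?_) (fun _ _ => rfl)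
  · simpa using commEquiv_of_adm u σ (by simpa using hσ)
  · exact adm_injective u (by simpa using hσ) (by simpa using hτ) h
  · obtain ⟨σ, h, rfl⟩ := adm_of_commEquiv (u := u) (v := v) (by simpa using hv)
    exact ⟨σ, by simpa using h, rfl⟩

theorem eqMat_is {α : Type*} [DecidableEq α] (r : Fin 4 → α) (a b c d : ℕ) :
    (eqMat r).Is a b c d ↔ (r 0 = r 1 ↔ a = b) ∧ (r 0 = r 2 ↔ a = c) ∧ (r 0 = r 3 ↔ a = d) ∧
      (r 1 = r 2 ↔ b = c) ∧ (r 1 = r 3 ↔ b = d) ∧ (r 2 = r 3 ↔ c = d) := by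
  have h : ∀ (P : Prop) [Decidable P] (x y : ℕ), decide P = (x == y) ↔ (P ↔ x = y) := by
    intro P _ x y
    rw [Bool.eq_iff_iff, decide_eq_true_eq, beq_iff_eq]
  unfold EqMat.Is eqMat
  simp only [h]

theorem injective_iff_is {α : Type*} [DecidableEq α] (r : Fin 4 → α) :
    Function.Injective r ↔ (eqMat r).Is 0 1 2 3 := by
  rw [eqMat_is]
  constructor
  · intro h
    simp [h.eq_iff]
  · intro h x y hxy
    simp only [Nat.reduceEqDiff, iff_false, OfNat.zero_ne_ofNat, zero_ne_one] at h
    fin_cases x <;> fin_cases y <;> first | rfl | (exfalso; simp at hxy; grind)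

open Classical in
theorem triple_iff {α : Type*} [DecidableEq α] (r : Fin 4 → α) :
    (∃ a, 3 ≤ (Finset.univ.filter fun t => r t = a).card) ↔ (eqMat r).Triple := by
  have hc : ∀ a, (Finset.univ.filter fun t => r t = a).card =
      (if r 0 = a then 1 else 0) + (if r 1 = a then 1 else 0) + (if r 2 = a then 1 else 0) +
        (if r 3 = a then 1 else 0) := by
    intro a
    rw [Finset.card_filter, Fin.sum_univ_four]
  simp only [hc, EqMat.Triple, eqMat, Bool.or_eq_true, Bool.and_eq_true, decide_eq_true_eq]
  constructor
  · rintro ⟨a, h⟩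
    split_ifs at h <;> first | omega | grind
  · rintro (((⟨h1, h2⟩ | ⟨h1, h2⟩) | ⟨h1, h2⟩) | ⟨h1, h2⟩)
    · exact ⟨r 0, by simp [← h2, ← h1]⟩
    · exact ⟨r 0, by simp [← h2, ← h1]⟩
    · exact ⟨r 0, by simp [← h2, ← h1]⟩
    · exact ⟨r 1, by simp [← h2, ← h1]⟩

theorem hasTriple_iff (u : Word n k) :
    HasTriple u ↔ (eqMat u.row).Triple ∨ (eqMat u.col).Triple := by
  rw [← triple_iff, ← triple_iff, HasTriple, exists_or]

theorem forbidden_iff (v : Word n k) :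
    Forbidden (eqMat v.row) (eqMat v.col) ↔
      (∃ s t : Fin 4, s.val + 1 = t.val ∧ v s = v t) ∨
      (∃ a b e c d : Fin n, a ≠ b ∧ a ≠ e ∧ b ≠ e ∧ c ≠ d ∧ v.Spells ![a, b, b, e] ![c, c, d, d]) ∨
      (∃ i i' i'' a b c : Fin n, a ≠ b ∧ a ≠ c ∧ b ≠ c ∧ i ≠ i' ∧ i ≠ i'' ∧
        v.Spells ![i, i, i', i''] ![a, b, b, c]) ∨
      (∃ i i' i'' a b c : Fin n, a ≠ b ∧ a ≠ c ∧ b ≠ c ∧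
        i ≠ i' ∧ i ≠ i'' ∧ i' ≠ i'' ∧ v.Spells ![i, i, i', i''] ![a, b, c, c]) := by
  unfold Forbidden
  refine or_congr ?_ (or_congr ?_ (or_congr ?_ ?_))
  · have hv : ∀ s t, v s = v t ↔ v.row s = v.row t ∧ v.col s = v.col t := by
      intro s t
      simp only [Word.row, Word.col, Subtype.ext_iff, Prod.ext_iff]
    simp only [hv, eqMat, Bool.or_eq_true, Bool.and_eq_true, decide_eq_true_eq]
    constructor
    · rintro ((h | h) | h)
      · exact ⟨0, 1, rfl, h⟩
      · exact ⟨1, 2, rfl, h⟩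
      · exact ⟨2, 3, rfl, h⟩
    · rintro ⟨s, t, hst, h⟩
      have : s = 0 ∧ t = 1 ∨ s = 1 ∧ t = 2 ∨ s = 2 ∧ t = 3 := by omega
      rcases this with ⟨rfl, rfl⟩ | ⟨rfl, rfl⟩ | ⟨rfl, rfl⟩ <;> tauto
  · rw [eqMat_is, eqMat_is]
    constructor
    · intro h
      simp at h
      obtain ⟨⟨h1, h2, h3, h4, h5, h6⟩, k1, k2, k3, k4, k5, k6⟩ := h
      refine ⟨v.row 0, v.row 1, v.row 3, v.col 0, v.col 2, h1, h3, h5, k2, ?_, ?_⟩ <;> funext t <;>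
        fin_cases t <;> simp [*]
    · rintro ⟨a, b, e, c, d, h1, h2, h3, h4, hr, hc⟩
      rw [hr, hc]
      simp [*]
  · rw [eqMat_is]
    simp only [eqMat, decide_eq_true_eq, decide_eq_false_iff_not]
    constructor
    · intro h
      simp at h
      obtain ⟨⟨h1, h2, h3, h4, h5, h6⟩, k1, k2, k3⟩ := h
      refine ⟨v.row 0, v.row 2, v.row 3, v.col 0, v.col 1, v.col 3, h1, h3, h5, k2, k3, ?_, ?_⟩ <;>
        funext t <;> fin_cases t <;> simp [*]
    · rintro ⟨i, i', i'', a, b, c, h1, h2, h3, h4, h5, hr, hc⟩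
      rw [hr, hc]
      simp [*]
  · rw [eqMat_is, eqMat_is]
    constructor
    · intro h
      simp at h
      obtain ⟨⟨h1, h2, h3, h4, h5, h6⟩, k1, k2, k3, k4, k5, k6⟩ := h
      refine ⟨v.row 0, v.row 2, v.row 3, v.col 0, v.col 1, v.col 2, k1, k2, k4, h2, h3, h6, ?_, ?_⟩
        <;> funext t <;> fin_cases t <;> simp [*]
    · rintro ⟨i, i', i'', a, b, c, h1, h2, h3, h4, h5, h6, hr, hc⟩
      rw [hr, hc]
      simp [*]

/-- A search over the commutation class becomes a search over admissible permutations, which makes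
the coefficient a function of the two kernels. -/
theorem coeff_eq (u : Word n k) : (coeff u : ℤ) = kernelCoeff (eqMat u.row) (eqMat u.col) := by
  have h1 : (HasTriple u ∨ HasSquare u ∨ ZigzagCol u ∨ ZigzagRow u ∨ TwoPairs u) ↔
      ((eqMat u.row).Triple ∨ (eqMat u.col).Triple ∨ ∃ a ∈ permTable,
        Admissible (eqMat u.row) (eqMat u.col) a ∧
          Forbidden ((eqMat u.row).pull a) ((eqMat u.col).pull a)) := by
    rw [hasTriple_iff, or_assoc]
    refine or_congr Iff.rfl (or_congr Iff.rfl ?_)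
    rw [HasSquare, ZigzagCol, ZigzagRow, TwoPairs, ← exists_or, ← exists_or, ← exists_or]
    simp only [← and_or_left]
    constructor
    · rintro ⟨v, huv, h⟩
      obtain ⟨σ, hσ, rfl⟩ := adm_of_commEquiv huv
      exact ⟨σ, (mem_permTable _).2 σ.injective, hσ, (forbidden_iff _).2 h⟩
    · rintro ⟨a, ha, had, h⟩
      obtain ⟨σ, rfl⟩ : ∃ σ : Equiv.Perm (Fin 4), ⇑σ = a :=
        ⟨Equiv.ofBijective a (Finite.injective_iff_bijective.1 ((mem_permTable a).1 ha)), rfl⟩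
      exact ⟨u ∘ σ, commEquiv_of_adm u σ had, (forbidden_iff (u ∘ σ)).1 h⟩
  unfold coeff kernelCoeff
  simp only [injective_iff_is, h1]
  split_ifs <;> simp

theorem eqMat_comp {α : Type*} [DecidableEq α] (r : Fin 4 → α) (a : Fin 4 → Fin 4) :
    eqMat (r ∘ a) = (eqMat r).pull a := rfl

theorem sum_wordWeight (u : Word n k) :
    ∑ σ : Equiv.Perm (Fin 4), (if Admissible (eqMat u.row) (eqMat u.col) σ then
      wordWeight (eqMat (u.row ∘ σ)) (eqMat (u.col ∘ σ)) else 0) = 12 * (coeff u : ℤ) := by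
  rw [coeff_eq]
  obtain ⟨r, hr, hr'⟩ := exists_kernelTable u.row
  obtain ⟨c, hc, hc'⟩ := exists_kernelTable u.col
  simp only [eqMat_comp]
  rw [hr', hc', ← classWeight_table r hr c hc, classWeight, sum_permTable]

theorem CommEquiv.map_eq {M : Type*} {F : Word n k → M}
    (hF : ∀ u v, CommStep u v → F u = F v) {u v : Word n k} (h : CommEquiv u v) : F u = F v := by
  change Relation.EqvGen CommStep u v at h
  induction h with
  | rel u v h => exact hF u v h
  | refl u => rfl
  | symm u v _ ih => exact ih.symm
  | trans u v w _ _ h1 h2 => exact h1.trans h2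

/-- The sum over commutation classes as a weighted sum over words. -/
theorem classSum_eq {M : Type} [AddCommGroup M] (F : Word n k → M)
    (hF : ∀ u v, CommStep u v → F u = F v) :
    (12 : ℤ) • classSum F = ∑ u, wordWeight (eqMat u.row) (eqMat u.col) • F u := by
  classical
  unfold classSum
  rw [Finset.smul_sum, ← Finset.sum_fiberwise_of_maps_to (s := Finset.univ)
    (t := (Finset.univ : Finset (CommClass n k))) (g := fun u => Quotient.mk _ u)
    (fun _ _ => Finset.mem_univ _)]
  refine Finset.sum_congr rfl fun C _ => ?_
  have hfil : (Finset.univ.filter fun u : Word n k => Quotient.mk _ u = C) =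
      Finset.univ.filter fun v => CommEquiv C.out v := by
    ext v
    simp only [Finset.mem_filter, Finset.mem_univ, true_and]
    rw [← Quotient.out_eq C, Quotient.eq, Quotient.out_eq]
    exact ⟨fun h => (commSetoid n k).symm h, fun h => (commSetoid n k).symm h⟩
  rw [hfil]
  have h1 : ∑ v ∈ Finset.univ.filter (fun v => CommEquiv C.out v),
      wordWeight (eqMat v.row) (eqMat v.col) • F v =
      (∑ v ∈ Finset.univ.filter (fun v => CommEquiv C.out v),
        wordWeight (eqMat v.row) (eqMat v.col)) • F C.out := by
    rw [Finset.sum_smul]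
    refine Finset.sum_congr rfl fun v hv => ?_
    rw [CommEquiv.map_eq hF (u := C.out) (v := v) (by simpa using hv)]
  rw [h1, sum_commClass, Finset.sum_filter]
  have h2 := sum_wordWeight C.out
  rw [← natCast_zsmul, smul_smul, ← h2]
  congr 1
  refine Finset.sum_congr rfl fun σ _ => ?_
  have e1 : Word.row (C.out ∘ σ) = C.out.row ∘ σ := rfl
  have e2 : Word.col (C.out ∘ σ) = C.out.col ∘ σ := rfl
  rw [e1, e2]
  by_cases h : C.out.Adm σ
  · exact (if_pos (c := Admissible _ _ _) h).trans (if_pos h).symm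
  · exact (if_neg (c := Admissible _ _ _) h).trans (if_neg h).symm

/-! ### Sums over distinct labels -/

section Labels

variable {ι κ A : Type*} [Fintype ι] [DecidableEq ι] [Fintype κ] [DecidableEq κ] [AddCommGroup A]

/-- The sum over pairs of distinct labels. -/
def offTwo (f : ι → ι → A) : A :=
  ∑ v ∈ Finset.univ.filter (fun v : ι × ι => v.1 ≠ v.2), f v.1 v.2

/-- The sum over triples of distinct labels. -/
def offThree (f : ι → ι → ι → A) : A :=
  ∑ v ∈ Finset.univ.filter (fun v : ι × ι × ι => v.1 ≠ v.2.1 ∧ v.1 ≠ v.2.2 ∧ v.2.1 ≠ v.2.2),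
    f v.1 v.2.1 v.2.2

theorem offTwo_congr {f g : ι → ι → A} (h : ∀ a b, a ≠ b → f a b = g a b) : offTwo f = offTwo g :=
  Finset.sum_congr rfl fun v hv => h _ _ (by simpa using hv)

theorem offThree_congr {f g : ι → ι → ι → A}
    (h : ∀ a b c, a ≠ b → a ≠ c → b ≠ c → f a b c = g a b c) : offThree f = offThree g :=
  Finset.sum_congr rfl fun v hv => by
    simp only [Finset.mem_filter, Finset.mem_univ, true_and] at hv
    exact h _ _ _ hv.1 hv.2.1 hv.2.2

theorem offTwo_add (f g : ι → ι → A) : offTwo (fun a b => f a b + g a b) = offTwo f + offTwo g :=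
  Finset.sum_add_distrib
theorem offTwo_sub (f g : ι → ι → A) : offTwo (fun a b => f a b - g a b) = offTwo f - offTwo g :=
  Finset.sum_sub_distrib ..
theorem offTwo_neg (f : ι → ι → A) : offTwo (fun a b => - f a b) = - offTwo f :=
  Finset.sum_neg_distrib ..
theorem offThree_add (f g : ι → ι → ι → A) :
    offThree (fun a b c => f a b c + g a b c) = offThree f + offThree g :=
  Finset.sum_add_distrib
theorem offThree_sub (f g : ι → ι → ι → A) :
    offThree (fun a b c => f a b c - g a b c) = offThree f - offThree g :=
  Finset.sum_sub_distrib ..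
theorem offThree_neg (f : ι → ι → ι → A) : offThree (fun a b c => - f a b c) = - offThree f :=
  Finset.sum_neg_distrib ..

theorem offTwo_zero : offTwo (fun _ _ : ι => (0 : A)) = 0 := Finset.sum_const_zero
theorem offTwo_swap (f : ι → ι → A) : offTwo (fun a b => f b a) = offTwo f := by
  refine Finset.sum_bij' (fun v _ => v.swap) (fun v _ => v.swap) ?_ ?_ ?_ ?_ ?_ <;>
    simp [eq_comm]

theorem offThree_swap_left (f : ι → ι → ι → A) : offThree (fun a b c => f b a c) = offThree f := by
  refine Finset.sum_bij' (fun v _ => (v.2.1, v.1, v.2.2)) (fun v _ => (v.2.1, v.1, v.2.2))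
    ?_ ?_ ?_ ?_ ?_ <;> simp <;> tauto

theorem offThree_swap_right (f : ι → ι → ι → A) : offThree (fun a b c => f a c b) = offThree f := by
  refine Finset.sum_bij' (fun v _ => (v.1, v.2.2, v.2.1)) (fun v _ => (v.1, v.2.2, v.2.1))
    ?_ ?_ ?_ ?_ ?_ <;> simp <;> tauto

theorem sum_sum_eq_offTwo (f : ι → ι → A) : ∑ a, ∑ b, f a b = ∑ a, f a a + offTwo f := by
  rw [← Finset.sum_product', Finset.univ_product_univ,
    ← Finset.sum_filter_add_sum_filter_not Finset.univ (fun v : ι × ι => v.1 = v.2)]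
  refine congrArg₂ (· + ·) ?_ rfl
  refine Finset.sum_bij' (fun v _ => v.1) (fun a _ => (a, a)) ?_ ?_ ?_ ?_ ?_ <;> aesop

theorem offTwo_eq_sum (f : ι → ι → A) :
    offTwo f = ∑ a, ∑ b ∈ Finset.univ.erase a, f a b := by
  have h : ∀ a, ∑ b ∈ Finset.univ.erase a, f a b = ∑ b, f a b - f a a := fun a => by
    rw [Finset.sum_erase_eq_sub (Finset.mem_univ a)]
  simp only [h, Finset.sum_sub_distrib, sum_sum_eq_offTwo]
  abel

/-- The unrestricted label either avoids the two distinct ones or equals exactly one of them. -/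
theorem sum_offTwo_eq (f : ι → ι → ι → A) :
    ∑ a, offTwo (fun b c => f a b c) =
      offThree f + offTwo (fun a b => f a a b) + offTwo (fun a b => f a b a) := by
  have key : ∀ g : ι → ι → ι → A, offThree g = ∑ a, ∑ b, ∑ c,
      if a ≠ b ∧ a ≠ c ∧ b ≠ c then g a b c else 0 := by
    intro g
    simp only [offThree, Finset.sum_filter]
    rw [Fintype.sum_prod_type]
    exact Finset.sum_congr rfl fun a _ => by rw [Fintype.sum_prod_type]
  have key2 : ∀ g : ι → ι → A, offTwo g = ∑ a, ∑ b, if a ≠ b then g a b else 0 := by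
    intro g
    simp only [offTwo, Finset.sum_filter]
    rw [Fintype.sum_prod_type]
  have h1 : ∀ a, offTwo (fun b c => f a b c) = ∑ b, ∑ c,
      ((if a ≠ b ∧ a ≠ c ∧ b ≠ c then f a b c else 0) +
        (if b = a then if a ≠ c then f a a c else 0 else 0) +
        (if c = a then if a ≠ b then f a b a else 0 else 0)) := by
    intro a
    rw [key2]
    refine Finset.sum_congr rfl fun b _ => Finset.sum_congr rfl fun c _ => ?_
    by_cases hb : b = a
    · subst hb
      by_cases hc : b = c
      · subst hc; simp
      · simp [hc, Ne.symm hc]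
    · by_cases hc : c = a
      · subst hc; simp [hb, Ne.symm hb]
      · simp [hb, hc, Ne.symm hb, Ne.symm hc]
  simp only [h1, Finset.sum_add_distrib]
  rw [key, key2, key2]
  congr 1
  · congr 1
    refine Finset.sum_congr rfl fun a _ => ?_
    rw [Finset.sum_comm]
    simp
  · simp

/-- Words with a given pattern of two labels. -/
theorem sum_pattern_two (π : Fin 4 → Fin 2) (hπ : Function.Surjective π) (f : (Fin 4 → ι) → A) :
    ∑ r, (if eqMat r = eqMat π then f r else 0) = offTwo (fun a b => f (![a, b] ∘ π)) := by
  rw [← Finset.sum_filter]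
  symm
  refine Finset.sum_bij (fun v _ => ![v.1, v.2] ∘ π) ?_ ?_ ?_ (fun _ _ => rfl)
  · intro v hv
    have hv : v.1 ≠ v.2 := by simpa using hv
    simp only [Finset.mem_filter, Finset.mem_univ, true_and]
    have hinj : Function.Injective ![v.1, v.2] := by
      intro s t; fin_cases s <;> fin_cases t <;> simp [hv, hv.symm]
    funext s t
    simp only [eqMat, Function.comp_apply, hinj.eq_iff]
  · intro v _ w _ h
    have h := hπ.injective_comp_right h
    ext
    · exact congrFun h 0
    · exact congrFun h 1
  · intro r hr
    have hr : eqMat r = eqMat π := by simpa using hr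
    have hr' : ∀ s t, r s = r t ↔ π s = π t := fun s t => by
      have := congrFun (congrFun hr s) t
      simpa [eqMat] using this
    obtain ⟨s0, h0⟩ := hπ 0
    obtain ⟨s1, h1⟩ := hπ 1
    refine ⟨(r s0, r s1), ?_, ?_⟩
    · simp [hr', h0, h1]
    · funext t
      rcases (by omega : π t = 0 ∨ π t = 1) with h | h
      · simp only [Function.comp_apply, h, Matrix.cons_val_zero]; rw [hr', h0, h]
      · simp only [Function.comp_apply, h, Matrix.cons_val_one, Matrix.cons_val_fin_one]
        rw [hr', h1, h]

/-- Words with a given pattern of three labels. -/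
theorem sum_pattern_three (π : Fin 4 → Fin 3) (hπ : Function.Surjective π) (f : (Fin 4 → ι) → A) :
    ∑ r, (if eqMat r = eqMat π then f r else 0) = offThree (fun a b c => f (![a, b, c] ∘ π)) := by
  rw [← Finset.sum_filter]
  symm
  refine Finset.sum_bij (fun v _ => ![v.1, v.2.1, v.2.2] ∘ π) ?_ ?_ ?_ (fun _ _ => rfl)
  · intro v hv
    simp only [Finset.mem_filter, Finset.mem_univ, true_and] at hv ⊢
    have hinj : Function.Injective ![v.1, v.2.1, v.2.2] := by
      intro s t
      fin_cases s <;> fin_cases t <;> simp [hv, hv.1.symm, hv.2.1.symm, hv.2.2.symm]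
    funext s t
    simp only [eqMat, Function.comp_apply, hinj.eq_iff]
  · intro v _ w _ h
    have h := hπ.injective_comp_right h
    ext
    · exact congrFun h 0
    · exact congrFun h 1
    · exact congrFun h 2
  · intro r hr
    have hr : eqMat r = eqMat π := by simpa using hr
    have hr' : ∀ s t, r s = r t ↔ π s = π t := fun s t => by
      have := congrFun (congrFun hr s) t
      simpa [eqMat] using this
    obtain ⟨s0, h0⟩ := hπ 0
    obtain ⟨s1, h1⟩ := hπ 1
    obtain ⟨s2, h2⟩ := hπ 2
    refine ⟨(r s0, r s1, r s2), ?_, ?_⟩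
    · simp [hr', h0, h1, h2]
    · funext t
      rcases (by omega : π t = 0 ∨ π t = 1 ∨ π t = 2) with h | h | h
      · simp only [Function.comp_apply, h, Matrix.cons_val_zero]; rw [hr', h0, h]
      · simp only [Function.comp_apply, h, Matrix.cons_val_one, Matrix.cons_val_zero]
        rw [hr', h1, h]
      · simp only [Function.comp_apply, h, Matrix.cons_val]
        rw [hr', h2, h]

theorem sum_pattern_one (f : (Fin 4 → ι) → A) :
    ∑ r, (if eqMat r = eqMat (fun _ => (0 : Fin 1)) then f r else 0) =
      ∑ a, f (fun _ => a) := by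
  rw [← Finset.sum_filter]
  symm
  refine Finset.sum_bij (fun a _ => fun _ => a) ?_ ?_ ?_ (fun _ _ => rfl)
  · intro a _; simp only [Finset.mem_filter, Finset.mem_univ, true_and]; funext s t; simp [eqMat]
  · intro a _ b _ h; exact congrFun h 0
  · intro r hr
    have hr : eqMat r = eqMat (fun _ => (0 : Fin 1)) := by simpa using hr
    refine ⟨r 0, Finset.mem_univ _, ?_⟩
    funext t
    have := congrFun (congrFun hr 0) t
    simpa [eqMat] using this

end Labels

theorem eqMat_is_iff {α : Type*} [DecidableEq α] {m : ℕ} (r : Fin 4 → α) (π : Fin 4 → Fin m) :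
    (eqMat r).Is (π 0) (π 1) (π 2) (π 3) ↔ eqMat r = eqMat π := by
  rw [eqMat_is]
  simp only [Fin.val_inj]
  have h2 : eqMat r = eqMat π ↔ ∀ s t, (r s = r t ↔ π s = π t) := by
    simp only [funext_iff, eqMat, decide_eq_decide]
  rw [h2]
  constructor
  · rintro ⟨h01, h02, h03, h12, h13, h23⟩ s t
    fin_cases s <;> fin_cases t <;>
      simp only [Fin.zero_eta, Fin.mk_one, Fin.reduceFinMk] <;>
      first | simp only [true_iff] | assumption | (rw [eq_comm, eq_comm (a := π _)]; assumption)
  · intro h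
    exact ⟨h _ _, h _ _, h _ _, h _ _, h _ _, h _ _⟩

/-! ### Relations between words in the generators joining rows to columns -/

section Box

variable {α β A : Type*} [Fintype α] [DecidableEq α] [Fintype β] [DecidableEq β] [Ring A]

/-- The relations between the generators `x_{ai}` with `a` in one block of indices and `i` in the
other, and the antisymmetric generators `e_{ab}` of the first block. -/
structure BoxRel (x : α → β → A) (e : α → α → A) (p : α → β → A) : Prop where
  comm_x : ∀ {a b i j}, a ≠ b → i ≠ j → x a i * x b j = x b j * x a i
  anti : ∀ a b, e b a = - e a b
  comm_e : ∀ {a b c} i, c ≠ a → c ≠ b → e a b * x c i = x c i * e a b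
  tri : ∀ {a b} i, a ≠ b → x a i * x b i = x b i * e a b - e a b * x a i
  sq : ∀ a i, x a i * x a i = p a i
  central : ∀ a i y, p a i * y = y * p a i
  ortho : ∀ {a b i j}, (a ≠ b ∨ i ≠ j) → p a i * p b j = 0

namespace BoxRel

variable {x : α → β → A} {e : α → α → A} {p : α → β → A} (h : BoxRel x e p)

include h

/-- The word abba is a product of two different squares and vanishes by `ortho`. In abab the
triangle relation at the middle pair brings each outer letter next to an equal one, so only
multiples of squares remain. -/
theorem two_one :
    offTwo (fun a b => ∑ i, x a i * x b i * x a i * x b i) +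
      offTwo (fun a b => ∑ i, x a i * x b i * x b i * x a i) =
    offTwo (fun a b => ∑ i, p a i * ((x a i + x b i) * e b a - x b i * x a i)) := by
  have h1 : offTwo (fun a b => ∑ i, x a i * x b i * x b i * x a i) = 0 := by
    rw [← offTwo_zero (ι := α)]
    refine offTwo_congr fun a b hab => Finset.sum_eq_zero fun i _ => ?_
    rw [mul_assoc (x a i), h.sq, ← h.central, mul_assoc, h.sq, h.ortho (Or.inl hab.symm)]
  have h2 : offTwo (fun a b => ∑ i, x a i * x b i * x a i * x b i) =
      offTwo (fun a b => ∑ i, (p b i * (x a i * e a b) - p a i * (e a b * x b i))) := by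
    refine offTwo_congr fun a b hab => Finset.sum_congr rfl fun i _ => ?_
    have : x a i * x b i * x a i * x b i = x a i * (x b i * x a i) * x b i := by noncomm_ring
    rw [this, h.tri i hab.symm, h.anti a b, h.central b i, ← h.sq b i, ← h.sq a i]
    noncomm_ring
  have h3 : offTwo (fun a b => ∑ i, p b i * (x a i * e a b)) =
      offTwo (fun a b => ∑ i, p a i * (x b i * e b a)) :=
    (offTwo_swap _).symm
  rw [h1, h2, add_zero]
  simp only [Finset.sum_sub_distrib, offTwo_sub]
  rw [h3, ← offTwo_sub]
  refine offTwo_congr fun a b hab => ?_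
  rw [← Finset.sum_sub_distrib]
  refine Finset.sum_congr rfl fun i _ => ?_
  rw [h.tri i hab.symm, h.anti a b]
  noncomm_ring

/-- The triangle relation is applied in each word to two neighbours in a common column. It leaves
terms of the shapes Y and Z, which cancel after exchanging row labels or column labels, and in the
first two words also a square, which gives the right side. -/
theorem two_two_squarefree :
    offTwo (fun a b => offTwo fun i j => x a i * x b i * x a i * x b j) +
      offTwo (fun a b => offTwo fun i j => x a i * x b j * x a j * x b j) -
      offTwo (fun a b => offTwo fun i j => x a i * x a j * x b j * x b i) =
    offTwo (fun a b => offTwo fun i j =>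
      - (p a i * (e a b * x b j + x b j * e a b))) := by
  set Z : α → α → β → β → A := fun a b i j => x a i * x b j * e a b * x a j with hZ
  set Y : α → α → β → β → A := fun a b i j => x a i * e a b * x b i * x a j with hY
  have h1 : offTwo (fun a b => offTwo fun i j => x a i * x b i * x a i * x b j) =
      offTwo (fun a b => offTwo fun i j => - (p a i * (e a b * x b j)) - Y b a i j) := by
    refine offTwo_congr fun a b hab => offTwo_congr fun i j hij => ?_
    simp only [hY]
    have : p a i * (e a b * x b j) = e a b * (x a i * x a i) * x b j := by
      rw [h.sq, ← mul_assoc, h.central]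
    rw [this, h.anti a b, h.tri i hab]
    noncomm_ring
  have h2 : offTwo (fun a b => offTwo fun i j => x a i * x b j * x a j * x b j) =
      offTwo (fun a b => offTwo fun i j => p b j * (x a i * e a b) - Z a b i j) := by
    refine offTwo_congr fun a b hab => offTwo_congr fun i j hij => ?_
    have : x a i * x b j * x a j * x b j = x a i * x b j * (x a j * x b j) := by noncomm_ring
    rw [hZ, this, h.tri j hab, h.central, ← h.sq b j]
    have : x a i * x b j * (x b j * e a b - e a b * x a j) = x a i * (x b j * x b j) * e a b -
      x a i * x b j * e a b * x a j := by noncomm_ring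
    rw [this, h.sq, mul_assoc (x a i), h.central]
    noncomm_ring
  have h3 : offTwo (fun a b => offTwo fun i j => x a i * x a j * x b j * x b i) =
      offTwo (fun a b => offTwo fun i j => - Z b a j i - Y a b i j) := by
    refine offTwo_congr fun a b hab => offTwo_congr fun i j hij => ?_
    have : x a i * x a j * x b j * x b i = x a i * (x a j * x b j) * x b i := by noncomm_ring
    rw [hZ, hY, this, h.tri j hab]
    simp only
    rw [h.anti a b, ← h.comm_x hab hij]
    have : x a i * e a b * x b i * x a j = x a i * e a b * (x a j * x b i) := by
      rw [h.comm_x hab hij.symm]; noncomm_ring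
    rw [this]
    noncomm_ring
  have h4 : offTwo (fun a b => offTwo fun i j => Z b a j i) =
      offTwo (fun a b => offTwo fun i j => Z a b i j) := by
    rw [offTwo_swap (fun a b => offTwo fun i j => Z a b j i)]
    exact offTwo_congr fun a b _ => offTwo_swap _
  have h5 : offTwo (fun a b => offTwo fun i j => Y b a i j) =
      offTwo (fun a b => offTwo fun i j => Y a b i j) :=
    offTwo_swap (fun a b => offTwo fun i j => Y a b i j)
  have h6 : offTwo (fun a b => offTwo fun i j => p b j * (x a i * e a b)) =
      offTwo (fun a b => offTwo fun i j => - (p a i * (x b j * e a b))) := by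
    rw [← offTwo_swap]
    refine offTwo_congr fun a b _ => ?_
    rw [← offTwo_swap]
    refine offTwo_congr fun i j _ => ?_
    rw [h.anti a b]; noncomm_ring
  rw [h1, h2, h3]
  simp only [offTwo_sub, offTwo_neg, offTwo_add, mul_add, neg_add] at h4 h5 h6 ⊢
  rw [h4, h5, h6]
  abel

/-- The same word is rewritten once through its last two letters and once through its middle two.
The square terms agree, while the remaining terms are opposite after exchanging b and c, because e
is antisymmetric. This evaluates twice the sum without dividing by two. -/
theorem three_one :
    (2 : ℤ) • offThree (fun a b c => ∑ i, x a i * x b i * x c i * x b i) =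
      (2 : ℤ) • offThree (fun a b c => ∑ i, p a i * (x b i * e c a)) := by
  have h1 : offThree (fun a b c => ∑ i, x a i * x b i * x c i * x b i) =
      offThree (fun a b c => ∑ i, - (p b i * (x a i * e b c))) +
        offThree (fun a b c => ∑ i, x a i * x b i * e b c * x c i) := by
    rw [← offThree_add]
    refine offThree_congr fun a b c _ _ hbc => ?_
    rw [← Finset.sum_add_distrib]
    refine Finset.sum_congr rfl fun i _ => ?_
    have : x a i * x b i * x c i * x b i = x a i * x b i * (x c i * x b i) := by noncomm_ring
    rw [this, h.tri i hbc.symm, h.anti b c, h.central, ← h.sq]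
    have : x a i * e b c * (x b i * x b i) = x a i * (x b i * x b i) * e b c := by
      rw [h.sq, mul_assoc, ← h.central b i (e b c), mul_assoc]
    rw [this]
    noncomm_ring
  have h2 : offThree (fun a b c => ∑ i, x a i * x b i * x c i * x b i) =
      offThree (fun a b c => ∑ i, - (p b i * (x a i * e b c))) +
        offThree (fun a b c => ∑ i, x a i * x c i * e b c * x b i) := by
    rw [← offThree_add]
    refine offThree_congr fun a b c _ _ hbc => ?_
    rw [← Finset.sum_add_distrib]
    refine Finset.sum_congr rfl fun i _ => ?_
    have : x a i * x b i * x c i * x b i = x a i * (x b i * x c i) * x b i := by noncomm_ring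
    rw [this, h.tri i hbc, h.central, ← h.sq]
    noncomm_ring
  have h3 : offThree (fun a b c => ∑ i, x a i * x c i * e b c * x b i) =
      - offThree (fun a b c => ∑ i, x a i * x b i * e b c * x c i) := by
    rw [← offThree_swap_right, ← offThree_neg]
    refine offThree_congr fun a b c _ _ _ => ?_
    rw [← Finset.sum_neg_distrib]
    refine Finset.sum_congr rfl fun i _ => ?_
    rw [h.anti b c]; noncomm_ring
  have h4 : offThree (fun a b c => ∑ i, - (p b i * (x a i * e b c))) =
      offThree (fun a b c => ∑ i, p a i * (x b i * e c a)) := by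
    rw [← offThree_swap_left]
    refine offThree_congr fun a b c _ _ _ => Finset.sum_congr rfl fun i _ => ?_
    rw [h.anti a c]; noncomm_ring
  rw [two_smul]
  nth_rewrite 1 [h1]
  rw [h2, h3, h4, two_smul]
  abel

/-- Commuting the last two letters and renaming rows puts the third sum into the shape of the
fourth. The triangle relation then produces no squares. The Z terms cancel between the four sums,
while Y and V change sign when two rows and two columns are exchanged together. -/
theorem three_two_squarefree :
    offThree (fun a b c => offTwo fun i j => x a i * x b i * x b j * x c i) +
      offThree (fun a b c => offTwo fun i j => x a i * x b i * x b j * x c j) -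
      offThree (fun a b c => offTwo fun i j => x a i * x a j * x b i * x c j) -
      offThree (fun a b c => offTwo fun i j => x a i * x a j * x b j * x c j) = 0 := by
  set Z : α → α → α → β → β → β → A := fun a b c i j l => x a i * e a b * x a j * x c l with hZ
  set Y : α → α → α → β → β → β → A := fun a b c i j l => e a b * x a i * x b j * x c l with hY
  set V : α → α → α → β → β → β → A := fun a b c i j l => x a i * x b j * e a b * x c l with hV
  have hZs : ∀ s : β → β → β, offThree (fun a b c => offTwo fun i j => Z b a c i j (s i j)) =
      offThree (fun a b c => offTwo fun i j => Z a b c i j (s i j)) := fun s =>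
    offThree_swap_left (fun a b c => offTwo fun i j => Z a b c i j (s i j))
  have h1 : ∀ s : β → β → β, offThree (fun a b c => offTwo fun i j =>
      x a i * x b i * x b j * x c (s i j)) =
      offThree (fun a b c => offTwo fun i j => - Z b a c i j (s i j) - Y a b c i j (s i j)) := by
    intro s
    refine offThree_congr fun a b c hab hac hbc => offTwo_congr fun i j _ => ?_
    rw [hZ, hY, h.tri i hab]
    simp only
    rw [h.anti a b]
    noncomm_ring
  have h2 : ∀ s : β → β → β, offThree (fun a b c => offTwo fun i j =>
      x a i * x a j * x b j * x c (s i j)) =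
      offThree (fun a b c => offTwo fun i j => V a b c i j (s i j) - Z a b c i j (s i j)) := by
    intro s
    refine offThree_congr fun a b c hab hac hbc => offTwo_congr fun i j _ => ?_
    have : x a i * x a j * x b j * x c (s i j) = x a i * (x a j * x b j) * x c (s i j) := by
      noncomm_ring
    rw [hZ, hV, this, h.tri j hab]
    noncomm_ring
  have h3 : offThree (fun a b c => offTwo fun i j => x a i * x a j * x b i * x c j) =
      offThree (fun a b c => offTwo fun i j => x a i * x a j * x b j * x c i) := by
    rw [← offThree_swap_right]
    refine offThree_congr fun a b c hab hac hbc => offTwo_congr fun i j hij => ?_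
    have : x a i * x a j * x c i * x b j = x a i * x a j * (x c i * x b j) := by noncomm_ring
    rw [this, h.comm_x hbc.symm hij]
    noncomm_ring
  have hYs : offThree (fun a b c => offTwo fun i j => Y a b c i j i) =
      - offThree (fun a b c => offTwo fun i j => Y a b c i j j) := by
    rw [← offThree_swap_left, ← offThree_neg]
    refine offThree_congr fun a b c hab hac hbc => ?_
    rw [← offTwo_swap, ← offTwo_neg]
    refine offTwo_congr fun i j hij => ?_
    rw [hY]
    simp only
    rw [h.anti a b, mul_assoc (- e a b), h.comm_x hab.symm hij.symm]
    noncomm_ring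
  have hVs : offThree (fun a b c => offTwo fun i j => V a b c i j i) =
      - offThree (fun a b c => offTwo fun i j => V a b c i j j) := by
    rw [← offThree_swap_left, ← offThree_neg]
    refine offThree_congr fun a b c hab hac hbc => ?_
    rw [← offTwo_swap, ← offTwo_neg]
    refine offTwo_congr fun i j hij => ?_
    rw [hV]
    simp only
    rw [h.anti a b, h.comm_x hab.symm hij.symm]
    noncomm_ring
  rw [h3, h1 (fun i _ => i), h1 (fun _ j => j), h2 (fun i _ => i), h2 (fun _ j => j)]
  simp only [offTwo_sub, offTwo_neg, offThree_sub, offThree_neg, hZs (fun i _ => i),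
    hZs (fun _ j => j), hYs, hVs]
  abel

/-- `x_b x_a x_b` for two rows in the same column, summed over the rows. -/
theorem three_two_braid :
    (2 : ℤ) • offThree (fun a b c => offTwo fun i j => x a i * x b i * x a i * x c j) =
      (2 : ℤ) • offThree (fun a b c => offTwo fun i j => p a i * (x b j * e c a)) := by
  have h1 : offThree (fun a b c => offTwo fun i j => x a i * x b i * x a i * x c j) =
      offThree (fun a b c => offTwo fun i j => - (p a i * (x c j * e a b))) +
        offThree (fun a b c => offTwo fun i j => x b i * e a b * x a i * x c j) := by
    rw [← offThree_add]
    refine offThree_congr fun a b c hab hac hbc => ?_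
    rw [← offTwo_add]
    refine offTwo_congr fun i j hij => ?_
    rw [h.tri i hab, ← h.comm_e j hac.symm hbc.symm, ← mul_assoc, h.central, ← h.sq]
    noncomm_ring
  have h2 : offThree (fun a b c => offTwo fun i j => x a i * x b i * x a i * x c j) =
      offThree (fun a b c => offTwo fun i j => - (p a i * (x c j * e a b))) +
        offThree (fun a b c => offTwo fun i j => x a i * e a b * x b i * x c j) := by
    rw [← offThree_add]
    refine offThree_congr fun a b c hab hac hbc => ?_
    rw [← offTwo_add]
    refine offTwo_congr fun i j hij => ?_
    have : x a i * x b i * x a i * x c j = x a i * (x b i * x a i) * x c j := by noncomm_ring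
    rw [this, h.tri i hab.symm, ← h.comm_e j hac.symm hbc.symm, h.anti a b, ← h.sq]
    noncomm_ring
  have h3 : offThree (fun a b c => offTwo fun i j => x a i * e a b * x b i * x c j) =
      - offThree (fun a b c => offTwo fun i j => x b i * e a b * x a i * x c j) := by
    rw [← offThree_swap_left, ← offThree_neg]
    refine offThree_congr fun a b c _ _ _ => ?_
    rw [← offTwo_neg]
    refine offTwo_congr fun i j hij => ?_
    rw [h.anti a b]; noncomm_ring
  have h4 : offThree (fun a b c => offTwo fun i j => - (p a i * (x c j * e a b))) =
      offThree (fun a b c => offTwo fun i j => p a i * (x b j * e c a)) := by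
    rw [← offThree_swap_right]
    refine offThree_congr fun a b c _ _ _ => offTwo_congr fun i j _ => ?_
    rw [h.anti c a]; noncomm_ring
  rw [two_smul]
  nth_rewrite 1 [h1]
  rw [h2, h3, h4, two_smul]
  abel

end BoxRel

end Box

/-! ### Row sums and the quantum correction term -/

section Box

variable {α β A : Type*} [Fintype α] [DecidableEq α] [Fintype β] [DecidableEq β] [Ring A]

theorem offTwo_mul_left (y : A) (f : α → α → A) : offTwo (fun a b => y * f a b) = y * offTwo f :=
  (Finset.mul_sum ..).symm
theorem offThree_zsmul (m : ℤ) (f : α → α → α → A) :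
    offThree (fun a b c => m • f a b c) = m • offThree f :=
  (Finset.smul_sum ..).symm

/-- The sum `X_a` of the generators in one row. -/
def rowSum (x : α → β → A) (a : α) : A := ∑ i, x a i

/-- `∑_i x_{ai} x_{bi}`. -/
def rowProd (x : α → β → A) (a b : α) : A := ∑ i, x a i * x b i

/-- The sum over the classes of words of two letters in the rows `a ≠ b`. -/
def pairSum (x : α → β → A) (a b : α) : A := rowSum x a * rowSum x b + rowProd x b a

namespace BoxRel

variable {x : α → β → A} {e : α → α → A} {p : α → β → A} (h : BoxRel x e p)

include h

/-- Generators in different rows and different columns commute, so the commutator only retains pairs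
in a common column. -/
theorem rowSum_mul_rowSum {a b : α} (hab : a ≠ b) :
    rowSum x a * rowSum x b - rowSum x b * rowSum x a = rowProd x a b - rowProd x b a := by
  simp only [rowSum, Finset.sum_mul_sum, rowProd, sum_sum_eq_offTwo (ι := β)]
  rw [← offTwo_swap (fun i j => x b i * x a j),
    offTwo_congr (f := fun i j => x b j * x a i) (g := fun i j => x a i * x b j)
      fun i j hij => h.comm_x hab.symm hij.symm]
  abel

/-- The summand `rowProd x b a` of `pairSum` is there to compensate the commutator of the row sums.
-/
theorem pairSum_comm {a b : α} (hab : a ≠ b) : pairSum x a b = pairSum x b a := by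
  have := h.rowSum_mul_rowSum hab
  unfold pairSum
  rw [← sub_eq_zero]
  rw [← sub_eq_zero] at this
  rw [← this]; abel

/-- All row and column labels are sorted by coincidence with each other and with the labels of the
square p_{ai}. Beyond this bookkeeping only three facts enter: the symmetry of `pairSum`,
commutation of generators without a common index, and the vanishing of products of different
squares. The right side is arranged to match the sums in `weightTypes_eq`. -/
theorem correction_eq :
    ∑ a, ∑ i, p a i * ((6 : ℤ) • offTwo (pairSum x) - (12 : ℤ) • ((∑ d, rowSum x d) *
      ∑ c ∈ Finset.univ.erase a, (rowSum x c + e c a))) =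
    (12 : ℤ) • offTwo (fun a b => ∑ i, p a i * (x b i * x a i - (x a i + x b i) * e b a)) +
    (12 : ℤ) • offTwo (fun a b => offTwo fun i j =>
      p a i * (x b j * x a j - x b i * x b j - x b j * x b i - (x a j + x b j) * e b a)) -
    (12 : ℤ) • offTwo (fun a b => offThree fun i j l => p a i * (x b j * x b l)) -
    (12 : ℤ) • offThree (fun a b c => ∑ i, p a i * (x b i * e c a)) -
    (12 : ℤ) • offThree (fun a b c => offTwo fun i j =>
      p a i * (x b i * x c j) + p a i * (x b j * e c a)) -
    (6 : ℤ) • offThree (fun a b c => offThree fun i j l => p a i * (x b j * x c l)) := by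
  set q : α → A := fun a => ∑ i, p a i with hq
  have s1 : ∑ a, q a * offTwo (pairSum x) = offThree (fun a b c => q a * pairSum x b c) +
      (2 : ℤ) • offTwo (fun a b => q a * pairSum x a b) := by
    simp only [← offTwo_mul_left]
    rw [sum_offTwo_eq, two_smul, add_assoc]
    congr 2
    exact offTwo_congr fun a b hab => by rw [h.pairSum_comm hab]
  have s2 : ∑ a, q a * ((∑ d, rowSum x d) * ∑ c ∈ Finset.univ.erase a, (rowSum x c + e c a)) =
      offThree (fun a b c => q a * (rowSum x b * (rowSum x c + e c a))) +
      offTwo (fun a b => q a * (rowSum x a * (rowSum x b + e b a))) +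
      offTwo (fun a b => q a * (rowSum x b * (rowSum x b + e b a))) := by
    have : ∑ a, q a * ((∑ d, rowSum x d) * ∑ c ∈ Finset.univ.erase a, (rowSum x c + e c a)) =
        ∑ d, offTwo (fun a c => q a * (rowSum x d * (rowSum x c + e c a))) := by
      simp only [offTwo_eq_sum, Finset.sum_mul, Finset.mul_sum]
      rw [Finset.sum_comm]
      refine Finset.sum_congr rfl fun a _ => ?_
      rw [Finset.sum_comm]
    rw [this, sum_offTwo_eq, offThree_swap_left (fun a b c =>
      q a * (rowSum x b * (rowSum x c + e c a))), offTwo_swap (fun a b =>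
      q a * (rowSum x b * (rowSum x b + e b a)))]
  have s3 : (6 : ℤ) • offThree (fun a b c => q a * pairSum x b c) -
      (12 : ℤ) • offThree (fun a b c => q a * (rowSum x b * rowSum x c)) =
      - (6 : ℤ) • offThree (fun a b c => offThree fun i j l => p a i * (x b j * x c l)) -
      (12 : ℤ) • offThree (fun a b c => offTwo fun i j => p a i * (x b i * x c j)) := by
    have t1 : offThree (fun a b c => q a * pairSum x b c) =
        offThree (fun a b c => q a * (rowSum x b * rowSum x c)) +
        offThree (fun a b c => q a * rowProd x b c) := by
      rw [← offThree_swap_right (fun a b c => q a * rowProd x b c), ← offThree_add]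
      exact offThree_congr fun a b c _ _ _ => by rw [pairSum, mul_add]
    have t2 : offThree (fun a b c => q a * (rowSum x b * rowSum x c)) =
        offThree (fun a b c => q a * rowProd x b c) +
        offThree (fun a b c => offThree fun i j l => p a i * (x b j * x c l)) +
        (2 : ℤ) • offThree (fun a b c => offTwo fun i j => p a i * (x b i * x c j)) := by
      have t3 : offThree (fun a b c => offTwo fun i j => p a i * (x b j * x c i)) =
          offThree (fun a b c => offTwo fun i j => p a i * (x b i * x c j)) := by
        rw [← offThree_swap_right]
        exact offThree_congr fun a b c _ _ hbc => offTwo_congr fun i j hij => by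
          rw [h.comm_x hbc.symm hij.symm]
      rw [two_smul]
      nth_rewrite 2 [← t3]
      rw [← offThree_add, ← offThree_add, ← offThree_add]
      refine offThree_congr fun a b c _ _ _ => ?_
      rw [add_assoc, ← add_assoc (offThree _),
        ← sum_offTwo_eq (fun i j l => p a i * (x b j * x c l))]
      simp only [offTwo_mul_left]
      rw [← Finset.sum_mul, ← mul_add, rowSum, rowSum, Finset.sum_mul_sum, sum_sum_eq_offTwo]
      rfl
    rw [t1, t2]
    module
  have s4 : offTwo (fun a b => q a * (rowSum x b * rowSum x b)) =
      offTwo (fun a b => offThree fun i j l => p a i * (x b j * x b l)) +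
      offTwo (fun a b => offTwo fun i j => p a i * (x b i * x b j)) +
      offTwo (fun a b => offTwo fun i j => p a i * (x b j * x b i)) := by
    rw [← offTwo_add, ← offTwo_add]
    refine offTwo_congr fun a b hab => ?_
    rw [← sum_offTwo_eq (fun i j l => p a i * (x b j * x b l))]
    simp only [offTwo_mul_left]
    rw [← Finset.sum_mul, rowSum, Finset.sum_mul_sum, sum_sum_eq_offTwo, mul_add,
      add_eq_right]
    -- The diagonal terms are squares in row b, and they are killed by the squares in the different
    -- row a.
    simp only [h.sq, hq, Finset.sum_mul_sum]
    exact Finset.sum_eq_zero fun i _ => Finset.sum_eq_zero fun j _ => h.ortho (Or.inl hab)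
  have s5 : ∀ f : α → α → β → A, offTwo (fun a b => q a * ∑ j, f a b j) =
      offTwo (fun a b => ∑ i, p a i * f a b i) +
      offTwo (fun a b => offTwo fun i j => p a i * f a b j) := by
    intro f
    rw [← offTwo_add]
    refine offTwo_congr fun a b _ => ?_
    rw [← sum_sum_eq_offTwo (fun i j => p a i * f a b j), Finset.sum_mul_sum]
  have s6 : offThree (fun a b c => q a * (rowSum x b * e c a)) =
      offThree (fun a b c => ∑ i, p a i * (x b i * e c a)) +
      offThree (fun a b c => offTwo fun i j => p a i * (x b j * e c a)) := by
    rw [← offThree_add]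
    refine offThree_congr fun a b c _ _ _ => ?_
    rw [← sum_sum_eq_offTwo (fun i j => p a i * (x b j * e c a)), rowSum,
      Finset.sum_mul Finset.univ (x b) (e c a), hq, Finset.sum_mul_sum]
  have s7 := s5 fun a b j => x b j * x a j - (x a j + x b j) * e b a
  have s8 : offTwo (fun a b => q a * ∑ j, (x b j * x a j - (x a j + x b j) * e b a)) =
      offTwo (fun a b => q a * pairSum x a b) -
      offTwo (fun a b => q a * (rowSum x a * (rowSum x b + e b a))) -
      offTwo (fun a b => q a * (rowSum x b * e b a)) := by
    rw [← offTwo_sub, ← offTwo_sub]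
    refine offTwo_congr fun a b _ => ?_
    rw [← mul_sub, ← mul_sub]
    congr 1
    rw [Finset.sum_sub_distrib, ← Finset.sum_mul, Finset.sum_add_distrib, pairSum, rowProd,
      rowSum, rowSum]
    noncomm_ring
  have s9 : offTwo (fun a b => offTwo fun i j =>
      p a i * (x b j * x a j - x b i * x b j - x b j * x b i - (x a j + x b j) * e b a)) =
      offTwo (fun a b => offTwo fun i j => p a i * (x b j * x a j - (x a j + x b j) * e b a)) -
      offTwo (fun a b => offTwo fun i j => p a i * (x b i * x b j)) -
      offTwo (fun a b => offTwo fun i j => p a i * (x b j * x b i)) := by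
    simp only [← offTwo_sub]
    refine offTwo_congr fun a b _ => offTwo_congr fun i j _ => ?_
    noncomm_ring
  have s10 : ∑ a, ∑ i, p a i * ((6 : ℤ) • offTwo (pairSum x) - (12 : ℤ) • ((∑ d, rowSum x d) *
      ∑ c ∈ Finset.univ.erase a, (rowSum x c + e c a))) =
      (6 : ℤ) • ∑ a, q a * offTwo (pairSum x) - (12 : ℤ) • ∑ a, q a * ((∑ d, rowSum x d) *
        ∑ c ∈ Finset.univ.erase a, (rowSum x c + e c a)) := by
    rw [Finset.smul_sum, Finset.smul_sum, ← Finset.sum_sub_distrib]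
    refine Finset.sum_congr rfl fun a _ => ?_
    rw [← Finset.sum_mul, mul_sub, mul_smul_comm, mul_smul_comm]
  have s11 : offThree (fun a b c => q a * (rowSum x b * (rowSum x c + e c a))) =
      offThree (fun a b c => q a * (rowSum x b * rowSum x c)) +
      offThree (fun a b c => q a * (rowSum x b * e c a)) := by
    simp only [mul_add, offThree_add]
  have s12 : offTwo (fun a b => q a * (rowSum x b * (rowSum x b + e b a))) =
      offTwo (fun a b => q a * (rowSum x b * rowSum x b)) +
      offTwo (fun a b => q a * (rowSum x b * e b a)) := by
    simp only [mul_add, offTwo_add]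
  rw [s10, s1, s2, s9, s11, s12]
  simp only [offThree_add, offTwo_add]
  have s13 := s7.symm.trans s8
  linear_combination (norm := module) s3 - (12 : ℤ) • s4 - (12 : ℤ) • s6 - (12 : ℤ) • s13

end BoxRel

end Box

/-! ### Weighted sums over all words and the types of zero class weight in the product formula -/

section Box

variable {α β A : Type*} [Fintype α] [DecidableEq α] [Fintype β] [DecidableEq β] [Ring A]

/-- The product of the generators along a word. -/
def wordProd (x : α → β → A) (r : Fin 4 → α) (c : Fin 4 → β) : A :=
  x (r 0) (c 0) * x (r 1) (c 1) * x (r 2) (c 2) * x (r 3) (c 3)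

/-- A weighted sum over all words. -/
def weightedSum (x : α → β → A) (f : EqMat → EqMat → ℤ) : A :=
  ∑ r : Fin 4 → α, ∑ c : Fin 4 → β, f (eqMat r) (eqMat c) • wordProd x r c

theorem weightedSum_add (x : α → β → A) (f g : EqMat → EqMat → ℤ) :
    weightedSum x (fun R C => f R C + g R C) = weightedSum x f + weightedSum x g := by
  simp only [weightedSum, add_smul, Finset.sum_add_distrib]

theorem weightedSum_sub (x : α → β → A) (f g : EqMat → EqMat → ℤ) :
    weightedSum x (fun R C => f R C - g R C) = weightedSum x f - weightedSum x g := by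
  simp only [weightedSum, sub_smul, Finset.sum_sub_distrib]

theorem weightedSum_mul (x : α → β → A) (m : ℤ) (f : EqMat → EqMat → ℤ) :
    weightedSum x (fun R C => m * f R C) = m • weightedSum x f := by
  simp only [weightedSum, mul_smul, Finset.smul_sum]

theorem ind_smul {γ : Type*} [DecidableEq γ] {m : ℕ} (r : Fin 4 → γ) (π : Fin 4 → Fin m) (y : A) :
    (eqMat r).ind (π 0) (π 1) (π 2) (π 3) • y = if eqMat r = eqMat π then y else 0 := by
  unfold EqMat.ind
  simp only [eqMat_is_iff]
  split_ifs <;> simp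

theorem weightedSum_ind (x : α → β → A) {m l : ℕ} (π : Fin 4 → Fin m) (ρ : Fin 4 → Fin l) :
    weightedSum x (fun R C => R.ind (π 0) (π 1) (π 2) (π 3) * C.ind (ρ 0) (ρ 1) (ρ 2) (ρ 3)) =
      ∑ r : Fin 4 → α, if eqMat r = eqMat π then
        ∑ c : Fin 4 → β, (if eqMat c = eqMat ρ then wordProd x r c else 0) else 0 := by
  unfold weightedSum
  refine Finset.sum_congr rfl fun r _ => ?_
  simp only [mul_smul, ind_smul]
  split_ifs <;> simp

theorem weightedSum_two_one (x : α → β → A) (π : Fin 4 → Fin 2) (hπ : Function.Surjective π) :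
    weightedSum x (fun R C => R.ind (π 0) (π 1) (π 2) (π 3) * C.ind 0 0 0 0) =
      offTwo fun a b => ∑ i, wordProd x (![a, b] ∘ π) fun _ => i := by
  refine (weightedSum_ind x π (fun _ => (0 : Fin 1))).trans ?_
  simp only [sum_pattern_one]
  exact sum_pattern_two π hπ _

theorem weightedSum_two_two (x : α → β → A) (π ρ : Fin 4 → Fin 2) (hπ : Function.Surjective π)
    (hρ : Function.Surjective ρ) :
    weightedSum x (fun R C => R.ind (π 0) (π 1) (π 2) (π 3) * C.ind (ρ 0) (ρ 1) (ρ 2) (ρ 3)) =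
      offTwo fun a b => offTwo fun i j => wordProd x (![a, b] ∘ π) (![i, j] ∘ ρ) := by
  rw [weightedSum_ind x π ρ]
  simp only [sum_pattern_two ρ hρ]
  exact sum_pattern_two π hπ _

theorem weightedSum_two_three (x : α → β → A) (π : Fin 4 → Fin 2) (ρ : Fin 4 → Fin 3)
    (hπ : Function.Surjective π) (hρ : Function.Surjective ρ) :
    weightedSum x (fun R C => R.ind (π 0) (π 1) (π 2) (π 3) * C.ind (ρ 0) (ρ 1) (ρ 2) (ρ 3)) =
      offTwo fun a b => offThree fun i j l => wordProd x (![a, b] ∘ π) (![i, j, l] ∘ ρ) := by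
  rw [weightedSum_ind x π ρ]
  simp only [sum_pattern_three ρ hρ]
  exact sum_pattern_two π hπ _

theorem weightedSum_three_one (x : α → β → A) (π : Fin 4 → Fin 3) (hπ : Function.Surjective π) :
    weightedSum x (fun R C => R.ind (π 0) (π 1) (π 2) (π 3) * C.ind 0 0 0 0) =
      offThree fun a b c => ∑ i, wordProd x (![a, b, c] ∘ π) fun _ => i := by
  refine (weightedSum_ind x π (fun _ => (0 : Fin 1))).trans ?_
  simp only [sum_pattern_one]
  exact sum_pattern_three π hπ _

theorem weightedSum_three_two (x : α → β → A) (π : Fin 4 → Fin 3) (ρ : Fin 4 → Fin 2)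
    (hπ : Function.Surjective π) (hρ : Function.Surjective ρ) :
    weightedSum x (fun R C => R.ind (π 0) (π 1) (π 2) (π 3) * C.ind (ρ 0) (ρ 1) (ρ 2) (ρ 3)) =
      offThree fun a b c => offTwo fun i j => wordProd x (![a, b, c] ∘ π) (![i, j] ∘ ρ) := by
  rw [weightedSum_ind x π ρ]
  simp only [sum_pattern_two ρ hρ]
  exact sum_pattern_three π hπ _

theorem weightedSum_three_three (x : α → β → A) (π ρ : Fin 4 → Fin 3)
    (hπ : Function.Surjective π) (hρ : Function.Surjective ρ) :
    weightedSum x (fun R C => R.ind (π 0) (π 1) (π 2) (π 3) * C.ind (ρ 0) (ρ 1) (ρ 2) (ρ 3)) =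
      offThree fun a b c => offThree fun i j l =>
        wordProd x (![a, b, c] ∘ π) (![i, j, l] ∘ ρ) := by
  rw [weightedSum_ind x π ρ]
  simp only [sum_pattern_three ρ hρ]
  exact sum_pattern_three π hπ _

namespace BoxRel

variable {x : α → β → A} {e : α → α → A} {p : α → β → A} (h : BoxRel x e p)

theorem weightTypesTwo_expand : (weightedSum x fun R C => 6 * weightTypesTwo R C) =
    (12 : ℤ) • (offTwo fun a b => offTwo fun i j => x a i * x a i * x b j * x b i) +
    (6 : ℤ) • (offTwo fun a b => offTwo fun i j => x a i * x a i * x b j * x b j) +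
    (12 : ℤ) • (offTwo fun a b => offTwo fun i j => x a i * x a j * x b i * x b i) -
    (12 : ℤ) • (offTwo fun a b => offTwo fun i j => x a i * x a j * x b j * x b i) +
    (12 : ℤ) • (offTwo fun a b => offThree fun i j l => x a i * x a i * x b j * x b l) +
    (12 : ℤ) • (offTwo fun a b => ∑ i, x a i * x b i * x a i * x b i) +
    (12 : ℤ) • (offTwo fun a b => offTwo fun i j => x a i * x b i * x a i * x b j) +
    (12 : ℤ) • (offTwo fun a b => offTwo fun i j => x a i * x b j * x a j * x b j) +
    (12 : ℤ) • (offTwo fun a b => ∑ i, x a i * x b i * x b i * x a i) := by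
  have s1 : Function.Surjective (![0, 0, 1, 1] : Fin 4 → Fin 2) := by decide
  have s2 : Function.Surjective (![0, 1, 0, 1] : Fin 4 → Fin 2) := by decide
  have s3 : Function.Surjective (![0, 1, 1, 0] : Fin 4 → Fin 2) := by decide
  have c1 : Function.Surjective (![0, 0, 1, 0] : Fin 4 → Fin 2) := by decide
  have c3 : Function.Surjective (![0, 1, 0, 0] : Fin 4 → Fin 2) := by decide
  have c5 : Function.Surjective (![0, 0, 1, 2] : Fin 4 → Fin 3) := by decide
  have c6 : Function.Surjective (![0, 0, 0, 1] : Fin 4 → Fin 2) := by decide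
  have c7 : Function.Surjective (![0, 1, 1, 1] : Fin 4 → Fin 2) := by decide
  have t1 := weightedSum_two_two x _ _ s1 c1
  have t2 := weightedSum_two_two x _ _ s1 s1
  have t3 := weightedSum_two_two x _ _ s1 c3
  have t4 := weightedSum_two_two x _ _ s1 s3
  have t5 := weightedSum_two_three x _ _ s1 c5
  have t6 := weightedSum_two_one x _ s2
  have t7 := weightedSum_two_two x _ _ s2 c6
  have t8 := weightedSum_two_two x _ _ s2 c7
  have t9 := weightedSum_two_one x _ s3
  have e : (fun R C => 6 * weightTypesTwo R C) = fun R C =>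
      12 * (R.ind 0 0 1 1 * C.ind 0 0 1 0) + 6 * (R.ind 0 0 1 1 * C.ind 0 0 1 1) +
      12 * (R.ind 0 0 1 1 * C.ind 0 1 0 0) - 12 * (R.ind 0 0 1 1 * C.ind 0 1 1 0) +
      12 * (R.ind 0 0 1 1 * C.ind 0 0 1 2) + 12 * (R.ind 0 1 0 1 * C.ind 0 0 0 0) +
      12 * (R.ind 0 1 0 1 * C.ind 0 0 0 1) + 12 * (R.ind 0 1 0 1 * C.ind 0 1 1 1) +
      12 * (R.ind 0 1 1 0 * C.ind 0 0 0 0) := by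
    funext R C
    unfold weightTypesTwo
    ring
  rw [e]
  simp only [weightedSum_add, weightedSum_sub, weightedSum_mul]
  exact congrArg₂ (· + ·) (congrArg₂ (· + ·) (congrArg₂ (· + ·) (congrArg₂ (· + ·)
    (congrArg₂ (· + ·) (congrArg₂ (· - ·) (congrArg₂ (· + ·) (congrArg₂ (· + ·)
    (congrArg _ t1) (congrArg _ t2)) (congrArg _ t3)) (congrArg _ t4)) (congrArg _ t5))
    (congrArg _ t6)) (congrArg _ t7)) (congrArg _ t8)) (congrArg _ t9)

theorem weightTypesThree_expand : (weightedSum x fun R C => 6 * weightTypesThree R C) =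
    (6 : ℤ) • (offThree fun a b c => offThree fun i j l => x a i * x a i * x b j * x c l) -
    (12 : ℤ) • (offThree fun a b c => ∑ i, x a i * x a i * x b i * x c i) -
    (12 : ℤ) • (offThree fun a b c => offTwo fun i j => x a i * x a j * x b i * x c j) -
    (12 : ℤ) • (offThree fun a b c => offTwo fun i j => x a i * x a j * x b j * x c j) +
    (12 : ℤ) • (offThree fun a b c => ∑ i, x a i * x b i * x b i * x c i) +
    (12 : ℤ) • (offThree fun a b c => offTwo fun i j => x a i * x b i * x b i * x c j) +
    (12 : ℤ) • (offThree fun a b c => offTwo fun i j => x a i * x b i * x b j * x c i) +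
    (12 : ℤ) • (offThree fun a b c => offTwo fun i j => x a i * x b i * x b j * x c j) +
    (12 : ℤ) • (offThree fun a b c => ∑ i, x a i * x b i * x c i * x b i) +
    (12 : ℤ) • (offThree fun a b c => offTwo fun i j => x a i * x b i * x a i * x c j) := by
  have s1 : Function.Surjective (![0, 0, 1, 2] : Fin 4 → Fin 3) := by decide
  have s2 : Function.Surjective (![0, 1, 1, 2] : Fin 4 → Fin 3) := by decide
  have s3 : Function.Surjective (![0, 1, 2, 1] : Fin 4 → Fin 3) := by decide
  have s4 : Function.Surjective (![0, 1, 0, 2] : Fin 4 → Fin 3) := by decide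
  have c1 : Function.Surjective (![0, 1, 0, 1] : Fin 4 → Fin 2) := by decide
  have c2 : Function.Surjective (![0, 1, 1, 1] : Fin 4 → Fin 2) := by decide
  have c3 : Function.Surjective (![0, 0, 0, 1] : Fin 4 → Fin 2) := by decide
  have c4 : Function.Surjective (![0, 0, 1, 0] : Fin 4 → Fin 2) := by decide
  have c5 : Function.Surjective (![0, 0, 1, 1] : Fin 4 → Fin 2) := by decide
  have t1 := weightedSum_three_three x _ _ s1 s1
  have t2 := weightedSum_three_one x _ s1
  have t3 := weightedSum_three_two x _ _ s1 c1
  have t4 := weightedSum_three_two x _ _ s1 c2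
  have t5 := weightedSum_three_one x _ s2
  have t6 := weightedSum_three_two x _ _ s2 c3
  have t7 := weightedSum_three_two x _ _ s2 c4
  have t8 := weightedSum_three_two x _ _ s2 c5
  have t9 := weightedSum_three_one x _ s3
  have t10 := weightedSum_three_two x _ _ s4 c3
  have e : (fun R C => 6 * weightTypesThree R C) = fun R C =>
      6 * (R.ind 0 0 1 2 * C.ind 0 0 1 2) - 12 * (R.ind 0 0 1 2 * C.ind 0 0 0 0) -
      12 * (R.ind 0 0 1 2 * C.ind 0 1 0 1) - 12 * (R.ind 0 0 1 2 * C.ind 0 1 1 1) +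
      12 * (R.ind 0 1 1 2 * C.ind 0 0 0 0) + 12 * (R.ind 0 1 1 2 * C.ind 0 0 0 1) +
      12 * (R.ind 0 1 1 2 * C.ind 0 0 1 0) + 12 * (R.ind 0 1 1 2 * C.ind 0 0 1 1) +
      12 * (R.ind 0 1 2 1 * C.ind 0 0 0 0) + 12 * (R.ind 0 1 0 2 * C.ind 0 0 0 1) := by
    funext R C
    unfold weightTypesThree
    ring
  rw [e]
  simp only [weightedSum_add, weightedSum_sub, weightedSum_mul]
  exact congrArg₂ (· + ·) (congrArg₂ (· + ·) (congrArg₂ (· + ·) (congrArg₂ (· + ·)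
    (congrArg₂ (· + ·) (congrArg₂ (· + ·) (congrArg₂ (· - ·) (congrArg₂ (· - ·)
    (congrArg₂ (· - ·) (congrArg _ t1) (congrArg _ t2)) (congrArg _ t3)) (congrArg _ t4))
    (congrArg _ t5)) (congrArg _ t6)) (congrArg _ t7)) (congrArg _ t8)) (congrArg _ t9))
    (congrArg _ t10)

include h

/-- Types with a neighbouring square reduce to a central factor p in front. The others occur in the
combinations evaluated by `two_one`, `two_two_squarefree`, `three_one`, `three_two_squarefree` and
`three_two_braid`. Thus these types may be subtracted from a weight in exchange for the correction;
when p vanishes they contribute nothing. -/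
theorem weightTypes_eq :
    (weightedSum x fun R C => 6 * weightTypesTwo R C) +
      (weightedSum x fun R C => 6 * weightTypesThree R C) =
    - ∑ a, ∑ i, p a i * ((6 : ℤ) • offTwo (pairSum x) - (12 : ℤ) • ((∑ d, rowSum x d) *
      ∑ c ∈ Finset.univ.erase a, (rowSum x c + e c a))) := by
  have q1 : (offTwo fun a b => offTwo fun i j => x a i * x a i * x b j * x b i) =
      offTwo fun a b => offTwo fun i j => p a i * (x b j * x b i) :=
    offTwo_congr fun a b _ => offTwo_congr fun i j _ => by rw [h.sq, mul_assoc]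
  have q2 : (offTwo fun a b => offTwo fun i j => x a i * x a i * x b j * x b j) = 0 := by
    rw [← offTwo_zero (ι := α)]
    refine offTwo_congr fun a b hab => ?_
    rw [← offTwo_zero (ι := β)]
    refine offTwo_congr fun i j _ => ?_
    rw [h.sq, mul_assoc, h.sq, h.ortho (Or.inl hab)]
  have q3 : (offTwo fun a b => offTwo fun i j => x a i * x a j * x b i * x b i) =
      offTwo fun a b => offTwo fun i j => p a i * (x b i * x b j) := by
    rw [← offTwo_swap]
    exact offTwo_congr fun a b _ => offTwo_congr fun i j _ => by rw [mul_assoc, h.sq, h.central]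
  have q4 : (offTwo fun a b => offThree fun i j l => x a i * x a i * x b j * x b l) =
      offTwo fun a b => offThree fun i j l => p a i * (x b j * x b l) :=
    offTwo_congr fun a b _ => offThree_congr fun i j l _ _ _ => by rw [h.sq, mul_assoc]
  have q5 : (offThree fun a b c => offThree fun i j l => x a i * x a i * x b j * x c l) =
      offThree fun a b c => offThree fun i j l => p a i * (x b j * x c l) :=
    offThree_congr fun a b c _ _ _ => offThree_congr fun i j l _ _ _ => by rw [h.sq, mul_assoc]
  have q6 : (offThree fun a b c => ∑ i, x a i * x b i * x b i * x c i) =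
      offThree fun a b c => ∑ i, x a i * x a i * x b i * x c i := by
    rw [← offThree_swap_left]
    exact offThree_congr fun a b c _ _ _ => Finset.sum_congr rfl fun i _ => by
      rw [mul_assoc (x b i), h.sq, h.central]
  have q7 : (offThree fun a b c => offTwo fun i j => x a i * x b i * x b i * x c j) =
      offThree fun a b c => offTwo fun i j => p a i * (x b i * x c j) := by
    rw [← offThree_swap_left]
    exact offThree_congr fun a b c _ _ _ => offTwo_congr fun i j _ => by
      rw [mul_assoc (x b i), h.sq, ← h.central, mul_assoc]
  have r1 := h.two_one
  have r2 := h.two_two_squarefree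
  have r3 := h.three_one
  have r4 := h.three_two_squarefree
  have r5 := h.three_two_braid
  have r6 : offTwo (fun a b => offTwo fun i j =>
      p a i * (x b j * x a j - x b i * x b j - x b j * x b i - (x a j + x b j) * e b a)) =
      - offTwo (fun a b => offTwo fun i j => - (p a i * (e a b * x b j + x b j * e a b))) -
      offTwo (fun a b => offTwo fun i j => p a i * (x b i * x b j)) -
      offTwo (fun a b => offTwo fun i j => p a i * (x b j * x b i)) := by
    simp only [← offTwo_sub, ← offTwo_neg]
    refine offTwo_congr fun a b hab => offTwo_congr fun i j _ => ?_
    rw [h.tri j hab.symm, h.anti a b]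
    noncomm_ring
  have r7 : offTwo (fun a b => ∑ i, p a i * (x b i * x a i - (x a i + x b i) * e b a)) =
      - offTwo (fun a b => ∑ i, p a i * ((x a i + x b i) * e b a - x b i * x a i)) := by
    rw [← offTwo_neg]
    refine offTwo_congr fun a b _ => ?_
    rw [← Finset.sum_neg_distrib]
    exact Finset.sum_congr rfl fun i _ => by noncomm_ring
  rw [weightTypesTwo_expand, weightTypesThree_expand, h.correction_eq, q1, q2, q3, q4, q5, q6, q7,
    r6, r7]
  simp only [offThree_add, offTwo_add]
  linear_combination (norm := module) (12 : ℤ) • r1 + (12 : ℤ) • r2 + (6 : ℤ) • r3 +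
    (12 : ℤ) • r4 + (6 : ℤ) • r5

end BoxRel

end Box

/-! ### Words with distinct rows as pair sums and triple sums -/

section Box

variable {α β A : Type*} [Fintype α] [DecidableEq α] [Fintype β] [DecidableEq β] [Ring A]

theorem sum_fin_four {γ M : Type*} [Fintype γ] [AddCommMonoid M] (f : (Fin 4 → γ) → M) :
    ∑ r, f r = ∑ a, ∑ b, ∑ c, ∑ d, f ![a, b, c, d] := by
  simp only [← Fintype.sum_prod_type']
  refine Fintype.sum_equiv (⟨fun r => (r 0, r 1, r 2, r 3),
    fun v => ![v.1, v.2.1, v.2.2.1, v.2.2.2], fun r => ?_, fun v => rfl⟩ :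
    (Fin 4 → γ) ≃ γ × γ × γ × γ) _ _ fun r => ?_
  · funext t; fin_cases t <;> rfl
  · congr 1
    funext t; fin_cases t <;> rfl

theorem offTwo_eq_ite (f : α → α → A) : offTwo f = ∑ a, ∑ b, if a = b then 0 else f a b := by
  simp only [offTwo, Finset.sum_filter]
  rw [Fintype.sum_prod_type]
  exact Finset.sum_congr rfl fun a _ => Finset.sum_congr rfl fun b _ => by
    by_cases h : a = b <;> simp [h]

theorem offThree_eq_ite (f : α → α → α → A) : offThree f =
    ∑ a, ∑ b, ∑ c, if a = b ∨ b = c ∨ a = c then 0 else f a b c := by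
  simp only [offThree, Finset.sum_filter]
  rw [Fintype.sum_prod_type]
  refine Finset.sum_congr rfl fun a _ => ?_
  rw [Fintype.sum_prod_type]
  refine Finset.sum_congr rfl fun b _ => Finset.sum_congr rfl fun c _ => ?_
  by_cases h1 : a = b <;> by_cases h2 : b = c <;> by_cases h3 : a = c <;> simp [h1, h2, h3]

/-- The sum over the classes of words of three letters in the distinct rows `a, b, c`. -/
def tripleSum (x : α → β → A) (a b c : α) : A :=
  rowSum x a * rowSum x b * rowSum x c + rowProd x b a * rowSum x c + rowSum x a * rowProd x c b +
    ∑ i, x c i * rowSum x b * x a i +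
    ∑ i, (x b i * x c i * x a i + x c i * x a i * x b i)

/-- Exchanging the two rows puts `rowProd` in the same order as the product of row sums, where it
counts pairs in a common column once more. This is the origin of `weightTwo`. -/
theorem offTwo_pairSum (x : α → β → A) :
    offTwo (pairSum x) = ∑ a, ∑ b, ∑ i, ∑ j,
      (if a = b then 0 else if i = j then 2 else 1 : ℤ) • (x a i * x b j) := by
  have h1 : offTwo (pairSum x) = offTwo (fun a b => rowSum x a * rowSum x b + rowProd x a b) := by
    rw [offTwo_add, ← offTwo_swap (fun a b => rowProd x a b), ← offTwo_add]
    rfl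
  rw [h1, offTwo_eq_ite]
  refine Finset.sum_congr rfl fun a _ => Finset.sum_congr rfl fun b _ => ?_
  by_cases hab : a = b
  · simp [hab]
  · simp only [hab, if_false]
    have h2 : ∀ i j, (if i = j then 2 else 1 : ℤ) • (x a i * x b j) =
        x a i * x b j + if i = j then x a i * x b j else 0 := by
      intro i j
      split_ifs <;> simp [two_smul]
    simp only [h2, Finset.sum_add_distrib, Finset.sum_ite_eq, Finset.mem_univ, if_true]
    rw [rowSum, rowSum, Finset.sum_mul_sum, rowProd]

/-- Since all ordered triples of rows are summed, each summand of `tripleSum` can be relabelled so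
that its letters come in the order a, b, c. The extra summands then count coincidences of columns,
and the two cyclic ones become equal. -/
theorem offThree_tripleSum (x : α → β → A) :
    offThree (tripleSum x) = ∑ a, ∑ b, ∑ c, ∑ i, ∑ j, ∑ l,
      (if a = b ∨ b = c ∨ a = c then 0 else 1 + (if i = j then 1 else 0) + (if j = l then 1 else 0) +
        (if i = l then 1 else 0) + (if i = j ∧ j = l then 2 else 0) : ℤ) •
        (x a i * x b j * x c l) := by
  have h1 : offThree (tripleSum x) = offThree (fun a b c => rowSum x a * rowSum x b * rowSum x c +
      rowProd x a b * rowSum x c + rowSum x a * rowProd x b c + ∑ i, x a i * rowSum x b * x c i +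
      (2 : ℤ) • ∑ i, x a i * x b i * x c i) := by
    unfold tripleSum
    simp only [offThree_add, Finset.sum_add_distrib, offThree_zsmul]
    have e1 := offThree_swap_left (fun a b c => rowProd x a b * rowSum x c)
    have e2 := offThree_swap_right (fun a b c => rowSum x a * rowProd x b c)
    have e3 : offThree (fun a b c => ∑ i, x c i * rowSum x b * x a i) =
        offThree (fun a b c => ∑ i, x a i * rowSum x b * x c i) := by
      rw [← offThree_swap_left, ← offThree_swap_right, ← offThree_swap_left]
    have e4 : offThree (fun a b c => ∑ i, x b i * x c i * x a i) =
        offThree (fun a b c => ∑ i, x a i * x b i * x c i) :=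
      (offThree_swap_left (fun a b c => ∑ i, x a i * x c i * x b i)).trans
        (offThree_swap_right (fun a b c => ∑ i, x a i * x b i * x c i))
    have e5 : offThree (fun a b c => ∑ i, x c i * x a i * x b i) =
        offThree (fun a b c => ∑ i, x a i * x b i * x c i) :=
      (offThree_swap_right (fun a b c => ∑ i, x b i * x a i * x c i)).trans
        (offThree_swap_left (fun a b c => ∑ i, x a i * x b i * x c i))
    rw [e1, e2, e3, e4, e5, two_smul]
  rw [h1, offThree_eq_ite]
  refine Finset.sum_congr rfl fun a _ => Finset.sum_congr rfl fun b _ =>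
    Finset.sum_congr rfl fun c _ => ?_
  split_ifs with habc
  · simp
  · have h2 : ∀ i j l, (1 + (if i = j then 1 else 0) + (if j = l then 1 else 0) +
        (if i = l then 1 else 0) + (if i = j ∧ j = l then 2 else 0) : ℤ) •
        (x a i * x b j * x c l) = x a i * x b j * x c l +
        (if i = j then x a i * x b j * x c l else 0) +
        (if j = l then x a i * x b j * x c l else 0) +
        (if i = l then x a i * x b j * x c l else 0) +
        (if i = j then if j = l then (2 : ℤ) • (x a i * x b j * x c l) else 0 else 0) := by
      intro i j l
      split_ifs <;> first | module | (exfalso; simp_all)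
    simp only [h2, Finset.sum_add_distrib]
    refine congrArg₂ (· + ·) (congrArg₂ (· + ·) (congrArg₂ (· + ·) (congrArg₂ (· + ·) ?_ ?_) ?_)
      ?_) ?_
    · simp only [rowSum, ← Finset.mul_sum, ← Finset.sum_mul]
    · simp [rowProd, rowSum, Finset.sum_mul_sum, Finset.sum_ite_irrel]
    · simp [rowProd, rowSum, Finset.sum_mul_sum, mul_assoc]
    · simp [rowSum, Finset.sum_mul, Finset.mul_sum]
    · have : ∀ i, (∑ j, ∑ l, if i = j then if j = l then (2 : ℤ) • (x a i * x b j * x c l) else 0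
          else 0) = (2 : ℤ) • (x a i * x b i * x c i) := by
        intro i
        simp only [Finset.sum_ite_irrel, Finset.sum_const_zero, Finset.sum_ite_eq,
          Finset.mem_univ, if_true]
      simp only [this, Finset.smul_sum]

theorem weightedSum_weightTwo (x : α → β → A) :
    (weightedSum x fun R C => weightTwo R C 0 1 * weightTwo R C 2 3) =
      offTwo (pairSum x) * offTwo (pairSum x) := by
  rw [offTwo_pairSum]
  simp only [weightedSum, sum_fin_four]
  have e : ∀ (a b c d : α) (i j k l : β), (weightTwo (eqMat ![a, b, c, d]) (eqMat ![i, j, k, l]) 0 1 *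
      weightTwo (eqMat ![a, b, c, d]) (eqMat ![i, j, k, l]) 2 3) •
      wordProd x ![a, b, c, d] ![i, j, k, l] =
      ((if a = b then 0 else if i = j then 2 else 1 : ℤ) • (x a i * x b j)) *
      ((if c = d then 0 else if k = l then 2 else 1 : ℤ) • (x c k * x d l)) := by
    intro a b c d i j k l
    simp only [weightTwo, eqMat, wordProd, decide_eq_true_eq, smul_mul_smul_comm]
    congr 1
    simp only [Matrix.cons_val]
    noncomm_ring
  simp only [e]
  simp only [← Finset.mul_sum, ← Finset.sum_mul]

theorem weightedSum_weightThree (x : α → β → A) :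
    (weightedSum x fun R C => weightThree R C 1 2 3) =
      (∑ a, rowSum x a) * offThree (tripleSum x) := by
  rw [offThree_tripleSum]
  simp only [weightedSum, sum_fin_four, rowSum]
  have e : ∀ (a b c d : α) (i j k l : β), weightThree (eqMat ![a, b, c, d]) (eqMat ![i, j, k, l])
      1 2 3 • wordProd x ![a, b, c, d] ![i, j, k, l] =
      x a i * ((if b = c ∨ c = d ∨ b = d then 0 else 1 + (if j = k then 1 else 0) +
        (if k = l then 1 else 0) + (if j = l then 1 else 0) + (if j = k ∧ k = l then 2 else 0) : ℤ) •
        (x b j * x c k * x d l)) := by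
    intro a b c d i j k l
    simp only [weightThree, eqMat, wordProd, decide_eq_true_eq, mul_smul_comm, Bool.or_eq_true,
      Bool.and_eq_true, or_assoc]
    congr 1
    simp only [Matrix.cons_val]
    noncomm_ring
  simp only [e]
  simp only [← Finset.mul_sum, ← Finset.sum_mul]

/-- The weighted sum over all words in terms of the sums with distinct rows. -/
theorem BoxRel.weightedSum_wordWeight {x : α → β → A} {e : α → α → A} {p : α → β → A}
    (h : BoxRel x e p) :
    weightedSum x wordWeight = (3 : ℤ) • (offTwo (pairSum x) * offTwo (pairSum x)) -
      (2 : ℤ) • ((∑ a, rowSum x a) * offThree (tripleSum x)) +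
      ∑ a, ∑ i, p a i * ((6 : ℤ) • offTwo (pairSum x) - (12 : ℤ) • ((∑ d, rowSum x d) *
        ∑ c ∈ Finset.univ.erase a, (rowSum x c + e c a))) := by
  have h1 := h.weightTypes_eq
  have h2 : weightedSum x wordWeight =
      weightedSum x (fun R C => 3 * (weightTwo R C 0 1 * weightTwo R C 2 3) -
        2 * weightThree R C 1 2 3 - 6 * weightTypesTwo R C - 6 * weightTypesThree R C) := rfl
  rw [h2]
  simp only [weightedSum_sub (x := x), weightedSum_mul x 3, weightedSum_mul x 2,
    weightedSum_weightTwo, weightedSum_weightThree]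
  rw [eq_neg_iff_add_eq_zero, add_eq_zero_iff_eq_neg'] at h1
  rw [h1]
  abel

end Box

/-! ### Evaluation of polynomials at commuting elements -/

section EvalHom

variable {R A : Type} [CommRing R] [Ring A] [Algebra R A] {m : ℕ}

open scoped Function in
/-- Evaluation of polynomials at pairwise commuting elements, as an algebra homomorphism. -/
def evalHom (θ : Fin m → A) (hθ : ∀ i j, Commute (θ i) (θ j)) : MvPolynomial (Fin m) R →ₐ[R] A :=
  -- The subalgebra generated by pairwise commuting elements is commutative, so `aeval` is available
  -- there.
  letI : CommRing (Algebra.adjoin R (Set.range θ)) :=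
    { (inferInstance : Ring (Algebra.adjoin R (Set.range θ))) with
      mul_comm := (Algebra.isMulCommutative_adjoin R
        (by rintro _ ⟨i, rfl⟩ _ ⟨j, rfl⟩; exact hθ i j)).is_comm.comm }
  (Algebra.adjoin R (Set.range θ)).val.comp
    (MvPolynomial.aeval fun i => (⟨θ i, Algebra.subset_adjoin ⟨i, rfl⟩⟩ :
      Algebra.adjoin R (Set.range θ)))

variable {θ : Fin m → A} (hθ : ∀ i j, Commute (θ i) (θ j))

@[simp] theorem evalHom_X (i : Fin m) :
    evalHom (R := R) θ hθ (MvPolynomial.X i) = θ i := by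
  simp [evalHom]

theorem evalHom_monomial (a : Fin m →₀ ℕ) (r : R) :
    evalHom (R := R) θ hθ (MvPolynomial.monomial a r) =
      r • (List.ofFn fun i => θ i ^ a i).prod := by
  have h1 : (MvPolynomial.monomial a r : MvPolynomial (Fin m) R) =
      r • (List.ofFn fun i => (MvPolynomial.X i : MvPolynomial (Fin m) R) ^ a i).prod := by
    rw [List.prod_ofFn, MvPolynomial.monomial_eq, MvPolynomial.smul_eq_C_mul, Finsupp.prod_fintype]
    simp
  rw [h1, map_smul, map_list_prod, List.map_ofFn]
  congr 3
  funext i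
  simp

theorem evalAt_eq (f : MvPolynomial (Fin m) R) : evalAt θ f = evalHom θ hθ f := by
  conv_rhs => rw [f.as_sum, map_sum]
  exact Finset.sum_congr rfl fun a _ => (evalHom_monomial hθ a _).symm

theorem evalHom_ext (φ : MvPolynomial (Fin m) R →ₐ[R] A) (h : ∀ i, φ (MvPolynomial.X i) = θ i) :
    φ = evalHom θ hθ := MvPolynomial.algHom_ext fun i => by simp [h]

end EvalHom

/-! ### Divided differences -/

section DividedDiff

variable {R : Type} [CommRing R] {n : ℕ}

theorem sub_mul_dividedDiff (i j : Fin n) (f : MvPolynomial (Fin n) R) :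
    (MvPolynomial.X i - MvPolynomial.X j) * dividedDiff i j f =
      f - MvPolynomial.rename (Equiv.swap i j) f :=
  (sub_dvd_sub_rename_swap i j f).choose_spec.symm

variable [IsDomain R]

theorem X_sub_X_ne_zero {i j : Fin n} (hij : i ≠ j) :
    (MvPolynomial.X i - MvPolynomial.X j : MvPolynomial (Fin n) R) ≠ 0 := by
  rw [sub_ne_zero]
  exact fun h => hij (MvPolynomial.X_injective h)

/-- Over a domain the difference of two variables cancels, so the quotient picked by choice is
determined. All values of `dividedDiff` below come from this. -/
theorem dividedDiff_unique {i j : Fin n} (hij : i ≠ j) {f g : MvPolynomial (Fin n) R}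
    (h : (MvPolynomial.X i - MvPolynomial.X j) * g =
      f - MvPolynomial.rename (Equiv.swap i j) f) : dividedDiff i j f = g :=
  mul_left_cancel₀ (X_sub_X_ne_zero hij) ((sub_mul_dividedDiff i j f).trans h.symm)

theorem dividedDiff_mul {i j : Fin n} (hij : i ≠ j) (f g : MvPolynomial (Fin n) R) :
    dividedDiff i j (f * g) = dividedDiff i j f * g +
      MvPolynomial.rename (Equiv.swap i j) f * dividedDiff i j g := by
  apply dividedDiff_unique hij
  have h1 := sub_mul_dividedDiff i j f
  have h2 := sub_mul_dividedDiff i j g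
  rw [map_mul]
  linear_combination g * h1 + MvPolynomial.rename (Equiv.swap i j) f * h2

theorem dividedDiff_add {i j : Fin n} (hij : i ≠ j) (f g : MvPolynomial (Fin n) R) :
    dividedDiff i j (f + g) = dividedDiff i j f + dividedDiff i j g := by
  apply dividedDiff_unique hij
  have h1 := sub_mul_dividedDiff i j f
  have h2 := sub_mul_dividedDiff i j g
  rw [map_add]
  linear_combination h1 + h2

theorem dividedDiff_of_symm {i j : Fin n} (hij : i ≠ j) {f : MvPolynomial (Fin n) R}
    (h : MvPolynomial.rename (Equiv.swap i j) f = f) : dividedDiff i j f = 0 :=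
  dividedDiff_unique hij (by rw [h]; simp)

theorem dividedDiff_C {i j : Fin n} (hij : i ≠ j) (r : R) :
    dividedDiff i j (MvPolynomial.C r : MvPolynomial (Fin n) R) = 0 :=
  dividedDiff_of_symm hij (by simp)

theorem dividedDiff_X_left {i j : Fin n} (hij : i ≠ j) :
    dividedDiff i j (MvPolynomial.X i : MvPolynomial (Fin n) R) = 1 :=
  dividedDiff_unique hij (by simp)

theorem dividedDiff_X_right {i j : Fin n} (hij : i ≠ j) :
    dividedDiff i j (MvPolynomial.X j : MvPolynomial (Fin n) R) = -1 :=
  dividedDiff_unique hij (by simp)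

theorem dividedDiff_X_of_ne {i j a : Fin n} (hij : i ≠ j) (hi : a ≠ i) (hj : a ≠ j) :
    dividedDiff i j (MvPolynomial.X a : MvPolynomial (Fin n) R) = 0 :=
  dividedDiff_of_symm hij (by simp [Equiv.swap_apply_of_ne_of_ne hi hj])

theorem map_dividedDiff {S : Type} [CommRing S] [IsDomain S] (φ : R →+* S) {i j : Fin n}
    (hij : i ≠ j) (f : MvPolynomial (Fin n) R) :
    MvPolynomial.map φ (dividedDiff i j f) = dividedDiff i j (MvPolynomial.map φ f) := by
  symm
  apply dividedDiff_unique hij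
  have h1 := congrArg (MvPolynomial.map φ) (sub_mul_dividedDiff i j f)
  simpa [MvPolynomial.map_rename] using h1

/-- Used to pass from Schubert polynomials over R to those over R[q], where the operators act. -/
theorem map_schubert {S : Type} [CommRing S] [IsDomain S] (φ : R →+* S) (w : Equiv.Perm (Fin n)) :
    MvPolynomial.map φ (schubert R w) = schubert S w := by
  induction w using schubert.induct with
  | case1 w h hi ih =>
    rw [schubert, schubert, dif_pos h, dif_pos h, map_dividedDiff φ (by simp [Fin.ext_iff]), ih]
  | case2 w h =>
    rw [schubert, schubert, dif_neg h, dif_neg h]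
    simp

end DividedDiff

/-! ### Elementary symmetric polynomials of the first variables -/

section ElemSym

variable {R : Type} [CommRing R] {n : ℕ}

@[simp] theorem elemSym_zero (m : ℕ) : elemSym R n m 0 = 1 := by simp [elemSym]

theorem elemSym_of_lt {m i : ℕ} (h : m < i) : elemSym R n m i = 0 := by
  unfold elemSym
  rw [Finset.powersetCard_eq_empty.2, Finset.sum_empty]
  refine lt_of_le_of_lt ?_ h
  have : (Finset.univ.filter fun a : Fin n => a.val < m).card =
      ((Finset.univ.filter fun a : Fin n => a.val < m).image Fin.val).card :=
    (Finset.card_image_of_injective _ Fin.val_injective).symm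
  rw [this]
  refine (Finset.card_le_card (t := Finset.range m) ?_).trans (Finset.card_range m).le
  intro a ha
  simp only [Finset.mem_image, Finset.mem_filter, Finset.mem_univ, true_and] at ha
  obtain ⟨b, hb, rfl⟩ := ha
  exact Finset.mem_range.2 hb

theorem elemSym_succ {m : ℕ} (hm : m < n) (i : ℕ) :
    elemSym R n (m + 1) (i + 1) =
      elemSym R n m (i + 1) + MvPolynomial.X ⟨m, hm⟩ * elemSym R n m i := by
  classical
  unfold elemSym
  have h1 : (Finset.univ.filter fun a : Fin n => a.val < m + 1) =
      insert ⟨m, hm⟩ (Finset.univ.filter fun a : Fin n => a.val < m) := by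
    ext a
    simp only [Finset.mem_filter, Finset.mem_univ, true_and, Finset.mem_insert, Fin.ext_iff]
    omega
  have h2 : (⟨m, hm⟩ : Fin n) ∉ (Finset.univ.filter fun a : Fin n => a.val < m) := by simp
  rw [h1, Finset.powersetCard_succ_insert h2, Finset.sum_union, Finset.sum_image, Finset.mul_sum]
  · congr 1
    refine Finset.sum_congr rfl fun s hs => ?_
    rw [Finset.prod_insert]
    exact fun h => h2 ((Finset.mem_powersetCard.1 hs).1 h)
  · intro s hs t ht hst
    have hs' : (⟨m, hm⟩ : Fin n) ∉ s := fun h => h2 ((Finset.mem_powersetCard.1 hs).1 h)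
    have ht' : (⟨m, hm⟩ : Fin n) ∉ t := fun h => h2 ((Finset.mem_powersetCard.1 ht).1 h)
    rw [← Finset.erase_insert hs', ← Finset.erase_insert ht', hst]
  · rw [Finset.disjoint_left]
    intro s hs hs'
    obtain ⟨t, _, rfl⟩ := Finset.mem_image.1 hs'
    exact h2 ((Finset.mem_powersetCard.1 hs).1 (Finset.mem_insert_self _ _))

theorem rename_elemSym (e : Equiv.Perm (Fin n)) (m i : ℕ) (he : ∀ a, (e a).val < m ↔ a.val < m) :
    MvPolynomial.rename e (elemSym R n m i) = elemSym R n m i := by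
  classical
  unfold elemSym
  rw [map_sum]
  refine Finset.sum_bij (fun s _ => s.map e.toEmbedding) ?_ ?_ ?_ ?_
  · intro s hs
    rw [Finset.mem_powersetCard] at hs ⊢
    refine ⟨fun a ha => ?_, by rw [Finset.card_map, hs.2]⟩
    obtain ⟨b, hb, rfl⟩ := Finset.mem_map.1 ha
    have := hs.1 hb
    simpa [he] using this
  · intro s _ t _ h
    exact Finset.map_injective _ h
  · intro s hs
    rw [Finset.mem_powersetCard] at hs
    refine ⟨s.map e.symm.toEmbedding, ?_, ?_⟩
    · rw [Finset.mem_powersetCard, Finset.card_map]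
      refine ⟨fun a ha => ?_, hs.2⟩
      obtain ⟨b, hb, rfl⟩ := Finset.mem_map.1 ha
      have := hs.1 hb
      have h2 := he (e.symm b)
      simp only [Equiv.apply_symm_apply] at h2
      simpa [← h2] using this
    · ext a
      simp
  · intro s _
    rw [map_prod, Finset.prod_map]
    simp

theorem rename_swap_elemSym {i j : Fin n} (m r : ℕ) (h : i.val < m ↔ j.val < m) :
    MvPolynomial.rename (Equiv.swap i j) (elemSym R n m r) = elemSym R n m r := by
  apply rename_elemSym
  intro a
  rcases eq_or_ne a i with rfl | hi
  · rw [Equiv.swap_apply_left, h]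
  · rcases eq_or_ne a j with rfl | hj
    · rw [Equiv.swap_apply_right, h]
    · rw [Equiv.swap_apply_of_ne_of_ne hi hj]

theorem map_elemSym {S : Type} [CommRing S] (φ : R →+* S) (m i : ℕ) :
    MvPolynomial.map φ (elemSym R n m i) = elemSym S n m i := by
  simp [elemSym, map_sum, map_prod]

theorem map_elemProd {S : Type} [CommRing S] (φ : R →+* S) (I : ElemIndex n) :
    MvPolynomial.map φ (elemProd R I) = elemProd S I := by
  simp [elemProd, map_prod, map_elemSym]

theorem constantCoeff_elemSym (m i : ℕ) :
    MvPolynomial.constantCoeff (elemSym R n m (i + 1)) = 0 := by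
  unfold elemSym
  rw [map_sum]
  refine Finset.sum_eq_zero fun s hs => ?_
  rw [Finset.mem_powersetCard] at hs
  obtain ⟨a, ha⟩ := Finset.card_pos.1 (by omega : 0 < s.card)
  rw [map_prod]
  exact Finset.prod_eq_zero ha (MvPolynomial.constantCoeff_X _ _)

variable [IsDomain R]

theorem dividedDiff_elemSym_of_ne {i j : Fin n} (hij : i.val + 1 = j.val) {m : ℕ}
    (hm : m ≠ j.val) (r : ℕ) : dividedDiff i j (elemSym R n m r) = 0 :=
  dividedDiff_of_symm (fun h => by rw [h] at hij; omega) (rename_swap_elemSym m r (by omega))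

/-- With zero-based indices the first j variables include x_i but not x_j. The polynomial is linear
in x_i, and its coefficients are symmetric in x_i and x_j because they contain neither. -/
theorem dividedDiff_elemSym {i j : Fin n} (hij : i.val + 1 = j.val) (r : ℕ) :
    dividedDiff i j (elemSym R n j.val (r + 1)) = elemSym R n i.val r := by
  have hne : i ≠ j := fun h => by rw [h] at hij; omega
  rw [← hij, elemSym_succ i.isLt, dividedDiff_add hne, mul_comm, dividedDiff_mul hne,
    dividedDiff_X_left hne, rename_swap_elemSym _ _ (by omega),
    dividedDiff_elemSym_of_ne hij (by omega), dividedDiff_elemSym_of_ne hij (by omega)]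
  simp

end ElemSym

/-! ### Quantum Bruhat operators with arbitrary parameters -/

section Bruhat

variable {n : ℕ}

/-- `y` lies on the open arc that runs upwards from `x` to `z` on a circle. -/
def InArc (x y z : ℕ) : Prop := (x < y ∧ y < z) ∨ (z < x ∧ x < y) ∨ (y < z ∧ z < x)

theorem inArc_left_iff {x y z : ℕ} (h1 : x ≠ y) (h2 : y ≠ z) (h3 : x ≠ z) :
    InArc y x z ↔ ¬ InArc x y z := by unfold InArc; omega

theorem inArc_right_iff {x y z : ℕ} (h1 : x ≠ y) (h2 : y ≠ z) (h3 : x ≠ z) :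
    InArc x z y ↔ ¬ InArc x y z := by unfold InArc; omega

/-- No value of `w` at a position strictly between `i` and `j` lies on the arc from `x` to `z`. -/
def Free (w : Equiv.Perm (Fin n)) (i j : Fin n) (x z : ℕ) : Prop :=
  ∀ c, i < c → c < j → ¬ InArc x (w c).val z

/-- The step from `w` to `w s_{ij}` is an edge of the quantum Bruhat graph. -/
def Clear (w : Equiv.Perm (Fin n)) (i j : Fin n) : Prop := Free w i j (w i).val (w j).val

theorem free_split (w : Equiv.Perm (Fin n)) {i j k : Fin n} (hij : i < j) (hjk : j < k) (x z : ℕ) :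
    Free w i k x z ↔ Free w i j x z ∧ ¬ InArc x (w j).val z ∧ Free w j k x z := by
  constructor
  · exact fun h => ⟨fun c h1 h2 => h c h1 (h2.trans hjk), h j hij hjk,
      fun c h1 h2 => h c (hij.trans h1) h2⟩
  · rintro ⟨h1, h2, h3⟩ c hc hc'
    rcases lt_trichotomy c j with h | h | h
    · exact h1 c hc h
    · rw [h]; exact h2
    · exact h3 c h hc'

theorem free_mul_swap (w : Equiv.Perm (Fin n)) {i j a b : Fin n} (ha : a ≤ i ∨ j ≤ a)
    (hb : b ≤ i ∨ j ≤ b) (x z : ℕ) : Free (w * Equiv.swap a b) i j x z ↔ Free w i j x z := by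
  refine forall_congr' fun c => forall_congr' fun h1 => forall_congr' fun h2 => ?_
  rw [Equiv.Perm.mul_apply, Equiv.swap_apply_of_ne_of_ne]
  · rintro rfl; rcases ha with h | h <;> order
  · rintro rfl; rcases hb with h | h <;> order

/-- The value of w at b cuts the arc in two, and it is not taken strictly between i and j. -/
theorem free_arc (w : Equiv.Perm (Fin n)) {i j b : Fin n} (hb : b ≤ i ∨ j ≤ b) {x z : ℕ}
    (h : InArc x (w b).val z) :
    Free w i j x z ↔ Free w i j x (w b).val ∧ Free w i j (w b).val z := by
  unfold Free
  simp only [← forall_and]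
  refine forall_congr' fun c => forall_congr' fun h1 => forall_congr' fun h2 => ?_
  have hne : (w c).val ≠ (w b).val := by
    rw [Ne, Fin.val_inj, w.injective.eq_iff]
    rintro rfl; rcases hb with h | h <;> order
  unfold InArc at *
  omega

theorem val_ne (w : Equiv.Perm (Fin n)) {i j : Fin n} (h : i ≠ j) : (w i).val ≠ (w j).val := by
  rwa [Ne, Fin.val_inj, w.injective.eq_iff]

variable {S : Type} [CommRing S] (q : Fin (n - 1) → S)

/-- `q_{ij} = q_i q_{i+1} ⋯ q_{j-1}`. -/
def qWeight (i j : Fin n) : S :=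
  ∏ m ∈ Finset.univ.filter (fun m : Fin (n - 1) => i.val ≤ m.val ∧ m.val < j.val), q m

theorem qWeight_mul {i j k : Fin n} (hij : i < j) (hjk : j < k) :
    qWeight q i k = qWeight q i j * qWeight q j k := by
  unfold qWeight
  rw [← Finset.prod_union]
  · congr 1
    ext m
    simp only [Finset.mem_filter, Finset.mem_univ, true_and, Finset.mem_union]
    have h1 : i.val < j.val := hij
    have h2 : j.val < k.val := hjk
    omega
  · rw [Finset.disjoint_left]
    intro m
    simp only [Finset.mem_filter, Finset.mem_univ, true_and]
    omega

/-- The parameters of the Fomin–Kirillov algebra that acts by quantum Bruhat operators. -/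
def qParam (i j : Fin n) : S :=
  if h : i.val + 1 = j.val then q ⟨i.val, by have := j.isLt; omega⟩ else 0

theorem qWeight_succ {i j : Fin n} (h : i.val + 1 = j.val) : qWeight q i j = qParam q i j := by
  unfold qWeight qParam
  rw [dif_pos h]
  convert Finset.prod_singleton _ _ using 2
  ext m
  simp only [Finset.mem_filter, Finset.mem_univ, true_and, Finset.mem_singleton, Fin.ext_iff]
  omega

/-- The factor `q_{ij}` of a step down. -/
def stepFactor (w : Equiv.Perm (Fin n)) (i j : Fin n) : S :=
  if w j < w i then qWeight q i j else 1

open Classical in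
/-- The matrix coefficients of the quantum Bruhat operators. -/
def stepWeight (w : Equiv.Perm (Fin n)) (i j : Fin n) : S :=
  if Clear w i j then stepFactor q w i j else 0

/-- Formal linear combinations of permutations. -/
def FlagModule (n : ℕ) (S : Type) [CommRing S] : Type := Equiv.Perm (Fin n) →₀ S

instance : AddCommGroup (FlagModule n S) := inferInstanceAs (AddCommGroup (Equiv.Perm (Fin n) →₀ S))

instance : Module S (FlagModule n S) := inferInstanceAs (Module S (Equiv.Perm (Fin n) →₀ S))

/-- The multiple `r w` of a permutation. -/
def flag (w : Equiv.Perm (Fin n)) (r : S) : FlagModule n S := Finsupp.single w r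

/-- The coefficient of a permutation. -/
def coord (w : Equiv.Perm (Fin n)) : FlagModule n S →ₗ[S] S := Finsupp.lapply w

theorem coord_flag (w w' : Equiv.Perm (Fin n)) (r : S) [Decidable (w' = w)] :
    coord w (flag w' r) = if w' = w then r else 0 :=
  Finsupp.single_apply (a := w') (a' := w) (b := r)

theorem flagModule_ext {v v' : FlagModule n S} (h : ∀ w, coord w v = coord w v') : v = v' :=
  Finsupp.ext h

theorem eq_sum_flag (v : FlagModule n S) : v = ∑ w, flag w (coord w v) :=
  (Finsupp.univ_sum_single (α := Equiv.Perm (Fin n)) v).symm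

theorem flagEnd_ext {f g : Module.End S (FlagModule n S)}
    (h : ∀ w r, f (flag w r) = g (flag w r)) : f = g := Finsupp.lhom_ext h

theorem flag_add (w : Equiv.Perm (Fin n)) (r s : S) : flag w (r + s) = flag w r + flag w s :=
  Finsupp.single_add w r s

theorem flag_zero (w : Equiv.Perm (Fin n)) : flag w (0 : S) = 0 := Finsupp.single_zero w

theorem smul_flag (w : Equiv.Perm (Fin n)) (r s : S) : r • flag w s = flag w (r * s) :=
  Finsupp.smul_single r w s

/-- The quantum Bruhat operator with parameters `q`. -/
def stepOp (i j : Fin n) : Module.End S (FlagModule n S) :=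
  Finsupp.linearCombination S fun w : Equiv.Perm (Fin n) =>
    flag (w * Equiv.swap i j) (stepWeight q w i j)

theorem stepOp_flag (i j : Fin n) (w : Equiv.Perm (Fin n)) (r : S) :
    stepOp q i j (flag w r) = flag (w * Equiv.swap i j) (r * stepWeight q w i j) :=
  (Finsupp.linearCombination_single S r w).trans (smul_flag _ _ _)

theorem stepOp_mul_flag (a b c d : Fin n) (w : Equiv.Perm (Fin n)) (r : S) :
    (stepOp q a b * stepOp q c d) (flag w r) =
      flag (w * Equiv.swap c d * Equiv.swap a b)
        (r * (stepWeight q w c d * stepWeight q (w * Equiv.swap c d) a b)) := by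
  rw [Module.End.mul_apply, stepOp_flag, stepOp_flag, mul_assoc r]

theorem stepWeight_mul (w w' : Equiv.Perm (Fin n)) (a b c d : Fin n) [Decidable (Clear w a b ∧ Clear w' c d)]:
    stepWeight q w a b * stepWeight q w' c d =
      if Clear w a b ∧ Clear w' c d then stepFactor q w a b * stepFactor q w' c d else 0 := by
  unfold stepWeight
  split_ifs <;> simp_all

/-- Going along an edge and back requires both complementary arcs to be free, which is impossible if
there is a position in between. For neighbouring positions exactly one of the two steps goes down
and contributes the parameter. -/
theorem stepOp_square {i j : Fin n} (h : i < j) :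
    stepOp q i j * stepOp q i j = algebraMap S _ (qParam q i j) := by
  classical
  refine flagEnd_ext fun w r => ?_
  rw [stepOp_mul_flag, mul_assoc, Equiv.swap_mul_self, mul_one, stepWeight_mul,
    Module.algebraMap_end_apply, smul_flag, mul_comm r]
  have hv := val_ne w h.ne
  have hF : stepFactor q w i j * stepFactor q (w * Equiv.swap i j) i j = qWeight q i j := by
    simp only [stepFactor, Equiv.Perm.mul_apply, Equiv.swap_apply_left, Equiv.swap_apply_right,
      Fin.lt_def]
    split_ifs <;> first | omega | simp
  have hC : (Clear w i j ∧ Clear (w * Equiv.swap i j) i j) ↔ i.val + 1 = j.val := by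
    unfold Clear
    rw [free_mul_swap _ (by simp) (by simp)]
    simp only [Equiv.Perm.mul_apply, Equiv.swap_apply_left, Equiv.swap_apply_right]
    constructor
    · rintro ⟨h1, h2⟩
      -- If the positions are not neighbours, the value at position i + 1 lies on one of the two
      -- arcs.
      by_contra hne
      have hlt : i.val < j.val := h
      have h3 := h1 ⟨i.val + 1, by omega⟩ (by simp [Fin.lt_def]) (by simp only [Fin.lt_def]; omega)
      have h4 := h2 ⟨i.val + 1, by omega⟩ (by simp [Fin.lt_def]) (by simp only [Fin.lt_def]; omega)
      have h5 := val_ne w (i := ⟨i.val + 1, by omega⟩) (j := i) (by simp [Fin.ext_iff])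
      have h6 := val_ne w (i := ⟨i.val + 1, by omega⟩) (j := j) (by simp [Fin.ext_iff]; omega)
      unfold InArc at h3 h4
      omega
    · intro h1
      constructor <;> intro c hc hc' <;> simp only [Fin.lt_def] at hc hc' <;> omega
  rw [hF]
  by_cases h1 : i.val + 1 = j.val
  · rw [if_pos (hC.2 h1), qWeight_succ q h1]
  · rw [if_neg (mt hC.1 h1), qParam, dif_neg h1]

/-- All three products lead to the same permutation, so coefficients are compared. If the value at j
lies on the arc from the value at i to the value at k, the direct step from i to k is blocked and
the left side matches the first summand. Otherwise the first summand is blocked and the second one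
matches. -/
theorem stepOp_triangle {i j k : Fin n} (hij : i < j) (hjk : j < k) :
    stepOp q i j * stepOp q j k =
      stepOp q i k * stepOp q i j + stepOp q j k * stepOp q i k := by
  classical
  refine flagEnd_ext fun w r => ?_
  rw [LinearMap.add_apply, stepOp_mul_flag, stepOp_mul_flag, stepOp_mul_flag]
  have hik := hij.trans hjk
  have s1 : Equiv.swap j k i = i := Equiv.swap_apply_of_ne_of_ne hij.ne hik.ne
  have s2 : Equiv.swap i j k = k := Equiv.swap_apply_of_ne_of_ne hik.ne' hjk.ne'
  have s3 : Equiv.swap i k j = j := Equiv.swap_apply_of_ne_of_ne hij.ne' hjk.ne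
  have e1 : w * Equiv.swap i j * Equiv.swap i k = w * Equiv.swap j k * Equiv.swap i j := by
    rw [mul_assoc, mul_assoc, Equiv.mul_swap_eq_swap_mul, s2, Equiv.swap_apply_left]
  have e2 : w * Equiv.swap i k * Equiv.swap j k = w * Equiv.swap j k * Equiv.swap i j := by
    rw [mul_assoc, mul_assoc, Equiv.mul_swap_eq_swap_mul (Equiv.swap j k), s1,
      Equiv.swap_apply_left, Equiv.mul_swap_eq_swap_mul (Equiv.swap i k), s3,
      Equiv.swap_apply_right, Equiv.swap_comm j i, Equiv.mul_swap_eq_swap_mul (Equiv.swap i j), s2,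
      Equiv.swap_apply_left]
  rw [e1, e2, ← flag_add, ← mul_add]
  congr 2
  have hab := val_ne w hij.ne
  have hbc := val_ne w hjk.ne
  have hac := val_ne w hik.ne
  simp only [stepWeight_mul]
  have c1 : Clear w j k ↔ Free w j k (w j) (w k) := Iff.rfl
  have c2 : Clear w i j ↔ Free w i j (w i) (w j) := Iff.rfl
  have c3 : Clear w i k ↔ Free w i j (w i) (w k) ∧ ¬ InArc (w i) (w j) (w k) ∧
      Free w j k (w i) (w k) := free_split w hij hjk _ _
  have c4 : Clear (w * Equiv.swap j k) i j ↔ Free w i j (w i) (w k) := by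
    unfold Clear
    rw [free_mul_swap _ (by simp) (by simp [hjk.le])]
    simp [s1]
  have c5 : Clear (w * Equiv.swap i j) i k ↔ Free w i j (w j) (w k) ∧ ¬ InArc (w j) (w i) (w k) ∧
      Free w j k (w j) (w k) := by
    unfold Clear
    rw [free_split _ hij hjk, free_mul_swap _ (by simp) (by simp),
      free_mul_swap _ (by simp [hij.le]) (by simp)]
    simp [s2]
  have c6 : Clear (w * Equiv.swap i k) j k ↔ Free w j k (w j) (w i) := by
    unfold Clear
    rw [free_mul_swap _ (by simp [hij.le]) (by simp)]
    simp [s3]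
  have f : stepFactor q w j k * stepFactor q (w * Equiv.swap j k) i j =
      if InArc (w i) (w j) (w k) then
        stepFactor q w i j * stepFactor q (w * Equiv.swap i j) i k
      else stepFactor q w i k * stepFactor q (w * Equiv.swap i k) j k := by
    simp only [stepFactor, Equiv.Perm.mul_apply, s1, s2, s3, Equiv.swap_apply_left,
      Equiv.swap_apply_right, Fin.lt_def, qWeight_mul q hij hjk, InArc]
    split_ifs <;> first | omega | ring
  rw [f]
  by_cases harc : InArc (w i) (w j) (w k)
  · have h1 : ¬ Clear w i k := fun h => (c3.1 h).2.1 harc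
    have h2 := fun h => (inArc_left_iff hab hbc hac).1 h harc
    have h3 := free_arc w (i := i) (j := j) (b := j) (by simp) harc
    simp only [h1, false_and, if_false, add_zero, if_pos harc]
    refine if_congr ?_ rfl rfl
    rw [c1, c4, c2, c5]
    exact ⟨fun ⟨x, y⟩ => ⟨(h3.1 y).1, (h3.1 y).2, h2, x⟩, fun ⟨x, y, _, z⟩ => ⟨z, h3.2 ⟨x, y⟩⟩⟩
  · have h2 := (inArc_left_iff hab hbc hac).2 harc
    have h1 : ¬ Clear (w * Equiv.swap i j) i k := fun h => (c5.1 h).2.1 h2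
    have h3 := free_arc w (i := j) (j := k) (b := i) (by simp [hij.le]) h2
    simp only [h1, and_false, if_false, zero_add, if_neg harc]
    refine if_congr ?_ rfl rfl
    rw [c1, c4, c3, c6]
    exact ⟨fun ⟨x, y⟩ => ⟨⟨y, harc, (h3.1 x).2⟩, (h3.1 x).1⟩, fun ⟨⟨x, _, y⟩, z⟩ => ⟨h3.2 ⟨z, y⟩, x⟩⟩

theorem stepOp_triangle_rev {i j k : Fin n} (hij : i < j) (hjk : j < k) :
    stepOp q j k * stepOp q i j =
      stepOp q i j * stepOp q i k + stepOp q i k * stepOp q j k := by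
  classical
  refine flagEnd_ext fun w r => ?_
  rw [LinearMap.add_apply, stepOp_mul_flag, stepOp_mul_flag, stepOp_mul_flag]
  have hik := hij.trans hjk
  have s1 : Equiv.swap j k i = i := Equiv.swap_apply_of_ne_of_ne hij.ne hik.ne
  have s2 : Equiv.swap i j k = k := Equiv.swap_apply_of_ne_of_ne hik.ne' hjk.ne'
  have s3 : Equiv.swap i k j = j := Equiv.swap_apply_of_ne_of_ne hij.ne' hjk.ne
  have e1 : w * Equiv.swap i k * Equiv.swap i j = w * Equiv.swap i j * Equiv.swap j k := by
    rw [mul_assoc, mul_assoc, Equiv.mul_swap_eq_swap_mul (Equiv.swap i j), s2,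
      Equiv.swap_apply_right]
  have e2 : w * Equiv.swap j k * Equiv.swap i k = w * Equiv.swap i j * Equiv.swap j k := by
    rw [mul_assoc, mul_assoc, Equiv.mul_swap_eq_swap_mul (Equiv.swap j k), s1,
      Equiv.swap_apply_right]
  rw [e1, e2, ← flag_add, ← mul_add]
  congr 2
  have hab := val_ne w hij.ne
  have hbc := val_ne w hjk.ne
  have hac := val_ne w hik.ne
  simp only [stepWeight_mul]
  have c1 : Clear w j k ↔ Free w j k (w j) (w k) := Iff.rfl
  have c2 : Clear w i j ↔ Free w i j (w i) (w j) := Iff.rfl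
  have c3 : Clear w i k ↔ Free w i j (w i) (w k) ∧ ¬ InArc (w i) (w j) (w k) ∧
      Free w j k (w i) (w k) := free_split w hij hjk _ _
  have c4 : Clear (w * Equiv.swap i j) j k ↔ Free w j k (w i) (w k) := by
    unfold Clear
    rw [free_mul_swap _ (by simp [hij.le]) (by simp)]
    simp [s2]
  have c5 : Clear (w * Equiv.swap j k) i k ↔ Free w i j (w i) (w j) ∧ ¬ InArc (w i) (w k) (w j) ∧
      Free w j k (w i) (w j) := by
    unfold Clear
    rw [free_split _ hij hjk, free_mul_swap _ (by simp) (by simp [hjk.le]),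
      free_mul_swap _ (by simp) (by simp)]
    simp [s1]
  have c6 : Clear (w * Equiv.swap i k) i j ↔ Free w i j (w k) (w j) := by
    unfold Clear
    rw [free_mul_swap _ (by simp) (by simp [hjk.le])]
    simp [s3]
  have f : stepFactor q w i j * stepFactor q (w * Equiv.swap i j) j k =
      if InArc (w i) (w j) (w k) then
        stepFactor q w j k * stepFactor q (w * Equiv.swap j k) i k
      else stepFactor q w i k * stepFactor q (w * Equiv.swap i k) i j := by
    simp only [stepFactor, Equiv.Perm.mul_apply, s1, s2, s3, Equiv.swap_apply_left,
      Equiv.swap_apply_right, Fin.lt_def, qWeight_mul q hij hjk, InArc]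
    split_ifs <;> first | omega | ring
  rw [f]
  by_cases harc : InArc (w i) (w j) (w k)
  · have h1 : ¬ Clear w i k := fun h => (c3.1 h).2.1 harc
    have h2 := fun h => (inArc_right_iff hab hbc hac).1 h harc
    have h3 := free_arc w (i := j) (j := k) (b := j) (by simp) harc
    simp only [h1, false_and, if_false, zero_add, if_pos harc]
    refine if_congr ?_ rfl rfl
    rw [c1, c4, c2, c5]
    exact ⟨fun ⟨x, y⟩ => ⟨(h3.1 y).2, x, h2, (h3.1 y).1⟩, fun ⟨x, y, _, z⟩ => ⟨y, h3.2 ⟨z, x⟩⟩⟩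
  · have h2 := (inArc_right_iff hab hbc hac).2 harc
    have h1 : ¬ Clear (w * Equiv.swap j k) i k := fun h => (c5.1 h).2.1 h2
    have h3 := free_arc w (i := i) (j := j) (b := k) (by simp [hjk.le]) h2
    simp only [h1, and_false, if_false, add_zero, if_neg harc]
    refine if_congr ?_ rfl rfl
    rw [c2, c4, c3, c6]
    exact ⟨fun ⟨x, y⟩ => ⟨⟨(h3.1 x).1, harc, y⟩, (h3.1 x).2⟩,
      fun ⟨⟨x, _, y⟩, z⟩ => ⟨h3.2 ⟨x, z⟩, y⟩⟩

/-- The weights of the two steps do not influence each other. Clearness is compared for disjoint,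
crossing and nested position intervals, which are the three cases below. -/
theorem stepOp_comm_of_lt {i j k l : Fin n} (hij : i < j) (hkl : k < l) (hik : i < k)
    (hil : i ≠ l) (hjk : j ≠ k) (hjl : j ≠ l) :
    stepOp q i j * stepOp q k l = stepOp q k l * stepOp q i j := by
  classical
  refine flagEnd_ext fun w r => ?_
  rw [stepOp_mul_flag, stepOp_mul_flag]
  have s1 : Equiv.swap i j k = k := Equiv.swap_apply_of_ne_of_ne hik.ne' hjk.symm
  have s2 : Equiv.swap i j l = l := Equiv.swap_apply_of_ne_of_ne hil.symm hjl.symm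
  have s3 : Equiv.swap k l i = i := Equiv.swap_apply_of_ne_of_ne hik.ne hil
  have s4 : Equiv.swap k l j = j := Equiv.swap_apply_of_ne_of_ne hjk hjl
  have e1 : w * Equiv.swap i j * Equiv.swap k l = w * Equiv.swap k l * Equiv.swap i j := by
    rw [mul_assoc, mul_assoc, Equiv.mul_swap_eq_swap_mul (Equiv.swap i j), s1, s2]
  rw [e1]
  congr 2
  simp only [stepWeight_mul]
  have f : stepFactor q w k l * stepFactor q (w * Equiv.swap k l) i j =
      stepFactor q w i j * stepFactor q (w * Equiv.swap i j) k l := by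
    simp only [stepFactor, Equiv.Perm.mul_apply, s1, s2, s3, s4]
    exact mul_comm _ _
  rw [f]
  refine if_congr ?_ rfl rfl
  unfold Clear
  simp only [Equiv.Perm.mul_apply, s1, s2, s3, s4]
  rcases lt_or_gt_of_ne hjk with h1 | h1
  · rw [free_mul_swap _ (by simp [h1.le]) (by simp [(h1.trans hkl).le]),
      free_mul_swap _ (by simp [hik.le]) (by simp [h1.le]), and_comm]
  rcases lt_or_gt_of_ne hjl with h2 | h2
  · have hab := val_ne w hik.ne
    have hac := val_ne w hij.ne
    have had := val_ne w hil
    have hbc := val_ne w hjk.symm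
    have hbd := val_ne w hkl.ne
    have hcd := val_ne w hjl
    rw [free_split w h1 h2, free_split (w * Equiv.swap k l) hik h1, free_split w hik h1,
      free_split (w * Equiv.swap i j) h1 h2,
      free_mul_swap w (i := i) (j := k) (a := k) (by simp) (by simp [hkl.le]),
      free_mul_swap w (i := k) (j := j) (a := k) (by simp) (by simp [h2.le]),
      free_mul_swap w (i := k) (j := j) (a := i) (by simp [hik.le]) (by simp),
      free_mul_swap w (i := j) (j := l) (a := i) (by simp [hij.le]) (by simp)]
    simp only [Equiv.Perm.mul_apply, Equiv.swap_apply_left, Equiv.swap_apply_right]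
    -- For crossing intervals the conditions at the inner endpoints agree only jointly for the two
    -- orders of steps, not one by one.
    have h3 : (¬ InArc (w k) (w j) (w l) ∧ ¬ InArc (w i) (w l) (w j)) ↔
        (¬ InArc (w i) (w k) (w j) ∧ ¬ InArc (w k) (w i) (w l)) := by unfold InArc; omega
    exact ⟨fun ⟨⟨x, y, z⟩, a, b, c⟩ => ⟨⟨a, (h3.1 ⟨y, b⟩).1, c⟩, x, (h3.1 ⟨y, b⟩).2, z⟩,
      fun ⟨⟨x, y, z⟩, a, b, c⟩ => ⟨⟨a, (h3.2 ⟨y, b⟩).1, c⟩, x, (h3.2 ⟨y, b⟩).2, z⟩⟩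
  · rw [free_mul_swap w (i := k) (j := l) (by simp [hik.le]) (by simp [h2.le]),
      free_split (w * Equiv.swap k l) hik h1, free_split (w * Equiv.swap k l) hkl h2,
      free_split w hik h1, free_split w hkl h2, free_mul_swap _ (by simp) (by simp [hkl.le]),
      free_mul_swap _ (by simp) (by simp), free_mul_swap _ (by simp [hkl.le]) (by simp)]
    simp only [Equiv.Perm.mul_apply, Equiv.swap_apply_left, Equiv.swap_apply_right]
    exact ⟨fun ⟨x, a, b, c, d, e⟩ => ⟨⟨a, d, c, b, e⟩, x⟩,
      fun ⟨⟨a, d, c, b, e⟩, x⟩ => ⟨x, a, b, c, d, e⟩⟩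

theorem stepOp_comm {i j k l : Fin n} (hij : i < j) (hkl : k < l) (hik : i ≠ k)
    (hil : i ≠ l) (hjk : j ≠ k) (hjl : j ≠ l) :
    stepOp q i j * stepOp q k l = stepOp q k l * stepOp q i j := by
  rcases lt_or_gt_of_ne hik with h | h
  · exact stepOp_comm_of_lt q hij hkl h hil hjk hjl
  · exact (stepOp_comm_of_lt q hkl hij h hjk.symm hil.symm hjl.symm).symm

/-- The Fomin–Kirillov algebra acts by quantum Bruhat operators. -/
def stepHom : FKAlgebra S (qParam (n := n) q) →ₐ[S] Module.End S (FlagModule n S) :=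
  RingQuot.liftAlgHom S ⟨FreeAlgebra.lift S fun g : Gen n => stepOp q g.1.1 g.1.2, by
    intro x y h
    cases h with
    | square h => simpa [freeGen] using stepOp_square q h
    | triangle hij hjk => simpa [freeGen] using stepOp_triangle q hij hjk
    | triangle_rev hij hjk => simpa [freeGen] using stepOp_triangle_rev q hij hjk
    | comm hij hkl h1 h2 h3 h4 => simpa [freeGen] using stepOp_comm q hij hkl h1 h2 h3 h4⟩

theorem stepHom_gen {i j : Fin n} (h : i < j) :
    stepHom q (gen (qParam q) i j) = stepOp q i j := by
  rw [gen_eq _ h]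
  unfold stepHom FKAlgebra.mk
  erw [RingQuot.liftAlgHom_mkAlgHom_apply]
  simp [freeGen]

end Bruhat

/-! ### Lengths -/

section Length

variable {n : ℕ}

theorem sum_eq_add_add_sum {M : Type} [AddCommMonoid M] {i j : Fin n} (h : i ≠ j) (f : Fin n → M) :
    ∑ a, f a = f i + (f j + ∑ a ∈ (Finset.univ.erase i).erase j, f a) := by
  rw [Finset.add_sum_erase _ f (by simp [h.symm]), Finset.add_sum_erase _ f (by simp)]

/-- The indicator of an inversion. -/
def invInd (w : Equiv.Perm (Fin n)) (a b : Fin n) : ℕ := if a < b ∧ w b < w a then 1 else 0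

theorem len_eq_sum (w : Equiv.Perm (Fin n)) : len w = ∑ a, ∑ b, invInd w a b := by
  unfold len invInd
  rw [Finset.card_filter, ← Finset.univ_product_univ, Finset.sum_product]

theorem len_decomp {i j : Fin n} (h : i ≠ j) (w : Equiv.Perm (Fin n)) :
    len w = invInd w i i + invInd w i j + invInd w j i + invInd w j j +
      ∑ c ∈ (Finset.univ.erase i).erase j,
        (invInd w i c + invInd w j c + invInd w c i + invInd w c j) +
      ∑ a ∈ (Finset.univ.erase i).erase j, ∑ b ∈ (Finset.univ.erase i).erase j, invInd w a b := by
  have key : ∀ a, ∑ b, invInd w a b = invInd w a i + (invInd w a j +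
      ∑ b ∈ (Finset.univ.erase i).erase j, invInd w a b) := fun a => sum_eq_add_add_sum h _
  rw [len_eq_sum, Finset.sum_congr rfl fun a _ => key a, sum_eq_add_add_sum h]
  simp only [Finset.sum_add_distrib]
  ring

/-- Apart from the exchanged pair, the number of inversions changes only through positions between i
and j whose values lie between the exchanged values. Each of them gains two inversions. -/
theorem len_mul_swap (w : Equiv.Perm (Fin n)) {i j : Fin n} (hij : i < j) (h : w i < w j) :
    len (w * Equiv.swap i j) = len w + 1 + 2 * (Finset.univ.filter fun c : Fin n =>
      (i < c ∧ c < j) ∧ w i < w c ∧ w c < w j).card := by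
  have hcard : (Finset.univ.filter fun c : Fin n =>
      (i < c ∧ c < j) ∧ w i < w c ∧ w c < w j).card =
      ∑ c ∈ (Finset.univ.erase i).erase j,
        if (i < c ∧ c < j) ∧ w i < w c ∧ w c < w j then 1 else 0 := by
    rw [Finset.card_filter, sum_eq_add_add_sum hij.ne]
    simp
  rw [hcard, len_decomp hij.ne, len_decomp hij.ne w, Finset.mul_sum]
  have h1 : ∀ c ∈ (Finset.univ.erase i).erase j,
      (invInd (w * Equiv.swap i j) i c + invInd (w * Equiv.swap i j) j c +
        invInd (w * Equiv.swap i j) c i + invInd (w * Equiv.swap i j) c j) =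
      (invInd w i c + invInd w j c + invInd w c i + invInd w c j) +
        2 * (if (i < c ∧ c < j) ∧ w i < w c ∧ w c < w j then 1 else 0) := by
    intro c hc
    simp only [Finset.mem_erase, Finset.mem_univ, and_true] at hc
    have hi := val_ne w hc.2
    have hj := val_ne w hc.1
    have hci : c.val ≠ i.val := fun h => hc.2 (Fin.ext h)
    have hcj : c.val ≠ j.val := fun h => hc.1 (Fin.ext h)
    simp only [invInd, Equiv.Perm.mul_apply, Equiv.swap_apply_left, Equiv.swap_apply_right,
      Equiv.swap_apply_of_ne_of_ne hc.2 hc.1, Fin.lt_def] at *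
    generalize (w c).val = x at *
    generalize (w i).val = y at *
    generalize (w j).val = z at *
    rcases lt_or_gt_of_ne hci with h1 | h1 <;> rcases lt_or_gt_of_ne hcj with h2 | h2 <;>
      rcases lt_or_gt_of_ne hi with h3 | h3 <;> rcases lt_or_gt_of_ne hj with h4 | h4 <;>
      first | omega | simp [h1, h2, h3, h4, h1.not_gt, h2.not_gt, h3.not_gt, h4.not_gt]
  have h2 : ∀ a ∈ (Finset.univ.erase i).erase j, ∀ b ∈ (Finset.univ.erase i).erase j,
      invInd (w * Equiv.swap i j) a b = invInd w a b := by
    intro a ha b hb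
    simp only [Finset.mem_erase, Finset.mem_univ, and_true] at ha hb
    simp only [invInd, Equiv.Perm.mul_apply, Equiv.swap_apply_of_ne_of_ne ha.2 ha.1,
      Equiv.swap_apply_of_ne_of_ne hb.2 hb.1]
  rw [Finset.sum_congr rfl h1, Finset.sum_congr rfl fun a ha => Finset.sum_congr rfl (h2 a ha),
    Finset.sum_add_distrib]
  have h3 : invInd (w * Equiv.swap i j) i i + invInd (w * Equiv.swap i j) i j +
      invInd (w * Equiv.swap i j) j i + invInd (w * Equiv.swap i j) j j =
      invInd w i i + invInd w i j + invInd w j i + invInd w j j + 1 := by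
    simp [invInd, h, hij, h.not_gt, hij.not_gt]
  rw [h3]
  ring

theorem len_mul_swap' (w : Equiv.Perm (Fin n)) {i j : Fin n} (hij : i < j) (h : w j < w i) :
    len w = len (w * Equiv.swap i j) + 1 + 2 * (Finset.univ.filter fun c : Fin n =>
      (i < c ∧ c < j) ∧ w j < w c ∧ w c < w i).card := by
  have h1 := len_mul_swap (w * Equiv.swap i j) hij (by simpa using h)
  rw [mul_assoc, Equiv.swap_mul_self, mul_one] at h1
  rw [h1]
  congr 3
  ext c
  simp only [Finset.mem_filter, Finset.mem_univ, true_and]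
  refine and_congr_right fun hc => ?_
  rw [Equiv.Perm.mul_apply, Equiv.Perm.mul_apply, Equiv.Perm.mul_apply, Equiv.swap_apply_left,
    Equiv.swap_apply_right, Equiv.swap_apply_of_ne_of_ne hc.1.ne' hc.2.ne]

theorem clear_iff_of_lt (w : Equiv.Perm (Fin n)) {i j : Fin n} (hij : i < j) (h : w i < w j) :
    Clear w i j ↔ len (w * Equiv.swap i j) = len w + 1 := by
  rw [len_mul_swap w hij h]
  simp only [add_eq_left, mul_eq_zero, OfNat.ofNat_ne_zero, false_or, Finset.card_eq_zero,
    Finset.filter_eq_empty_iff, Finset.mem_univ, true_implies]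
  unfold Clear Free InArc
  rw [Fin.lt_def] at h
  refine forall_congr' fun c => ?_
  simp only [Fin.lt_def]
  omega

theorem card_filter_between {i j : Fin n} :
    (Finset.univ.filter fun c : Fin n => i < c ∧ c < j).card = j.val - i.val - 1 := by
  rw [← Fin.card_Ioo]
  congr 1
  ext; simp

/-- For a step down the arc runs over the top and the bottom of the value range. It is free exactly
when all j - i - 1 positions in between take values between the two exchanged ones, which is the
largest possible drop in length. -/
theorem clear_iff_of_gt (w : Equiv.Perm (Fin n)) {i j : Fin n} (hij : i < j) (h : w j < w i) :
    Clear w i j ↔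
      (len (w * Equiv.swap i j) : ℤ) = len w - 2 * ((j.val : ℤ) - i.val) + 1 := by
  have h1 := len_mul_swap' w hij h
  have h2 := card_filter_between (i := i) (j := j)
  have hij' : i.val < j.val := hij
  have h3 : (len (w * Equiv.swap i j) : ℤ) = len w - 2 * ((j.val : ℤ) - i.val) + 1 ↔
      (Finset.univ.filter fun c : Fin n => i < c ∧ c < j).card ≤ (Finset.univ.filter fun c : Fin n =>
      (i < c ∧ c < j) ∧ w j < w c ∧ w c < w i).card := by
    have h4 : (Finset.univ.filter fun c : Fin n =>
      (i < c ∧ c < j) ∧ w j < w c ∧ w c < w i).card ≤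
      (Finset.univ.filter fun c : Fin n => i < c ∧ c < j).card := by
      refine Finset.card_le_card fun c hc => ?_
      simp only [Finset.mem_filter] at hc ⊢
      exact ⟨hc.1, hc.2.1⟩
    omega
  rw [h3]
  have h5 : (Finset.univ.filter fun c : Fin n => (i < c ∧ c < j) ∧ w j < w c ∧ w c < w i) ⊆
      (Finset.univ.filter fun c : Fin n => i < c ∧ c < j) := by
    intro c hc
    simp only [Finset.mem_filter] at hc ⊢
    exact ⟨hc.1, hc.2.1⟩
  constructor
  · intro hC
    refine Finset.card_le_card fun c hc => ?_
    simp only [Finset.mem_filter, Finset.mem_univ, true_and] at hc ⊢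
    refine ⟨hc, ?_⟩
    have := hC c hc.1 hc.2
    have h6 := val_ne w hc.1.ne
    have h7 := val_ne w hc.2.ne
    unfold InArc at this
    simp only [Fin.lt_def] at *
    omega
  · intro hle c hc hc'
    have h8 : c ∈ (Finset.univ.filter fun c : Fin n =>
        (i < c ∧ c < j) ∧ w j < w c ∧ w c < w i) := by
      rw [Finset.eq_of_subset_of_card_le h5 hle]
      simp [hc, hc']
    simp only [Finset.mem_filter, Finset.mem_univ, true_and, Fin.lt_def] at h8
    unfold InArc
    omega

/-- This joins the description by lengths with the description by arcs. The direction of a step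
decides which of the two length conditions can hold. -/
theorem bruhatOp_apply {i j : Fin n} (hij : i < j) (v : SchubertModule n) :
    bruhatOp i j v = stepOp (S := QCoeff ℤ n) MvPolynomial.X i j v := by
  suffices h : (bruhatOp i j : Module.End (QCoeff ℤ n) (SchubertModule n)) =
      stepOp (S := QCoeff ℤ n) MvPolynomial.X i j from congrArg (fun f => f v) h
  unfold bruhatOp stepOp
  congr 1
  funext w
  unfold stepWeight stepFactor
  have hij' : i.val < j.val := hij
  rcases lt_or_gt_of_ne (w.injective.ne hij.ne) with h | h
  · have h1 := clear_iff_of_lt w hij h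
    have h2 := len_mul_swap w hij h
    rw [if_neg h.not_gt]
    by_cases hC : Clear w i j
    · rw [if_pos (h1.1 hC), if_pos hC]; rfl
    · rw [if_neg (mt h1.2 hC), if_neg hC, if_neg (by omega), flag_zero]; rfl
  · have h1 := clear_iff_of_gt w hij h
    have h2 := len_mul_swap' w hij h
    rw [if_pos h, if_neg (by omega)]
    by_cases hC : Clear w i j
    · rw [if_pos (h1.1 hC), if_pos hC]; rfl
    · rw [if_neg (mt h1.2 hC), if_neg hC, flag_zero]; rfl

end Length

/-! ### Divided differences acting on formal combinations of permutations -/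

section Demazure

variable {n : ℕ} {S : Type} [CommRing S]

theorem clear_of_succ (w : Equiv.Perm (Fin n)) {i j : Fin n} (hij : i.val + 1 = j.val) :
    Clear w i j := by
  intro c h1 h2
  simp only [Fin.lt_def] at h1 h2
  omega

/-- The parameters with `q_i = 1` at one place and `0` elsewhere. -/
def unitParam (S : Type) [CommRing S] (i : ℕ) (m : Fin (n - 1)) : S := if m.val = i then 1 else 0

theorem qWeight_unitParam_self {i j : Fin n} (hij : i.val + 1 = j.val) :
    qWeight (unitParam S i.val) i j = 1 := by
  rw [qWeight_succ _ hij, qParam, dif_pos hij, unitParam, if_pos rfl]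

theorem qWeight_zero {i j : Fin n} (hij : i < j) : qWeight (0 : Fin (n - 1) → S) i j = 0 := by
  have hij' : i.val < j.val := hij
  exact Finset.prod_eq_zero (i := ⟨i.val, by omega⟩) (by simpa using hij) rfl

theorem qWeight_unitParam {i a b : Fin n} (hab : a < b)
    (h : ¬ (a.val = i.val ∧ b.val = i.val + 1)) : qWeight (unitParam S i.val) a b = 0 := by
  have hab' : a.val < b.val := hab
  by_cases h1 : a.val = i.val
  · exact Finset.prod_eq_zero (i := ⟨a.val + 1, by omega⟩)
      (by simp only [Finset.mem_filter, Finset.mem_univ, true_and]; omega)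
      (by rw [unitParam, if_neg]; simp only; omega)
  · exact Finset.prod_eq_zero (i := ⟨a.val, by omega⟩)
      (by simpa using hab) (by rw [unitParam, if_neg]; exact h1)

/-- The weight of a step down is a product of consecutive parameters. For every other pair of
positions this product contains one that is zero. -/
theorem stepOp_unitParam {i a b : Fin n} (hab : a < b)
    (h : ¬ (a.val = i.val ∧ b.val = i.val + 1)) :
    stepOp (unitParam S i.val) a b = stepOp 0 a b := by
  unfold stepOp stepWeight stepFactor
  rw [qWeight_unitParam hab h, qWeight_zero hab]

/-- The divided difference operator `σ_w ↦ σ_{w s_i}` if `w` has a descent at `i`, else `0`. -/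
def demazure (S : Type) [CommRing S] (i j : Fin n) : Module.End S (FlagModule n S) :=
  stepOp (unitParam S i.val) i j - stepOp 0 i j

theorem demazure_flag {i j : Fin n} (hij : i.val + 1 = j.val) (w : Equiv.Perm (Fin n)) (r : S) :
    demazure S i j (flag w r) =
      if w j < w i then flag (w * Equiv.swap i j) r else 0 := by
  have hlt : i < j := Fin.lt_def.2 (by omega)
  rw [demazure, LinearMap.sub_apply, stepOp_flag, stepOp_flag, stepWeight, stepWeight,
    if_pos (clear_of_succ w hij), if_pos (clear_of_succ w hij), stepFactor, stepFactor,
    qWeight_unitParam_self hij, qWeight_zero hlt]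
  split_ifs <;> simp [flag_zero]

theorem demazure_square {i j : Fin n} (hij : i.val + 1 = j.val) :
    demazure S i j * demazure S i j = 0 := by
  refine flagEnd_ext fun w r => ?_
  rw [Module.End.mul_apply, demazure_flag hij]
  split_ifs with h
  · rw [demazure_flag hij, if_neg]
    · rfl
    · simpa using h.le
  · simp

theorem stepOp_unitParam_self (i j : Fin n) :
    stepOp (unitParam S i.val) i j = stepOp 0 i j + demazure S i j := by
  rw [demazure, add_sub_cancel]

/-- The relations hold for the parameters 0 and for the parameters with a single 1. Subtracting one
from the other gives the relations between `demazure` and the classical operators; here the square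
changes from 0 to 1. The next lemmas treat the remaining relations in the same way. -/
theorem demazure_mul_step_self {i j : Fin n} (hij : i.val + 1 = j.val) :
    demazure S i j * stepOp 0 i j = 1 - stepOp 0 i j * demazure S i j := by
  have hlt : i < j := Fin.lt_def.2 (by omega)
  have h1 := stepOp_square (unitParam S i.val) hlt
  have h2 := stepOp_square (0 : Fin (n - 1) → S) hlt
  rw [← qWeight_succ _ hij, qWeight_unitParam_self hij, map_one, stepOp_unitParam_self] at h1
  rw [← qWeight_succ _ hij, qWeight_zero hlt, map_zero] at h2
  have h3 := demazure_square (S := S) hij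
  rw [← h1, add_mul, mul_add, mul_add, h2, h3]
  abel

theorem demazure_mul_right {i j l : Fin n} (hij : i.val + 1 = j.val) (hl : j < l) :
    demazure S i j * stepOp 0 j l = stepOp 0 i l * demazure S i j ∧
      demazure S i j * stepOp 0 i l = stepOp 0 j l * demazure S i j := by
  have hlt : i < j := Fin.lt_def.2 (by omega)
  have hl' : j.val < l.val := hl
  have h1 := stepOp_triangle (unitParam S i.val) hlt hl
  have h2 := stepOp_triangle (0 : Fin (n - 1) → S) hlt hl
  have h3 := stepOp_triangle_rev (unitParam S i.val) hlt hl
  have h4 := stepOp_triangle_rev (0 : Fin (n - 1) → S) hlt hl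
  rw [stepOp_unitParam_self, stepOp_unitParam hl (by omega),
    stepOp_unitParam (hlt.trans hl) (by omega)] at h1 h3
  rw [add_mul, mul_add, h2] at h1
  rw [add_mul, mul_add, h4] at h3
  refine ⟨add_left_cancel (h1.trans ?_), (add_left_cancel (h3.trans ?_)).symm⟩ <;> abel

theorem demazure_mul_left {i j l : Fin n} (hij : i.val + 1 = j.val) (hl : l < i) :
    demazure S i j * stepOp 0 l j = stepOp 0 l i * demazure S i j ∧
      demazure S i j * stepOp 0 l i = stepOp 0 l j * demazure S i j := by
  have hlt : i < j := Fin.lt_def.2 (by omega)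
  have hl' : l.val < i.val := hl
  have h1 := stepOp_triangle (unitParam S i.val) hl hlt
  have h2 := stepOp_triangle (0 : Fin (n - 1) → S) hl hlt
  have h3 := stepOp_triangle_rev (unitParam S i.val) hl hlt
  have h4 := stepOp_triangle_rev (0 : Fin (n - 1) → S) hl hlt
  rw [stepOp_unitParam_self, stepOp_unitParam hl (by omega),
    stepOp_unitParam (hl.trans hlt) (by omega)] at h1 h3
  rw [add_mul, mul_add, h2] at h1
  rw [add_mul, mul_add, h4] at h3
  refine ⟨(add_left_cancel (h1.trans ?_)).symm, add_left_cancel (h3.trans ?_)⟩ <;> abel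

theorem demazure_mul_of_disjoint {i j a b : Fin n} (hij : i.val + 1 = j.val) (hab : a < b)
    (h1 : a ≠ i) (h2 : a ≠ j) (h3 : b ≠ i) (h4 : b ≠ j) :
    demazure S i j * stepOp 0 a b = stepOp 0 a b * demazure S i j := by
  have hlt : i < j := Fin.lt_def.2 (by omega)
  have e1 := stepOp_comm (unitParam S i.val) hlt hab h1.symm h3.symm h2.symm h4.symm
  have e2 := stepOp_comm (0 : Fin (n - 1) → S) hlt hab h1.symm h3.symm h2.symm h4.symm
  rw [stepOp_unitParam_self, stepOp_unitParam hab (fun h => h1 (Fin.ext h.1))] at e1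
  rw [add_mul, mul_add, e2] at e1
  exact add_left_cancel e1

/-- The action of `x_{ij}` extended antisymmetrically. -/
def altOp (q : Fin (n - 1) → S) (i j : Fin n) : Module.End S (FlagModule n S) :=
  stepHom q (sgen (qParam q) i j)

theorem altOp_neg (q : Fin (n - 1) → S) (i j : Fin n) : altOp q j i = - altOp q i j := by
  rw [altOp, sgen_neg, map_neg, altOp]

theorem altOp_self (q : Fin (n - 1) → S) (i : Fin n) : altOp q i i = 0 := by
  rw [altOp, sgen, sub_self, map_zero]

theorem altOp_of_lt (q : Fin (n - 1) → S) {i j : Fin n} (h : i < j) :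
    altOp q i j = stepOp q i j := by
  rw [altOp, sgen, gen_zero _ h.not_gt, sub_zero, stepHom_gen q h]

theorem demazure_mul_altOp_of_lt {i j a b : Fin n} (hij : i.val + 1 = j.val) (hab : a < b) :
    demazure S i j * altOp 0 a b =
      altOp 0 (Equiv.swap i j a) (Equiv.swap i j b) * demazure S i j +
        if a = i ∧ b = j then 1 else 0 := by
  have hlt : i < j := Fin.lt_def.2 (by omega)
  have hab' : a.val < b.val := hab
  rw [altOp_of_lt _ hab]
  rcases eq_or_ne a i with rfl | h1
  · rcases eq_or_ne b j with rfl | h2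
    · rw [Equiv.swap_apply_left, Equiv.swap_apply_right, altOp_neg, altOp_of_lt _ hlt,
        demazure_mul_step_self hij]
      simp only [and_self, if_true]
      rw [neg_mul]; abel
    · have hjb : j < b := Fin.lt_def.2 (by
        have : b.val ≠ j.val := fun h => h2 (Fin.ext h)
        omega)
      rw [Equiv.swap_apply_left, Equiv.swap_apply_of_ne_of_ne hab.ne' h2, altOp_of_lt _ hjb,
        (demazure_mul_right hij hjb).2]
      simp [h2]
  rcases eq_or_ne a j with rfl | h2
  · rw [Equiv.swap_apply_right, Equiv.swap_apply_of_ne_of_ne (hlt.trans hab).ne' hab.ne',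
      altOp_of_lt _ (hlt.trans hab), (demazure_mul_right hij hab).1]
    simp [h1]
  rw [Equiv.swap_apply_of_ne_of_ne h1 h2]
  rcases eq_or_ne b i with rfl | h3
  · rw [Equiv.swap_apply_left, altOp_of_lt _ (hab.trans hlt), (demazure_mul_left hij hab).2]
    simp [h1]
  rcases eq_or_ne b j with rfl | h4
  · have hai : a < i := Fin.lt_def.2 (by
      have : a.val ≠ i.val := fun h => h1 (Fin.ext h)
      omega)
    rw [Equiv.swap_apply_right, altOp_of_lt _ hai, (demazure_mul_left hij hai).1]
    simp [h1]
  rw [Equiv.swap_apply_of_ne_of_ne h3 h4, altOp_of_lt _ hab,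
    demazure_mul_of_disjoint hij hab h1 h2 h3 h4]
  simp [h1]

theorem demazure_mul_altOp {i j : Fin n} (hij : i.val + 1 = j.val) (a b : Fin n) :
    demazure S i j * altOp 0 a b =
      altOp 0 (Equiv.swap i j a) (Equiv.swap i j b) * demazure S i j +
        ((if a = i ∧ b = j then 1 else 0) - if a = j ∧ b = i then 1 else 0) := by
  have hlt : i < j := Fin.lt_def.2 (by omega)
  rcases lt_trichotomy a b with h | rfl | h
  · rw [demazure_mul_altOp_of_lt hij h, if_neg (c := a = j ∧ b = i), sub_zero]
    rintro ⟨rfl, rfl⟩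
    exact lt_asymm h hlt
  · rw [altOp_self, altOp_self, mul_zero, zero_mul, if_neg, if_neg]
    · simp
    all_goals
      rintro ⟨rfl, h⟩
      exact hlt.ne (by simp [h])
  · rw [altOp_neg, altOp_neg _ (Equiv.swap i j b), mul_neg, demazure_mul_altOp_of_lt hij h,
      if_neg (c := a = i ∧ b = j)]
    · simp only [and_comm, neg_add, neg_mul, zero_sub]
    · rintro ⟨rfl, rfl⟩
      exact lt_asymm h hlt

/-- The action of the Dunkl element `θ_i`. -/
def dunklOp (q : Fin (n - 1) → S) (i : Fin n) : Module.End S (FlagModule n S) :=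
  stepHom q (dunkl (qParam q) i)

theorem dunklOp_eq (q : Fin (n - 1) → S) (i : Fin n) : dunklOp q i = ∑ j, altOp q i j := by
  rw [dunklOp, dunkl_eq, map_sum]; rfl

theorem dunklOp_commute (q : Fin (n - 1) → S) (i j : Fin n) :
    Commute (dunklOp q i) (dunklOp q j) := (dunkl_commute _ i j).map _

/-- The action of polynomials through the Dunkl elements. -/
def polyOp (q : Fin (n - 1) → S) :
    MvPolynomial (Fin n) S →ₐ[S] Module.End S (FlagModule n S) :=
  evalHom (dunklOp q) (dunklOp_commute q)

@[simp] theorem polyOp_X (q : Fin (n - 1) → S) (i : Fin n) :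
    polyOp q (MvPolynomial.X i) = dunklOp q i := evalHom_X _ i

theorem polyOp_eq_stepHom (q : Fin (n - 1) → S) (f : MvPolynomial (Fin n) S) :
    polyOp q f = stepHom q (evalHom (dunkl (qParam q)) (dunkl_commute _) f) := by
  have h : (stepHom q).comp (evalHom (R := S) (dunkl (qParam q)) (dunkl_commute _)) = polyOp q :=
    evalHom_ext _ _ fun i => by simp [dunklOp]
  rw [← h]; rfl

/-- Summing over the second index absorbs the transposition of that index. What remains is the
twisted Leibniz rule of the divided difference on one variable. -/
theorem demazure_mul_dunklOp {i j : Fin n} (hij : i.val + 1 = j.val) (a : Fin n) :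
    demazure S i j * dunklOp 0 a = dunklOp 0 (Equiv.swap i j a) * demazure S i j +
      ((if a = i then 1 else 0) - if a = j then 1 else 0) := by
  rw [dunklOp_eq, dunklOp_eq, Finset.mul_sum,
    Finset.sum_congr rfl fun b _ => demazure_mul_altOp hij a b, Finset.sum_add_distrib,
    Finset.sum_sub_distrib, ← Finset.sum_mul]
  congr 1
  · congr 1
    exact Equiv.sum_comp (Equiv.swap i j) fun b => altOp 0 (Equiv.swap i j a) b
  · have h : ∀ x y : Fin n, ∑ b, (if a = x ∧ b = y then (1 : Module.End S (FlagModule n S)) else 0) =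
        if a = x then 1 else 0 := by
      intro x y
      by_cases h : a = x
      · simp only [h, true_and, Finset.sum_ite_eq', Finset.mem_univ, if_true]
      · simp only [h, false_and, if_false, Finset.sum_const_zero]
    rw [h, h]

/-- Both sides follow the same twisted Leibniz rule in f, so constants and variables suffice. -/
theorem demazure_mul_polyOp [IsDomain S] {i j : Fin n} (hij : i.val + 1 = j.val)
    (f : MvPolynomial (Fin n) S) :
    demazure S i j * polyOp 0 f =
      polyOp 0 (dividedDiff i j f) +
        polyOp 0 (MvPolynomial.rename (Equiv.swap i j) f) * demazure S i j := by
  have hne : i ≠ j := fun h => by rw [h] at hij; omega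
  induction f using MvPolynomial.induction_on with
  | C r =>
    rw [dividedDiff_C hne, map_zero, zero_add, MvPolynomial.rename_C, ← MvPolynomial.algebraMap_eq,
      AlgHom.commutes]
    exact (Algebra.commutes r _).symm
  | add p p' hp hp' =>
    rw [dividedDiff_add hne]
    simp only [map_add, mul_add, add_mul, hp, hp']
    abel
  | mul_X p a hp =>
    have hX : polyOp (0 : Fin (n - 1) → S) (dividedDiff i j (MvPolynomial.X a)) =
        (if a = i then 1 else 0) - if a = j then 1 else 0 := by
      rcases eq_or_ne a i with rfl | h1
      · rw [dividedDiff_X_left hne]; simp [hne]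
      rcases eq_or_ne a j with rfl | h2
      · rw [dividedDiff_X_right hne]; simp [h1]
      rw [dividedDiff_X_of_ne hne h1 h2]; simp [h1, h2]
    rw [dividedDiff_mul hne]
    simp only [map_mul, map_add, MvPolynomial.rename_X, polyOp_X, hX]
    rw [← mul_assoc, hp, add_mul, mul_assoc (polyOp 0 _) (demazure S i j), demazure_mul_dunklOp hij,
      mul_add, mul_assoc, add_assoc]
    congr 1
    rw [add_comm]

theorem demazure_polyOp [IsDomain S] {i j : Fin n} (hij : i.val + 1 = j.val)
    (f : MvPolynomial (Fin n) S) {v : FlagModule n S} (hv : demazure S i j v = 0) :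
    demazure S i j (polyOp 0 f v) = polyOp 0 (dividedDiff i j f) v := by
  rw [← Module.End.mul_apply, demazure_mul_polyOp hij, LinearMap.add_apply, Module.End.mul_apply,
    hv, map_zero, add_zero]

end Demazure

/-! ### Schubert polynomials at the classical Dunkl operators -/

section SchubertAction

variable {n : ℕ} {S : Type} [CommRing S]

/-- A strictly increasing sequence of n values below n is the identity: counting from the left
bounds it below, counting from the right bounds it above. It serves to recognise permutations
without descents or without ascents. -/
theorem eq_val_of_step {f : Fin n → ℕ} (hf : ∀ a, f a < n)
    (h : ∀ a b : Fin n, a.val + 1 = b.val → f a < f b) (c : Fin n) : f c = c.val := by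
  have h1 : ∀ t, ∀ c : Fin n, c.val = t → t ≤ f c := by
    intro t
    induction t with
    | zero => intro c _; exact Nat.zero_le _
    | succ t ih =>
      intro c hc
      have hc' := c.isLt
      have h2 := ih ⟨t, by omega⟩ rfl
      have h3 := h ⟨t, by omega⟩ c (by simp [hc])
      omega
  have h2 : ∀ t, ∀ c : Fin n, c.val + t + 1 = n → f c + t + 1 ≤ n := by
    intro t
    induction t with
    | zero => intro c _; exact hf c
    | succ t ih =>
      intro c hc
      have h2 := ih ⟨c.val + 1, by omega⟩ (by simp; omega)
      have h3 := h c ⟨c.val + 1, by omega⟩ rfl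
      omega
  have h3 := h1 c.val c rfl
  have h4 := h2 (n - 1 - c.val) c (by omega)
  omega

theorem stepOp_zero_flag_of_gt {i j : Fin n} (hij : i < j) {w : Equiv.Perm (Fin n)}
    (h : w j < w i) (r : S) : stepOp 0 i j (flag w r) = 0 := by
  rw [stepOp_flag, stepWeight, stepFactor, if_pos h, qWeight_zero hij]
  simp [flag_zero]

theorem stepOp_zero_flag_of_not_clear {i j : Fin n} {w : Equiv.Perm (Fin n)}
    (h : ¬ Clear w i j) (r : S) : stepOp 0 i j (flag w r) = 0 := by
  rw [stepOp_flag, stepWeight, if_neg h]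
  simp [flag_zero]

theorem stepOp_zero_flag_of_clear {i j : Fin n} {w : Equiv.Perm (Fin n)}
    (h : Clear w i j) (h' : w i < w j) (r : S) :
    stepOp 0 i j (flag w r) = flag (w * Equiv.swap i j) r := by
  rw [stepOp_flag, stepWeight, if_pos h, stepFactor, if_neg h'.not_gt, mul_one]

/-- The shape of the permutations that occur while `x_1^{n-1} x_2^{n-2} ⋯` is built up. -/
structure Stage (m t : ℕ) (w : Equiv.Perm (Fin n)) : Prop where
  head : ∀ a : Fin n, a.val < m → (w a).val = n - 1 - a.val
  at_m : ∀ a : Fin n, a.val = m → (w a).val = t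
  tail : ∀ a b : Fin n, m < a.val → a < b → w a < w b

/-- At q = 0 only one summand of the Dunkl operator survives, the exchange with the position of the
value t + 1. Positions before m hold larger values, and smaller values after m would also give steps
down. Values above t + 1 are blocked, because t + 1 stands to their left in the increasing tail. -/
theorem Stage.next {m : Fin n} {t : ℕ} {w : Equiv.Perm (Fin n)} (h : Stage m.val t w)
    (ht : t + 1 < n - m.val) : ∃ w', dunklOp 0 m (flag w (1 : S)) = flag w' 1 ∧
      Stage m.val (t + 1) w' := by
  have hw : w (w.symm ⟨t + 1, by omega⟩) = ⟨t + 1, by omega⟩ := w.apply_symm_apply _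
  generalize w.symm ⟨t + 1, by omega⟩ = l at hw
  have hwm := h.at_m m rfl
  have hwl : (w l).val = t + 1 := by rw [hw]
  have hml : m < l := by
    by_contra hle
    rcases lt_or_eq_of_le (not_lt.1 hle) with h1 | h1
    · have h2 := h.head l h1
      have h3 : l.val < m.val := h1
      omega
    · rw [h1] at hwl; omega
  refine ⟨w * Equiv.swap m l, ?_, ?_, ?_, ?_⟩
  · rw [dunklOp_eq, LinearMap.sum_apply, Finset.sum_eq_single l]
    · rw [altOp_of_lt _ hml]
      apply stepOp_zero_flag_of_clear
      · intro c _ _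
        unfold InArc
        omega
      · rw [Fin.lt_def]; omega
    · intro b _ hb
      rcases lt_trichotomy b m with h1 | h1 | h1
      · rw [altOp_neg, altOp_of_lt _ h1, LinearMap.neg_apply, stepOp_zero_flag_of_gt h1, neg_zero]
        have h2 := h.head b h1
        have h3 : b.val < m.val := h1
        rw [Fin.lt_def]
        omega
      · rw [h1, altOp_self, LinearMap.zero_apply]
      · rw [altOp_of_lt _ h1]
        by_cases h2 : w b < w m
        · exact stepOp_zero_flag_of_gt h1 h2 _
        · apply stepOp_zero_flag_of_not_clear
          have h3 := val_ne w h1.ne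
          have h4 := val_ne w hb
          rw [Fin.lt_def] at h2
          have h5 : l < b := by
            by_contra hle
            have := h.tail b l h1 (lt_of_le_of_ne (not_lt.1 hle) hb)
            rw [Fin.lt_def] at this
            omega
          intro hC
          refine hC l hml h5 ?_
          unfold InArc
          omega
    · simp
  · intro a ha
    have h1 : a ≠ m := fun h => by rw [h] at ha; omega
    have h2 : a ≠ l := fun h => by
      rw [h] at ha
      exact absurd (Fin.lt_def.1 hml) (by omega)
    rw [Equiv.Perm.mul_apply, Equiv.swap_apply_of_ne_of_ne h1 h2, h.head a ha]
  · intro a ha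
    rw [Fin.ext ha, Equiv.Perm.mul_apply, Equiv.swap_apply_left, hwl]
  · have key : ∀ c : Fin n, m.val < c.val → c ≠ l →
        (w * Equiv.swap m l) c = w c ∧ (w c).val ≠ t ∧ (w c).val ≠ t + 1 := by
      intro c hc hcl
      have h1 : c ≠ m := fun h => by rw [h] at hc; omega
      rw [Equiv.Perm.mul_apply, Equiv.swap_apply_of_ne_of_ne h1 hcl]
      have h2 := val_ne w h1
      have h3 := val_ne w hcl
      omega
    have keyl : ((w * Equiv.swap m l) l).val = t := by
      rw [Equiv.Perm.mul_apply, Equiv.swap_apply_right, hwm]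
    intro a b ha hab
    have hab' : a.val < b.val := hab
    have h1 := h.tail a b ha hab
    rw [Fin.lt_def] at h1 ⊢
    by_cases h2 : a = l
    · subst h2
      obtain ⟨e1, e2, e3⟩ := key b (by omega) hab.ne'
      rw [keyl, e1]
      omega
    · obtain ⟨e1, e2, e3⟩ := key a ha h2
      rw [e1]
      by_cases h3 : b = l
      · subst h3
        rw [keyl]
        omega
      · obtain ⟨e4, e5, e6⟩ := key b (by omega) h3
        rw [e4]
        exact h1

theorem Stage.iterate {m : Fin n} {w : Equiv.Perm (Fin n)} (h : Stage m.val 0 w) {t : ℕ}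
    (ht : t < n - m.val) : ∃ w', (dunklOp 0 m ^ t) (flag w (1 : S)) = flag w' 1 ∧
      Stage m.val t w' := by
  induction t with
  | zero => exact ⟨w, rfl, h⟩
  | succ t ih =>
    obtain ⟨w', h1, h2⟩ := ih (by omega)
    obtain ⟨w'', h3, h4⟩ := h2.next (S := S) ht
    exact ⟨w'', by rw [pow_succ', Module.End.mul_apply, h1, h3], h4⟩

/-- The power n - 1 - m of the Dunkl operator lifts the value at position m from 0 to n - 1 - m, one
unit at a time. The value 0 is then the first entry of the increasing tail, where the next position
starts. -/
theorem polyOp_staircase_prefix (m : ℕ) (hm : m < n) : ∃ w : Equiv.Perm (Fin n),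
    polyOp 0 (∏ a ∈ Finset.univ.filter (fun a : Fin n => a.val < m),
      MvPolynomial.X a ^ (n - 1 - a.val)) (flag 1 (1 : S)) = flag w 1 ∧ Stage m 0 w := by
  induction m with
  | zero =>
    refine ⟨1, by simp, ?_, ?_, ?_⟩
    · intro a ha; omega
    · intro a ha; simpa using ha
    · intro a b _ h; exact h
  | succ m ih =>
    obtain ⟨w, h1, h2⟩ := ih (by omega)
    obtain ⟨w', h3, h4⟩ := Stage.iterate (S := S) (m := ⟨m, by omega⟩) h2 (t := n - 1 - m)
      (by simp only; omega)
    refine ⟨w', ?_, ?_, ?_, ?_⟩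
    · have h5 : (Finset.univ.filter fun a : Fin n => a.val < m + 1) =
          insert ⟨m, by omega⟩ (Finset.univ.filter fun a : Fin n => a.val < m) := by
        ext a
        simp only [Finset.mem_filter, Finset.mem_univ, true_and, Finset.mem_insert, Fin.ext_iff]
        omega
      rw [h5, Finset.prod_insert (by simp), map_mul, Module.End.mul_apply, h1, map_pow, polyOp_X, h3]
    · intro a ha
      rcases Nat.lt_succ_iff_lt_or_eq.1 ha with h | h
      · exact h4.head a h
      · rw [h4.at_m a h, h]
    · intro a ha
      have hw : w' (w'.symm ⟨0, by omega⟩) = ⟨0, by omega⟩ := w'.apply_symm_apply _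
      generalize w'.symm ⟨0, by omega⟩ = c at hw
      rcases lt_trichotomy c a with h | h | h
      · have h6 : c.val < a.val := h
        have h7 : (w' c).val = 0 := by rw [hw]
        rcases Nat.lt_succ_iff_lt_or_eq.1 (by omega : c.val < m + 1) with h5 | h5
        · have := h4.head c h5
          omega
        · have := h4.at_m c h5
          omega
      · rw [← h, hw]
      · have := h4.tail a c (by simp only; omega) h
        rw [hw, Fin.lt_def] at this
        simp at this
    · intro a b ha hab
      exact h4.tail a b (by simp only; omega) hab

theorem polyOp_staircase {w : Equiv.Perm (Fin n)} (hw : ¬ ∃ i, IsAscent w i) :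
    polyOp 0 (∏ a : Fin n, MvPolynomial.X a ^ (n - 1 - a.val)) (flag 1 (1 : S)) = flag w 1 := by
  rcases Nat.eq_zero_or_pos n with rfl | hn
  · have : w = 1 := Subsingleton.elim _ _
    simp [this]
  obtain ⟨w', h1, h2⟩ := polyOp_staircase_prefix (n := n) (S := S) (n - 1) (by omega)
  have hlast : ∀ a : Fin n, ¬ a.val < n - 1 → n - 1 - a.val = 0 := fun a h => by omega
  have h3 : ∏ a : Fin n, (MvPolynomial.X a ^ (n - 1 - a.val) : MvPolynomial (Fin n) S) =
      ∏ a ∈ Finset.univ.filter (fun a : Fin n => a.val < n - 1),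
        MvPolynomial.X a ^ (n - 1 - a.val) := by
    rw [Finset.prod_filter]
    refine Finset.prod_congr rfl fun a _ => ?_
    split_ifs with h
    · rfl
    · rw [hlast a h, pow_zero]
  rw [h3, h1]
  congr 1
  ext c
  have hlt : ∀ a : Fin n, n - 1 - (w a).val < n := fun a => by omega
  -- A permutation without ascents is strictly decreasing, so its reversal in values is increasing.
  have h4 := eq_val_of_step (f := fun c => n - 1 - (w c).val) hlt (by
    intro a b hab
    have hb := b.isLt
    have h5 : ¬ IsAscent w a.val := fun h => hw ⟨_, h⟩
    unfold IsAscent at h5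
    push Not at h5
    have h6 := h5 (by omega : a.val + 1 < n)
    have h7 : (⟨a.val + 1, by omega⟩ : Fin n) = b := Fin.ext hab
    rw [h7, Fin.le_def] at h6
    have h8 := val_ne w (i := a) (j := b) (fun h => by rw [h] at hab; omega)
    have h9 := (w a).isLt
    have h10 : (w b).val ≤ (w a).val := h6
    change n - 1 - (w a).val < n - 1 - (w b).val
    omega) c
  have h5 := (w c).isLt
  rcases lt_or_ge c.val (n - 1) with h | h
  · rw [h2.head c h]; omega
  · rw [h2.at_m c (by omega)]; omega

theorem demazure_flag_one {i j : Fin n} (hij : i.val + 1 = j.val) (r : S) :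
    demazure S i j (flag 1 r) = 0 := by
  rw [demazure_flag hij, if_neg]
  simp only [Equiv.Perm.coe_one, id_eq, Fin.lt_def]
  omega

/-- The recursion of Schubert polynomials is followed downwards from the staircase. The identity is
killed by `demazure`, so a divided difference of the polynomial becomes `demazure` of the vector,
and this turns w s_i into w. -/
theorem polyOp_schubert [IsDomain S] (w : Equiv.Perm (Fin n)) :
    polyOp 0 (schubert S w) (flag 1 1) = flag w 1 := by
  induction w using schubert.induct with
  | case1 w h hi ih =>
    rw [schubert, dif_pos h]
    simp only at ih ⊢
    rw [← demazure_polyOp rfl _ (demazure_flag_one rfl 1), ih, demazure_flag rfl, if_pos,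
      mul_assoc, Equiv.swap_mul_self, mul_one]
    simpa using hi.2
  | case2 w h =>
    rw [schubert, dif_neg h]
    exact polyOp_staircase h

end SchubertAction

/-! ### Quantum Schubert polynomials at the quantum Dunkl operators -/

section QuantumAction

variable {n : ℕ} {S : Type} [CommRing S] (q : Fin (n - 1) → S)

/-- Distinct permutations with a descent at this place have distinct images, so no cancellation can
occur in the kernel of `demazure`. -/
theorem coord_eq_zero_of_demazure {i j : Fin n} (hij : i.val + 1 = j.val) {v : FlagModule n S}
    (hv : demazure S i j v = 0) {w : Equiv.Perm (Fin n)} (hw : w j < w i) : coord w v = 0 := by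
  classical
  have h1 := congrArg (coord (w * Equiv.swap i j)) hv
  rw [map_zero, eq_sum_flag v, map_sum, map_sum, Finset.sum_eq_single w] at h1
  · rwa [demazure_flag hij, if_pos hw, coord_flag, if_pos rfl] at h1
  · intro w' _ hne
    rw [demazure_flag hij]
    split_ifs
    · rw [coord_flag, if_neg fun h => hne (mul_right_cancel h)]
    · rw [map_zero]
  · simp

theorem linear_congr_of_support {f g : Module.End S (FlagModule n S)} {v : FlagModule n S}
    (h : ∀ w, coord w v = 0 ∨ f (flag w (coord w v)) = g (flag w (coord w v))) : f v = g v := by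
  rw [eq_sum_flag v, map_sum, map_sum]
  refine Finset.sum_congr rfl fun w _ => ?_
  rcases h w with h1 | h1
  · rw [h1, flag_zero, map_zero, map_zero]
  · exact h1

/-- The quantum part of `t_{ab}` vanishes on vectors without descents right after `a`. -/
theorem stepOp_eq_of_demazure_left {a b c : Fin n} (hac : a.val + 1 = c.val) (hcb : c ≤ b)
    {v : FlagModule n S} (hv : demazure S a c v = 0) : stepOp q a b v = stepOp 0 a b v := by
  have hlt : a < c := Fin.lt_def.2 (by omega)
  refine linear_congr_of_support fun w => ?_
  by_cases hw : w c < w a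
  · exact Or.inl (coord_eq_zero_of_demazure hac hv hw)
  · right
    rw [stepOp_flag, stepOp_flag, stepWeight, stepWeight]
    split_ifs with hC
    -- A clear step down would force the value right after position a below the value at a, and the
    -- support of v has no such descent.
    · rw [stepFactor, stepFactor, if_neg, if_neg]
      all_goals
        intro hba
        rcases eq_or_lt_of_le hcb with rfl | h
        · exact hw hba
        · have h1 := hC c hlt h
          have h2 := val_ne w hlt.ne
          have h3 := val_ne w h.ne
          unfold InArc at h1
          rw [Fin.lt_def] at hw hba
          omega
    · rfl

theorem stepOp_succ {i j : Fin n} (hij : i.val + 1 = j.val) :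
    stepOp q i j = stepOp 0 i j + qParam q i j • demazure S i j := by
  have hlt : i < j := Fin.lt_def.2 (by omega)
  refine flagEnd_ext fun w r => ?_
  rw [LinearMap.add_apply, LinearMap.smul_apply, demazure_flag hij, stepOp_flag, stepOp_flag,
    stepWeight, stepWeight, if_pos (clear_of_succ w hij), if_pos (clear_of_succ w hij), stepFactor,
    stepFactor, qWeight_succ q hij, qWeight_zero hlt]
  split_ifs
  · rw [smul_flag, ← flag_add]; congr 1; ring
  · rw [smul_zero, add_zero]

/-- The vector has no descents at the positions up to `m`. -/
def NoDescents (m : ℕ) (v : FlagModule n S) : Prop :=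
  ∀ i j : Fin n, i.val + 1 = j.val → j.val ≤ m → demazure S i j v = 0

theorem NoDescents.mono {m m' : ℕ} (h : m' ≤ m) {v : FlagModule n S} (hv : NoDescents m v) :
    NoDescents m' v := fun i j hij hj => hv i j hij (hj.trans h)

theorem dunklOp_zero_fin {m : Fin n} (hm : m.val = 0) {v : FlagModule n S}
    (hv : ∀ l, m.val + 1 = l.val → demazure S m l v = 0) : dunklOp q m v = dunklOp 0 m v := by
  rw [dunklOp_eq, dunklOp_eq, LinearMap.sum_apply, LinearMap.sum_apply]
  refine Finset.sum_congr rfl fun l _ => ?_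
  rcases lt_trichotomy l m with h | rfl | h
  · rw [Fin.lt_def] at h; omega
  · rw [altOp_self, altOp_self]
  · have h' : m.val < l.val := h
    have hl := l.isLt
    rw [altOp_of_lt _ h, altOp_of_lt _ h, stepOp_eq_of_demazure_left q
      (c := ⟨m.val + 1, by omega⟩) rfl (Fin.le_def.2 h') (hv _ rfl)]

/-- The quantum part of a summand needs a descent right after its smaller index. Only the pair of m
with its predecessor k can have one, and antisymmetry gives the minus sign. -/
theorem dunklOp_succ {k m : Fin n} (hkm : k.val + 1 = m.val) {v : FlagModule n S}
    (hv : ∀ i j : Fin n, i.val + 1 = j.val → j.val < m.val → demazure S i j v = 0)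
    (hv' : ∀ l, m.val + 1 = l.val → demazure S m l v = 0) :
    dunklOp q m v = dunklOp 0 m v - qParam q k m • demazure S k m v := by
  rw [dunklOp_eq, dunklOp_eq, LinearMap.sum_apply, LinearMap.sum_apply,
    ← Finset.add_sum_erase _ _ (Finset.mem_univ k),
    ← Finset.add_sum_erase _ (fun l => altOp 0 m l v) (Finset.mem_univ k)]
  have hlt : k < m := Fin.lt_def.2 (by omega)
  have h1 : ∀ l ∈ Finset.univ.erase k, altOp q m l v = altOp 0 m l v := by
    intro l hl
    have hlk : l.val ≠ k.val := fun h => (Finset.mem_erase.1 hl).1 (Fin.ext h)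
    rcases lt_trichotomy l m with h | rfl | h
    · have h' : l.val < m.val := h
      have hm := m.isLt
      rw [altOp_neg, altOp_neg 0, altOp_of_lt _ h, altOp_of_lt _ h, LinearMap.neg_apply,
        LinearMap.neg_apply, stepOp_eq_of_demazure_left q
          (c := ⟨l.val + 1, by omega⟩) rfl (Fin.le_def.2 h') (hv _ _ rfl (by simp only; omega))]
    · rw [altOp_self, altOp_self]
    · have h' : m.val < l.val := h
      have hl := l.isLt
      rw [altOp_of_lt _ h, altOp_of_lt _ h, stepOp_eq_of_demazure_left q
        (c := ⟨m.val + 1, by omega⟩) rfl (Fin.le_def.2 h') (hv' _ rfl)]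
  rw [Finset.sum_congr rfl h1, altOp_neg, altOp_neg 0, altOp_of_lt _ hlt, altOp_of_lt _ hlt,
    stepOp_succ q hkm]
  simp only [LinearMap.neg_apply, LinearMap.add_apply, LinearMap.smul_apply]
  abel

/-- At q = 0 every step goes up in length, so no step ends at the identity and only the constant
term contributes. -/
theorem coord_one_polyOp (f : MvPolynomial (Fin n) S) (v : FlagModule n S) :
    coord 1 (polyOp 0 f v) = MvPolynomial.constantCoeff f * coord 1 v := by
  classical
  have hstep : ∀ a b : Fin n, a < b → ∀ v : FlagModule n S, coord 1 (stepOp 0 a b v) = 0 := by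
    intro a b hab v
    rw [eq_sum_flag v, map_sum, map_sum]
    refine Finset.sum_eq_zero fun w _ => ?_
    rw [stepOp_flag, coord_flag]
    split_ifs with h
    · have h2 : w = Equiv.swap a b := by
        rw [← mul_one (Equiv.swap a b), ← Equiv.swap_mul_self a b, ← mul_assoc, ← one_mul w]
        have := congrArg (· * Equiv.swap a b) h
        simpa [mul_assoc] using this
      rw [stepWeight, stepFactor, h2, if_pos (c := (Equiv.swap a b) b < _) (by simpa using hab),
        qWeight_zero hab]
      simp
    · rfl
  have hd : ∀ (a : Fin n) (v : FlagModule n S), coord 1 (dunklOp 0 a v) = 0 := by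
    intro a v
    rw [dunklOp_eq, LinearMap.sum_apply, map_sum]
    refine Finset.sum_eq_zero fun b _ => ?_
    rcases lt_trichotomy a b with h | rfl | h
    · rw [altOp_of_lt _ h, hstep a b h]
    · rw [altOp_self, LinearMap.zero_apply, map_zero]
    · rw [altOp_neg, altOp_of_lt _ h, LinearMap.neg_apply, map_neg, hstep b a h, neg_zero]
  induction f using MvPolynomial.induction_on generalizing v with
  | C r =>
    rw [← MvPolynomial.algebraMap_eq, AlgHom.commutes]
    simp [Module.algebraMap_end_apply]
  | add p p' hp hp' => rw [map_add, LinearMap.add_apply, map_add, hp, hp', map_add, add_mul]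
  | mul_X p a hp => rw [map_mul, Module.End.mul_apply, hp, polyOp_X, hd]; simp

variable [IsDomain S]

theorem noDescents_polyOp {m : ℕ} {v : FlagModule n S} (hv : NoDescents m v)
    {f : MvPolynomial (Fin n) S} (hf : ∀ i j : Fin n, i.val + 1 = j.val → j.val ≤ m →
      MvPolynomial.rename (Equiv.swap i j) f = f) : NoDescents m (polyOp 0 f v) := by
  intro i j hij hj
  rw [demazure_polyOp hij f (hv i j hij hj),
    dividedDiff_of_symm (fun h => by rw [h] at hij; omega) (hf i j hij hj), map_zero,
    LinearMap.zero_apply]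

variable {R : Type} [CommRing R] [IsDomain R]

theorem polyOp_C (q : Fin (n - 1) → S) (r : S) (v : FlagModule n S) :
    polyOp q (MvPolynomial.C r) v = r • v := by
  rw [← MvPolynomial.algebraMap_eq, AlgHom.commutes, Module.algebraMap_end_apply]

/-- In the recursion the quantum Dunkl operator differs from the classical one by a multiple of q
times `demazure`, applied to e_{r+1}^{m+1}(θ)v. This yields -q e_r^m(θ)v and cancels the q-term of
the quantum recursion. The hypothesis includes the descent just beyond the m variables, since the
last Dunkl operator also meets that position. -/
theorem polyOp_quantumElem (m : ℕ) (hm : m ≤ n) (r : ℕ) (v : FlagModule n (QCoeff R n))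
    (hv : NoDescents m v) :
    polyOp MvPolynomial.X (quantumElem R n m r) v = polyOp 0 (elemSym (QCoeff R n) n m r) v := by
  induction m using Nat.strong_induction_on generalizing r v with
  | _ m ih =>
  rcases r with _ | r
  · rw [elemSym_zero, quantumElem]; simp
  rcases m with _ | m
  · rw [elemSym_of_lt (by omega), quantumElem]; simp
  rcases r with _ | r
  · rw [elemSym_succ hm, quantumElem, xVar, dif_pos (by omega), elemSym_zero]
    simp only [map_add, mul_one, LinearMap.add_apply, polyOp_X]
    rw [ih m (by omega) (by omega) 1 v (hv.mono (by omega))]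
    congr 1
    rcases m with _ | m
    · exact dunklOp_zero_fin _ rfl fun l hl => hv _ l hl (by simp only at hl; omega)
    · rw [dunklOp_succ _ (k := ⟨m, by omega⟩) rfl
        (fun i j hij hj => hv i j hij (by simp only at hj; omega))
        (fun l hl => hv _ l hl (by simp only at hl; omega)),
        hv ⟨m, by omega⟩ _ rfl (by simp only; omega), smul_zero, sub_zero]
  rcases m with _ | m
  · rw [elemSym_of_lt (by omega), quantumElem]; simp
  · have hmn : m + 1 < n := by omega
    -- Symmetry in the first m + 1 variables leaves only one possible descent, between the
    -- zero-based positions m and m + 1.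
    have hu : ∀ i j : Fin n, i.val + 1 = j.val → j.val ≤ m + 2 →
        demazure (QCoeff R n) i j (polyOp 0 (elemSym (QCoeff R n) n (m + 1) (r + 1)) v) =
          if j.val = m + 1 then polyOp 0 (elemSym (QCoeff R n) n m r) v else 0 := by
      intro i j hij hj
      rw [demazure_polyOp hij _ (hv i j hij hj)]
      split_ifs with h
      · rw [← h, dividedDiff_elemSym hij, show i.val = m by omega]
      · rw [dividedDiff_elemSym_of_ne hij (fun h' => h h'.symm), map_zero, LinearMap.zero_apply]
    rw [elemSym_succ hmn, quantumElem, xVar, dif_pos hmn, qVar, dif_pos (by omega)]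
    simp only [map_add, map_mul, LinearMap.add_apply, Module.End.mul_apply, polyOp_X, polyOp_C]
    rw [ih (m + 1) (by omega) (by omega) (r + 2) v (hv.mono (by omega)),
      ih (m + 1) (by omega) (by omega) (r + 1) v (hv.mono (by omega)),
      ih m (by omega) (by omega) r v (hv.mono (by omega)),
      dunklOp_succ _ (k := ⟨m, by omega⟩) rfl
        (fun i j hij hj => by
          rw [hu i j hij (by simp only at hj; omega), if_neg (by simp only at hj; omega)])
        (fun l hl => by
          rw [hu _ l hl (by simp only at hl; omega), if_neg (by simp only at hl; omega)]),
      hu ⟨m, by omega⟩ _ rfl (by simp only; omega), if_pos rfl, qParam, dif_pos rfl]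
    abel

theorem noDescents_one (m : ℕ) (r : S) : NoDescents m (flag (1 : Equiv.Perm (Fin n)) r) :=
  fun _ _ hij _ => demazure_flag_one hij r

/-- Complete symmetry leaves no descents, so the vector is a multiple of the identity, and its
coefficient is the constant term of the polynomial, which is zero. -/
theorem polyOp_quantumElem_top (r : ℕ) :
    polyOp MvPolynomial.X (quantumElem R n n (r + 1)) (flag 1 1) = 0 := by
  rw [polyOp_quantumElem n le_rfl _ _ (noDescents_one n 1)]
  have h1 : NoDescents n (polyOp 0 (elemSym (QCoeff R n) n n (r + 1)) (flag 1 1)) :=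
    noDescents_polyOp (noDescents_one n 1) fun i j _ _ =>
      rename_swap_elemSym _ _ (by simp)
  refine flagModule_ext fun w => ?_
  rw [map_zero]
  by_cases hw : ∃ i j : Fin n, i.val + 1 = j.val ∧ w j < w i
  · obtain ⟨i, j, hij, hw⟩ := hw
    exact coord_eq_zero_of_demazure hij (h1 i j hij j.isLt.le) hw
  · push Not at hw
    have h2 : w = 1 := by
      ext c
      exact eq_val_of_step (f := fun c => (w c).val) (fun a => (w a).isLt) (fun a b hab =>
        lt_of_le_of_ne (hw a b hab) (val_ne w (fun h => by rw [h] at hab; omega))) c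
    rw [h2, coord_one_polyOp, constantCoeff_elemSym, zero_mul]

/-- The factors act in decreasing order of the number of variables. The factors already applied are
symmetric in one variable more than the next factor has, so the vector has no descents where
`polyOp_quantumElem` forbids them. -/
theorem polyOp_quantumElemProd (I : ElemIndex n) :
    polyOp MvPolynomial.X (quantumElemProd R I) (flag 1 1) =
      polyOp 0 (elemProd (QCoeff R n) I) (flag 1 1) := by
  have key : ∀ t ≤ n - 1,
      polyOp MvPolynomial.X (∏ m ∈ Finset.univ.filter (fun m : Fin (n - 1) => n - 1 - t ≤ m.val),
        quantumElem R n (m.val + 1) (I m).val) (flag 1 1) =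
      polyOp 0 (∏ m ∈ Finset.univ.filter (fun m : Fin (n - 1) => n - 1 - t ≤ m.val),
        elemSym (QCoeff R n) n (m.val + 1) (I m).val) (flag 1 1) := by
    intro t
    induction t with
    | zero =>
      intro _
      have : (Finset.univ.filter fun m : Fin (n - 1) => n - 1 - 0 ≤ m.val) = ∅ := by
        ext m
        have := m.isLt
        simp only [Finset.mem_filter, Finset.mem_univ, true_and, Finset.notMem_empty, iff_false]
        omega
      rw [this]
      simp
    | succ t ih =>
      intro ht
      have h1 : (Finset.univ.filter fun m : Fin (n - 1) => n - 1 - (t + 1) ≤ m.val) =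
          insert ⟨n - 1 - (t + 1), by omega⟩
            (Finset.univ.filter fun m : Fin (n - 1) => n - 1 - t ≤ m.val) := by
        ext a
        simp only [Finset.mem_filter, Finset.mem_univ, true_and, Finset.mem_insert, Fin.ext_iff]
        omega
      have h2 : (⟨n - 1 - (t + 1), by omega⟩ : Fin (n - 1)) ∉
          (Finset.univ.filter fun m : Fin (n - 1) => n - 1 - t ≤ m.val) := by
        simp only [Finset.mem_filter, Finset.mem_univ, true_and]
        omega
      rw [h1, Finset.prod_insert h2, Finset.prod_insert h2, map_mul, map_mul, Module.End.mul_apply,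
        Module.End.mul_apply, ih (by omega), polyOp_quantumElem _ (by simp only; omega)]
      refine noDescents_polyOp (noDescents_one _ 1) fun i j hij hj => ?_
      rw [map_prod]
      refine Finset.prod_congr rfl fun m hm => ?_
      simp only [Finset.mem_filter, Finset.mem_univ, true_and] at hm
      simp only at hj
      exact rename_swap_elemSym _ _ (by omega)
  have h := key (n - 1) le_rfl
  simpa [quantumElemProd, elemProd] using h

theorem polyOp_quantumSchubert (w : Equiv.Perm (Fin n))
    (h : ∃ α : ElemIndex n → R, schubert R w = ∑ I, α I • elemProd R I) :
    polyOp MvPolynomial.X (quantumSchubert R w) (flag 1 1) = flag w 1 := by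
  rw [quantumSchubert, dif_pos h, map_sum, LinearMap.sum_apply]
  have h1 : ∀ I, polyOp MvPolynomial.X (MvPolynomial.C (MvPolynomial.C (h.choose I)) *
      quantumElemProd R I) (flag (1 : Equiv.Perm (Fin n)) 1) =
      polyOp 0 (MvPolynomial.map MvPolynomial.C (h.choose I • elemProd R I)) (flag 1 1) := by
    intro I
    rw [map_mul, Module.End.mul_apply, polyOp_quantumElemProd, MvPolynomial.smul_eq_C_mul, map_mul,
      map_mul, Module.End.mul_apply, map_elemProd, MvPolynomial.map_C, polyOp_C, polyOp_C]
  rw [Finset.sum_congr rfl fun I _ => h1 I, ← LinearMap.sum_apply, ← map_sum, ← map_sum,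
    ← h.choose_spec, map_schubert, polyOp_schubert]

end QuantumAction

/-! ### Expansion in products of elementary symmetric polynomials -/

section Expansions

variable {R : Type} [CommRing R] {n : ℕ}

variable (R n) in
/-- The span of the elementary symmetric polynomials of the first `m` variables. -/
def elemSpan (m : ℕ) : Submodule R (MvPolynomial (Fin n) R) :=
  Submodule.span R (Set.range (elemSym R n m))

theorem elemSym_mem_elemSpan (m i : ℕ) : elemSym R n m i ∈ elemSpan R n m :=
  Submodule.subset_span ⟨i, rfl⟩

theorem one_mem_elemSpan (m : ℕ) : (1 : MvPolynomial (Fin n) R) ∈ elemSpan R n m := by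
  rw [← elemSym_zero (R := R) (n := n) m]
  exact elemSym_mem_elemSpan m 0

/-- When the second factors are enlarged by one variable, the product e_a e_b times that variable
occurs twice and cancels. This trades (a, b + 1) for (a + 1, b), and induction on b finishes. -/
theorem elemSym_mul_mem {m : ℕ} (hm : m < n) (a b : ℕ) :
    elemSym R n m a * elemSym R n m b ∈ elemSpan R n m * elemSpan R n (m + 1) := by
  induction b generalizing a with
  | zero =>
    rw [elemSym_zero]
    exact Submodule.mul_mem_mul (elemSym_mem_elemSpan m a) (one_mem_elemSpan _)
  | succ b ih =>
    have h1 : elemSym R n m a * elemSym R n m (b + 1) =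
        elemSym R n m (a + 1) * elemSym R n m b +
          (elemSym R n m a * elemSym R n (m + 1) (b + 1) -
            elemSym R n m b * elemSym R n (m + 1) (a + 1)) := by
      rw [elemSym_succ hm, elemSym_succ hm]
      ring
    rw [h1]
    exact add_mem (ih _) (sub_mem
      (Submodule.mul_mem_mul (elemSym_mem_elemSpan _ _) (elemSym_mem_elemSpan _ _))
      (Submodule.mul_mem_mul (elemSym_mem_elemSpan _ _) (elemSym_mem_elemSpan _ _)))

open scoped Pointwise in
theorem elemSpan_mul_self_le {m : ℕ} (hm : m < n) :
    elemSpan R n m * elemSpan R n m ≤ elemSpan R n m * elemSpan R n (m + 1) := by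
  have h : elemSpan R n m * elemSpan R n m = Submodule.span R
      (Set.range (elemSym R n m) * Set.range (elemSym R n m)) := Submodule.span_mul_span _ _ _
  rw [h, Submodule.span_le]
  rintro _ ⟨_, ⟨a, rfl⟩, _, ⟨b, rfl⟩, rfl⟩
  exact elemSym_mul_mem hm a b

variable (R n) in
/-- The span of the products of elementary symmetric polynomials. -/
def elemProdSpan : Submodule R (MvPolynomial (Fin n) R) :=
  Submodule.span R (Set.range (elemProd R (n := n)))

theorem elemProdSpan_eq : elemProdSpan R n = ∏ m : Fin (n - 1), elemSpan R n (m.val + 1) := by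
  unfold elemSpan
  rw [Submodule.prod_span]
  apply le_antisymm
  · rw [elemProdSpan, Submodule.span_le]
    rintro _ ⟨I, rfl⟩
    refine Submodule.subset_span ((Set.mem_fintype_prod _ _).2 ⟨_, fun m => ⟨(I m).val, rfl⟩, rfl⟩)
  · rw [Submodule.span_le]
    intro f hf
    obtain ⟨g, hg, rfl⟩ := (Set.mem_fintype_prod _ _).1 hf
    choose i hi using hg
    by_cases h : ∃ m : Fin (n - 1), m.val + 1 < i m
    · obtain ⟨m, hm⟩ := h
      rw [Finset.prod_eq_zero (Finset.mem_univ m)]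
      · exact zero_mem _
      · rw [← hi, elemSym_of_lt hm]
    · push Not at h
      refine Submodule.subset_span ⟨fun m => ⟨i m, by have := h m; omega⟩, ?_⟩
      exact Finset.prod_congr rfl fun m _ => hi m

theorem prod_mem_prod_submodule {ι A : Type} [CommRing A] [Algebra R A] {s : Finset ι}
    {E : ι → Submodule R A} {a : ι → A} (h : ∀ i ∈ s, a i ∈ E i) : ∏ i ∈ s, a i ∈ ∏ i ∈ s, E i := by
  classical
  induction s using Finset.induction_on with
  | empty => simpa using ⟨1, map_one _⟩
  | insert i s hi ih =>
    rw [Finset.prod_insert hi, Finset.prod_insert hi]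
    exact Submodule.mul_mem_mul (h i (Finset.mem_insert_self _ _))
      (ih fun j hj => h j (Finset.mem_insert_of_mem hj))

theorem prod_elemSym_mem (g : Fin (n - 1) → ℕ) :
    ∏ m : Fin (n - 1), elemSym R n (m.val + 1) (g m) ∈ elemProdSpan R n := by
  rw [elemProdSpan_eq]
  exact prod_mem_prod_submodule fun m _ => elemSym_mem_elemSpan _ _

theorem elemProdSpan_induction {P : MvPolynomial (Fin n) R → Prop}
    (h1 : ∀ g : Fin (n - 1) → ℕ, P (∏ m : Fin (n - 1), elemSym R n (m.val + 1) (g m)))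
    (h2 : ∀ f g, P f → P g → P (f + g)) (h3 : ∀ (r : R) f, P f → P (MvPolynomial.C r * f))
    {f : MvPolynomial (Fin n) R} (hf : f ∈ elemProdSpan R n) : P f := by
  induction hf using Submodule.span_induction with
  | mem f hf => obtain ⟨I, rfl⟩ := hf; exact h1 fun m => (I m).val
  | zero => simpa using h3 0 _ (h1 0)
  | add f g _ _ hf hg => exact h2 f g hf hg
  | smul r f _ hf => rw [MvPolynomial.smul_eq_C_mul]; exact h3 r f hf

/-- Only the factor in the variables up to x_i is not symmetric under the exchange, and its divided
difference has one variable fewer. Two factors then have the same number of variables, and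
`elemSpan_mul_self_le` trades one of them for the missing size. -/
theorem dividedDiff_mem_elemProdSpan [IsDomain R] {i j : Fin n} (hij : i.val + 1 = j.val)
    {f : MvPolynomial (Fin n) R} (hf : f ∈ elemProdSpan R n) :
    dividedDiff i j f ∈ elemProdSpan R n := by
  have hne : i ≠ j := fun h => by rw [h] at hij; omega
  have hjn := j.isLt
  refine elemProdSpan_induction (P := fun f => dividedDiff i j f ∈ elemProdSpan R n) ?_ ?_ ?_ hf
  · intro g
    let μ : Fin (n - 1) := ⟨i.val, by omega⟩
    have hμ : μ.val + 1 = j.val := hij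
    rw [← Finset.mul_prod_erase _ _ (Finset.mem_univ μ), mul_comm, dividedDiff_mul hne, map_prod]
    have hsym : ∀ m ∈ Finset.univ.erase μ, MvPolynomial.rename (Equiv.swap i j)
        (elemSym R n (m.val + 1) (g m)) = elemSym R n (m.val + 1) (g m) := by
      intro m hm
      refine rename_swap_elemSym _ _ ?_
      have : m.val ≠ i.val := fun h => (Finset.mem_erase.1 hm).1 (Fin.ext h)
      omega
    rw [Finset.prod_congr rfl hsym, dividedDiff_of_symm (f := ∏ m ∈ _, _) hne (by
      rw [map_prod, Finset.prod_congr rfl hsym]), zero_mul, zero_add]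
    have hrest : (∏ m ∈ Finset.univ.erase μ, elemSym R n (m.val + 1) (g m)) ∈
        ∏ m ∈ Finset.univ.erase μ, elemSpan R n (m.val + 1) :=
      prod_mem_prod_submodule fun m _ => elemSym_mem_elemSpan _ _
    rw [elemProdSpan_eq, ← Finset.mul_prod_erase _ _ (Finset.mem_univ μ), hμ]
    rcases hg : g μ with _ | r
    · rw [elemSym_zero, dividedDiff_of_symm hne (by simp), mul_zero]
      exact zero_mem _
    · rw [dividedDiff_elemSym hij]
      -- For i = 0 no variables remain, so the new factor is 0 or 1 and there is nothing to
      -- straighten.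
      rcases Nat.eq_zero_or_pos i.val with h0 | h0
      · rw [mul_comm (elemSpan R n j.val)]
        refine Submodule.mul_mem_mul hrest ?_
        rw [h0]
        rcases r with _ | r
        · rw [elemSym_zero]; exact one_mem_elemSpan _
        · rw [elemSym_of_lt (by omega)]; exact zero_mem _
      · let ν : Fin (n - 1) := ⟨i.val - 1, by omega⟩
        have hν : ν.val + 1 = i.val := by simp only [ν]; omega
        have hνμ : ν ∈ Finset.univ.erase μ := by
          refine Finset.mem_erase.2 ⟨fun h => ?_, Finset.mem_univ _⟩
          have := congrArg Fin.val h
          simp only [ν, μ] at this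
          omega
        rw [← Finset.mul_prod_erase _ _ hνμ, hν] at hrest
        have h1 := Submodule.mul_mem_mul hrest (elemSym_mem_elemSpan (R := R) (n := n) i.val r)
        rw [mul_right_comm] at h1
        rw [← Finset.mul_prod_erase _ _ hνμ, hν, ← mul_assoc, mul_comm (elemSpan R n j.val), ← hij]
        exact mul_le_mul' (elemSpan_mul_self_le i.isLt) le_rfl h1
  · intro f g hf hg
    rw [dividedDiff_add hne]
    exact add_mem hf hg
  · intro r f hf
    rw [dividedDiff_mul hne, dividedDiff_C hne, zero_mul, zero_add, MvPolynomial.rename_C,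
      ← MvPolynomial.smul_eq_C_mul]
    exact Submodule.smul_mem _ _ hf

theorem elemSym_self {m : ℕ} (hm : m ≤ n) : elemSym R n m m =
    ∏ a ∈ Finset.univ.filter (fun a : Fin n => a.val < m), MvPolynomial.X a := by
  induction m with
  | zero => simp
  | succ m ih =>
    have h5 : (Finset.univ.filter fun a : Fin n => a.val < m + 1) =
        insert ⟨m, by omega⟩ (Finset.univ.filter fun a : Fin n => a.val < m) := by
      ext a
      simp only [Finset.mem_filter, Finset.mem_univ, true_and, Finset.mem_insert, Fin.ext_iff]
      omega
    rw [elemSym_succ hm, elemSym_of_lt (Nat.lt_succ_self m), zero_add, ih (by omega), h5,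
      Finset.prod_insert (by simp)]

/-- The staircase monomial is e_1^1 e_2^2 ⋯ e_{n-1}^{n-1}, as e_m^m is the product of the first m
variables. -/
theorem staircase_mem_elemProdSpan :
    ∏ a : Fin n, (MvPolynomial.X a ^ (n - 1 - a.val) : MvPolynomial (Fin n) R) ∈
      elemProdSpan R n := by
  have h : ∏ a : Fin n, (MvPolynomial.X a ^ (n - 1 - a.val) : MvPolynomial (Fin n) R) =
      ∏ m : Fin (n - 1), elemSym R n (m.val + 1) (m.val + 1) := by
    have h1 : ∀ m : Fin (n - 1), elemSym R n (m.val + 1) (m.val + 1) =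
        ∏ a : Fin n, if a.val < m.val + 1 then MvPolynomial.X a else 1 := by
      intro m
      rw [elemSym_self (by omega), Finset.prod_filter]
    rw [Finset.prod_congr rfl fun m _ => h1 m, Finset.prod_comm]
    refine Finset.prod_congr rfl fun a _ => ?_
    rw [Finset.prod_ite, Finset.prod_const, Finset.prod_const_one, mul_one]
    congr 1
    have h2 : (Finset.univ.filter fun m : Fin (n - 1) => a.val < m.val + 1).card =
        (Finset.Ico a.val (n - 1)).card := by
      rw [← Finset.card_map Fin.valEmbedding]
      congr 1
      ext x
      simp only [Finset.mem_map, Finset.mem_filter, Finset.mem_univ, true_and,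
        Fin.valEmbedding_apply, Finset.mem_Ico]
      constructor
      · rintro ⟨m, hm, rfl⟩
        exact ⟨by omega, m.isLt⟩
      · rintro ⟨h1, h2⟩
        exact ⟨⟨x, h2⟩, by simp only; omega, rfl⟩
    rw [h2, Nat.card_Ico]
  rw [h]
  exact prod_elemSym_mem _

theorem schubert_mem_elemProdSpan [IsDomain R] (w : Equiv.Perm (Fin n)) :
    schubert R w ∈ elemProdSpan R n := by
  induction w using schubert.induct with
  | case1 w h hi ih =>
    rw [schubert, dif_pos h]
    exact dividedDiff_mem_elemProdSpan rfl ih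
  | case2 w h =>
    rw [schubert, dif_neg h]
    exact staircase_mem_elemProdSpan

theorem exists_elemProd_expansion [IsDomain R] (w : Equiv.Perm (Fin n)) :
    ∃ α : ElemIndex n → R, schubert R w = ∑ I, α I • elemProd R I := by
  obtain ⟨α, h⟩ := (Submodule.mem_span_range_iff_exists_fun R).1 (schubert_mem_elemProdSpan w)
  exact ⟨α, h.symm⟩

theorem card_elemIndex (n : ℕ) : Fintype.card (Equiv.Perm (Fin n)) = Fintype.card (ElemIndex n) := by
  rw [Fintype.card_perm, Fintype.card_fin, Fintype.card_pi]
  simp only [Fintype.card_fin]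
  rw [Fin.prod_univ_eq_prod_range (fun m => m + 2) (n - 1)]
  rcases n with _ | n
  · simp
  · rw [Nat.add_sub_cancel, Nat.factorial_eq_prod_range_add_one, Finset.prod_range_succ' ]
    simp

variable (R n) in
/-- An identification of the two free modules of rank `n!`. -/
def flagEquiv : FlagModule n R ≃ₗ[R] (ElemIndex n → R) :=
  (Finsupp.linearEquivFunOnFinite R R (Equiv.Perm (Fin n))).trans
    (LinearEquiv.funCongrLeft R R (Fintype.equivOfCardEq (card_elemIndex n)).symm)

/-- Both modules are free of rank n!, and a surjective endomorphism of a finitely generated module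
over a commutative ring is injective. -/
theorem injective_of_surjective (f : (ElemIndex n → R) →ₗ[R] FlagModule n R)
    (hf : Function.Surjective f) : Function.Injective f := by
  have h1 : Function.Surjective ((flagEquiv R n).toLinearMap.comp f) := by
    rw [LinearMap.coe_comp]
    exact (flagEquiv R n).surjective.comp hf
  have h2 := OrzechProperty.injective_of_surjective_endomorphism _ h1
  rw [LinearMap.coe_comp] at h2
  exact h2.of_comp

theorem surjective_of_flag {M : Type} [AddCommGroup M] [Module R M] (f : M →ₗ[R] FlagModule n R)
    (hf : ∀ w, ∃ v, f v = flag w 1) : Function.Surjective f := by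
  intro v
  choose g hg using hf
  refine ⟨∑ w, coord w v • g w, ?_⟩
  rw [map_sum]
  conv_rhs => rw [eq_sum_flag v]
  refine Finset.sum_congr rfl fun w _ => ?_
  rw [map_smul, hg, smul_flag, mul_one]

variable [IsDomain R]

/-- Schubert polynomials reach every permutation and lie in the span, so the coefficients map onto
the flag module and hence injectively. This gives uniqueness of the expansion and also recovers it
from the vector alone. -/
theorem elemProd_coeff_unique {α β : ElemIndex n → R}
    (h : polyOp 0 (∑ I, α I • elemProd R I) (flag 1 (1 : R)) =
      polyOp 0 (∑ I, β I • elemProd R I) (flag 1 1)) : α = β := by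
  let f : (ElemIndex n → R) →ₗ[R] FlagModule n R :=
    (LinearMap.applyₗ (flag (1 : Equiv.Perm (Fin n)) (1 : R))).comp
      ((polyOp (0 : Fin (n - 1) → R)).toLinearMap.comp
        (Fintype.linearCombination R (elemProd R (n := n))))
  have hf : ∀ α, f α = polyOp 0 (∑ I, α I • elemProd R I) (flag 1 (1 : R)) := fun α => rfl
  refine injective_of_surjective f (surjective_of_flag f fun w => ?_) ?_
  · obtain ⟨α, hα⟩ := exists_elemProd_expansion (R := R) w
    exact ⟨α, by rw [hf, ← hα, polyOp_schubert]⟩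
  · rw [hf, hf, h]

/-- It reduces the computation of a Schubert polynomial and its quantization to finding one
combination that sends the identity to w. -/
theorem quantumSchubert_eq {w : Equiv.Perm (Fin n)} {α : ElemIndex n → R}
    (h : polyOp 0 (∑ I, α I • elemProd R I) (flag 1 (1 : R)) = flag w 1) :
    schubert R w = ∑ I, α I • elemProd R I ∧ quantumSchubert R w =
      ∑ I, MvPolynomial.C (MvPolynomial.C (α I)) * quantumElemProd R I := by
  have hex := exists_elemProd_expansion (R := R) w
  have h1 : hex.choose = α := elemProd_coeff_unique (by
    rw [← hex.choose_spec, polyOp_schubert, h])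
  refine ⟨by rw [← h1, ← hex.choose_spec], ?_⟩
  rw [quantumSchubert, dif_pos hex, h1]

end Expansions

/-! ### The Schubert polynomial of the shape `(2, 2)` -/

section BoxSchubert

variable {R : Type} [CommRing R] [IsDomain R] {n : ℕ}

/-- The difference of the two vectors is killed at all descents, so it is a multiple of the
identity, and the coefficient at the identity excludes this. -/
theorem eq_flag_of_demazure {u : FlagModule n R} {w : Equiv.Perm (Fin n)} (hw : w ≠ 1)
    (h0 : coord 1 u = 0) (h : ∀ i j : Fin n, i.val + 1 = j.val →
      demazure R i j u = if w j < w i then flag (w * Equiv.swap i j) 1 else 0) : u = flag w 1 := by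
  classical
  rw [← sub_eq_zero]
  refine flagModule_ext fun w' => ?_
  have h1 : ∀ i j : Fin n, i.val + 1 = j.val → demazure R i j (u - flag w 1) = 0 := by
    intro i j hij
    rw [map_sub, h i j hij, demazure_flag hij, sub_self]
  rw [map_zero]
  by_cases hw' : ∃ i j : Fin n, i.val + 1 = j.val ∧ w' j < w' i
  · obtain ⟨i, j, hij, hw'⟩ := hw'
    exact coord_eq_zero_of_demazure hij (h1 i j hij) hw'
  · push Not at hw'
    have h2 : w' = 1 := by
      ext c
      exact eq_val_of_step (f := fun c => (w' c).val) (fun a => (w' a).isLt) (fun a b hab =>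
        lt_of_le_of_ne (hw' a b hab) (val_ne w' (fun h => by rw [h] at hab; omega))) c
    rw [h2, map_sub, h0, coord_flag, if_neg hw, sub_zero]

theorem dividedDiff_sub {i j : Fin n} (hij : i ≠ j) (f g : MvPolynomial (Fin n) R) :
    dividedDiff i j (f - g) = dividedDiff i j f - dividedDiff i j g := by
  apply dividedDiff_unique hij
  have h1 := sub_mul_dividedDiff i j f
  have h2 := sub_mul_dividedDiff i j g
  rw [map_sub]
  linear_combination h1 - h2

theorem dividedDiff_elemSym_mul {i j : Fin n} (hij : i.val + 1 = j.val) {a b : ℕ} (hab : a ≠ b)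
    (r s : ℕ) : dividedDiff i j (elemSym R n a (r + 1) * elemSym R n b (s + 1)) =
      if j.val = a then elemSym R n i.val r * elemSym R n b (s + 1)
      else if j.val = b then elemSym R n a (r + 1) * elemSym R n i.val s else 0 := by
  have hne : i ≠ j := fun h => by rw [h] at hij; omega
  split_ifs with h1 h2
  · subst h1
    rw [dividedDiff_mul hne, dividedDiff_elemSym hij, dividedDiff_elemSym_of_ne hij hab.symm,
      mul_zero, add_zero]
  · subst h2
    rw [dividedDiff_mul hne, dividedDiff_elemSym hij, dividedDiff_elemSym_of_ne hij hab,
      zero_mul, zero_add, rename_swap_elemSym _ _ (by omega)]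
  · refine dividedDiff_of_symm hne ?_
    rw [map_mul, rename_swap_elemSym _ _ (by omega), rename_swap_elemSym _ _ (by omega)]

variable (R) in
/-- The vector that a polynomial yields on the identity permutation. -/
def flagOf (f : MvPolynomial (Fin n) R) : FlagModule n R := polyOp 0 f (flag 1 1)

theorem demazure_flagOf {i j : Fin n} (hij : i.val + 1 = j.val) (f : MvPolynomial (Fin n) R) :
    demazure R i j (flagOf R f) = flagOf R (dividedDiff i j f) :=
  demazure_polyOp hij f (demazure_flag_one hij 1)

theorem flagOf_zero : flagOf R (0 : MvPolynomial (Fin n) R) = 0 := by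
  rw [flagOf, map_zero, LinearMap.zero_apply]

theorem flagOf_eq_flag {f : MvPolynomial (Fin n) R} {w : Equiv.Perm (Fin n)} (hw : w ≠ 1)
    (h0 : MvPolynomial.constantCoeff f = 0) (h : ∀ i j : Fin n, i.val + 1 = j.val →
      flagOf R (dividedDiff i j f) = if w j < w i then flag (w * Equiv.swap i j) 1 else 0) :
    flagOf R f = flag w 1 := by
  refine eq_flag_of_demazure hw ?_ fun i j hij => by rw [demazure_flagOf hij, h i j hij]
  rw [flagOf, coord_one_polyOp, h0, zero_mul]

/-- The weak order below w is climbed from s_k. The polynomials on the way are e_1^k, e_2^{k+1},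
e_1^{k-1} e_1^k - e_2^k and e_1^{k-1} e_2^{k+1} - e_3^{k+1}. At each stage the nonzero divided
differences are polynomials already identified, and they occur exactly at the descents. -/
theorem flagOf_box (k : ℕ) (hk : 2 ≤ k) (hn : k + 2 ≤ n) :
    flagOf R (elemSym R n k 2 * elemSym R n (k + 1) 2 - elemSym R n k 1 * elemSym R n (k + 1) 3) =
      flag (boxPerm n k hk hn) 1 := by
  obtain ⟨a, b, c, d, ha, hb, hc, hd⟩ : ∃ a b c d : Fin n,
      a.val = k - 2 ∧ b.val = k - 1 ∧ c.val = k ∧ d.val = k + 1 :=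
    ⟨⟨k - 2, by omega⟩, ⟨k - 1, by omega⟩, ⟨k, by omega⟩, ⟨k + 1, by omega⟩, rfl, rfl, rfl, rfl⟩
  have hbox : boxPerm n k hk hn = Equiv.swap a c * Equiv.swap b d := by
    unfold boxPerm
    congr 2 <;> ext <;> simp [ha, hb, hc, hd]
  have hne : ∀ {i j : Fin n}, i.val + 1 = j.val → i ≠ j := fun hij h => by rw [h] at hij; omega
  have hcases : ∀ i j : Fin n, i.val + 1 = j.val →
      (i = a ∧ j = b) ∨ (i = b ∧ j = c) ∨ (i = c ∧ j = d) ∨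
        (j.val ≠ k - 1 ∧ j.val ≠ k ∧ j.val ≠ k + 1) := by
    intro i j hij
    simp only [Fin.ext_iff]
    omega
  -- the five permutations, through their values
  obtain ⟨p1, hp1⟩ : ∃ p : Equiv.Perm (Fin n), p = Equiv.swap b c := ⟨_, rfl⟩
  obtain ⟨p2, hp2⟩ : ∃ p : Equiv.Perm (Fin n), p = p1 * Equiv.swap c d := ⟨_, rfl⟩
  obtain ⟨ph, hph⟩ : ∃ p : Equiv.Perm (Fin n), p = p1 * Equiv.swap a b := ⟨_, rfl⟩
  obtain ⟨pg, hpg⟩ : ∃ p : Equiv.Perm (Fin n), p = p2 * Equiv.swap a b := ⟨_, rfl⟩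
  obtain ⟨pb, hpb⟩ : ∃ p : Equiv.Perm (Fin n), p = pg * Equiv.swap b c := ⟨_, rfl⟩
  have hval : ∀ {x y z : Fin n}, (Equiv.swap x y z).val =
      if z.val = x.val then y.val else if z.val = y.val then x.val else z.val := by
    intro x y z
    simp only [Equiv.swap_apply_def, Fin.ext_iff]
    split_ifs <;> rfl
  have v1 : ∀ z, (p1 z).val = if z.val = k - 1 then k else if z.val = k then k - 1 else z.val := by
    intro z; rw [hp1, hval, hb, hc]
  have v2 : ∀ z, (p2 z).val = if z.val = k - 1 then k else if z.val = k then k + 1 else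
      if z.val = k + 1 then k - 1 else z.val := by
    intro z; rw [hp2, Equiv.Perm.mul_apply, v1, hval, hc, hd]
    split_ifs <;> omega
  have vh : ∀ z, (ph z).val = if z.val = k - 2 then k else if z.val = k - 1 then k - 2 else
      if z.val = k then k - 1 else z.val := by
    intro z; rw [hph, Equiv.Perm.mul_apply, v1, hval, ha, hb]
    split_ifs <;> omega
  have vg : ∀ z, (pg z).val = if z.val = k - 2 then k else if z.val = k - 1 then k - 2 else
      if z.val = k then k + 1 else if z.val = k + 1 then k - 1 else z.val := by
    intro z; rw [hpg, Equiv.Perm.mul_apply, v2, hval, ha, hb]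
    split_ifs <;> omega
  have vb : ∀ z, (pb z).val = if z.val = k - 2 then k else if z.val = k - 1 then k + 1 else
      if z.val = k then k - 2 else if z.val = k + 1 then k - 1 else z.val := by
    intro z; rw [hpb, Equiv.Perm.mul_apply, vg, hval, hb, hc]
    split_ifs <;> omega
  have hbox' : boxPerm n k hk hn = pb := by
    ext z
    rw [vb, hbox, Equiv.Perm.mul_apply, hval, hval, ha, hb, hc, hd]
    split_ifs <;> omega
  have hgh : pg * Equiv.swap c d = ph := by
    ext z
    rw [vh, Equiv.Perm.mul_apply, vg, hval, hc, hd]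
    split_ifs <;> omega
  have hne1 : ∀ {p : Equiv.Perm (Fin n)} {z : Fin n}, (p z).val ≠ z.val → p ≠ 1 := by
    rintro p z h rfl
    exact h rfl
  have hcc : ∀ m r, r ≠ 0 → MvPolynomial.constantCoeff (elemSym R n m r) = 0 := by
    rintro m (_ | r) hr
    · exact absurd rfl hr
    · exact constantCoeff_elemSym m r
  have h1 : flagOf R (elemSym R n k 1) = flag p1 1 := by
    refine flagOf_eq_flag (hne1 (z := c) (by rw [v1, hc]; split_ifs <;> omega))
      (constantCoeff_elemSym _ _) fun i j hij => ?_
    rcases hcases i j hij with ⟨rfl, rfl⟩ | ⟨rfl, rfl⟩ | ⟨rfl, rfl⟩ | ⟨e1, e2, e3⟩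
    · rw [dividedDiff_elemSym_of_ne hij (by omega), if_neg, flagOf_zero]
      rw [Fin.lt_def, v1, v1]; split_ifs <;> omega
    · have := dividedDiff_elemSym (R := R) hij 0
      rw [hc] at this
      rw [this, elemSym_zero, if_pos, hp1, Equiv.swap_mul_self]
      · simp [flagOf]
      · rw [Fin.lt_def, v1, v1]; split_ifs <;> omega
    · rw [dividedDiff_elemSym_of_ne hij (by omega), if_neg, flagOf_zero]
      rw [Fin.lt_def, v1, v1]; split_ifs <;> omega
    · rw [dividedDiff_elemSym_of_ne hij (by omega), if_neg, flagOf_zero]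
      rw [Fin.lt_def, v1, v1]; split_ifs <;> omega
  have h2 : flagOf R (elemSym R n (k + 1) 2) = flag p2 1 := by
    refine flagOf_eq_flag (hne1 (z := c) (by rw [v2, hc]; split_ifs <;> omega))
      (constantCoeff_elemSym _ _) fun i j hij => ?_
    rcases hcases i j hij with ⟨rfl, rfl⟩ | ⟨rfl, rfl⟩ | ⟨rfl, rfl⟩ | ⟨e1, e2, e3⟩
    · rw [dividedDiff_elemSym_of_ne hij (by omega), if_neg, flagOf_zero]
      rw [Fin.lt_def, v2, v2]; split_ifs <;> omega
    · rw [dividedDiff_elemSym_of_ne hij (by omega), if_neg, flagOf_zero]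
      rw [Fin.lt_def, v2, v2]; split_ifs <;> omega
    · have := dividedDiff_elemSym (R := R) hij 1
      rw [hd, hc] at this
      rw [this, h1, if_pos, hp2, mul_assoc, Equiv.swap_mul_self, mul_one]
      rw [Fin.lt_def, v2, v2]; split_ifs <;> omega
    · rw [dividedDiff_elemSym_of_ne hij (by omega), if_neg, flagOf_zero]
      rw [Fin.lt_def, v2, v2]; split_ifs <;> omega
  have hh : flagOf R (elemSym R n (k - 1) 1 * elemSym R n k 1 - elemSym R n k 2) = flag ph 1 := by
    refine flagOf_eq_flag (hne1 (z := a) (by rw [vh, ha]; split_ifs <;> omega))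
      (by simp [hcc])
      fun i j hij => ?_
    rw [dividedDiff_sub (hne hij), dividedDiff_elemSym_mul hij (by omega) 0 0]
    rcases hcases i j hij with ⟨rfl, rfl⟩ | ⟨rfl, rfl⟩ | ⟨rfl, rfl⟩ | ⟨e1, e2, e3⟩
    · rw [dividedDiff_elemSym_of_ne hij (by omega), if_pos hb, elemSym_zero, one_mul, sub_zero, h1,
        if_pos, hph, mul_assoc, Equiv.swap_mul_self, mul_one]
      rw [Fin.lt_def, vh, vh]; split_ifs <;> omega
    · have := dividedDiff_elemSym (R := R) hij 1
      rw [hc, hb] at this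
      rw [this, if_neg (by omega), if_pos hc, if_neg, elemSym_zero, mul_one, sub_self, flagOf_zero]
      rw [Fin.lt_def, vh, vh]; split_ifs <;> omega
    · rw [dividedDiff_elemSym_of_ne hij (by omega), if_neg (by omega), if_neg (by omega), sub_zero,
        flagOf_zero, if_neg]
      rw [Fin.lt_def, vh, vh]; split_ifs <;> omega
    · rw [dividedDiff_elemSym_of_ne hij (by omega), if_neg (by omega), if_neg (by omega), sub_zero,
        flagOf_zero, if_neg]
      rw [Fin.lt_def, vh, vh]; split_ifs <;> omega
  have hg : flagOf R (elemSym R n (k - 1) 1 * elemSym R n (k + 1) 2 - elemSym R n (k + 1) 3) =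
      flag pg 1 := by
    refine flagOf_eq_flag (hne1 (z := a) (by rw [vg, ha]; split_ifs <;> omega))
      (by simp [hcc])
      fun i j hij => ?_
    rw [dividedDiff_sub (hne hij), dividedDiff_elemSym_mul hij (by omega) 0 1]
    rcases hcases i j hij with ⟨rfl, rfl⟩ | ⟨rfl, rfl⟩ | ⟨rfl, rfl⟩ | ⟨e1, e2, e3⟩
    · rw [dividedDiff_elemSym_of_ne hij (by omega), if_pos hb, elemSym_zero, one_mul, sub_zero, h2,
        if_pos, hpg, mul_assoc, Equiv.swap_mul_self, mul_one]
      rw [Fin.lt_def, vg, vg]; split_ifs <;> omega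
    · rw [dividedDiff_elemSym_of_ne hij (by omega), if_neg (by omega), if_neg (by omega), sub_zero,
        flagOf_zero, if_neg]
      rw [Fin.lt_def, vg, vg]; split_ifs <;> omega
    · have := dividedDiff_elemSym (R := R) hij 2
      rw [hd, hc] at this
      rw [this, if_neg (by omega), if_pos hd, hc, hh, if_pos, hgh]
      rw [Fin.lt_def, vg, vg]; split_ifs <;> omega
    · rw [dividedDiff_elemSym_of_ne hij (by omega), if_neg (by omega), if_neg (by omega), sub_zero,
        flagOf_zero, if_neg]
      rw [Fin.lt_def, vg, vg]; split_ifs <;> omega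
  rw [hbox']
  refine flagOf_eq_flag (hne1 (z := a) (by rw [vb, ha]; split_ifs <;> omega))
    (by simp [hcc])
    fun i j hij => ?_
  rw [dividedDiff_sub (hne hij), dividedDiff_elemSym_mul hij (by omega) 1 1,
    dividedDiff_elemSym_mul hij (by omega) 0 2]
  rcases hcases i j hij with ⟨rfl, rfl⟩ | ⟨rfl, rfl⟩ | ⟨rfl, rfl⟩ | ⟨e1, e2, e3⟩
  · rw [if_neg (by omega), if_neg (by omega), if_neg (by omega), if_neg (by omega), sub_zero,
      flagOf_zero, if_neg]
    rw [Fin.lt_def, vb, vb]; split_ifs <;> omega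
  · rw [if_pos hc, if_pos hc, elemSym_zero, one_mul, hb, hg, if_pos, hpb, mul_assoc,
      Equiv.swap_mul_self, mul_one]
    rw [Fin.lt_def, vb, vb]; split_ifs <;> omega
  -- At the last place both products differentiate to e_1^k e_2^k and cancel.
  · rw [if_neg (by omega), if_pos hd, if_neg (by omega), if_pos hd, hc,
      mul_comm (elemSym R n k (0 + 1)), sub_self, flagOf_zero, if_neg]
    rw [Fin.lt_def, vb, vb]; split_ifs <;> omega
  · rw [if_neg (by omega), if_neg (by omega), if_neg (by omega), if_neg (by omega), sub_zero,
      flagOf_zero, if_neg]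
    rw [Fin.lt_def, vb, vb]; split_ifs <;> omega

/-- The index of a product of two elementary symmetric polynomials. -/
def pairIndex (n k r s : ℕ) (m : Fin (n - 1)) : Fin (m.val + 2) :=
  if m.val + 1 = k then Fin.ofNat _ r else if m.val = k then Fin.ofNat _ s else 0

theorem prod_pairIndex {M : Type} [CommMonoid M] {k r s : ℕ} (hk : 2 ≤ k) (hn : k + 2 ≤ n)
    (hr : r ≤ k) (hs : s ≤ k + 1) (F : ℕ → ℕ → M) (hF : ∀ m, F m 0 = 1) :
    ∏ m : Fin (n - 1), F (m.val + 1) (pairIndex n k r s m).val = F k r * F (k + 1) s := by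
  have hne : (⟨k - 1, by omega⟩ : Fin (n - 1)) ≠ ⟨k, by omega⟩ := by
    simp only [Ne, Fin.ext_iff]; omega
  rw [← Finset.mul_prod_erase _ _ (Finset.mem_univ (⟨k - 1, by omega⟩ : Fin (n - 1))),
    ← Finset.mul_prod_erase _ _ (Finset.mem_erase.2 ⟨hne.symm, Finset.mem_univ _⟩),
    Finset.prod_eq_one, mul_one]
  · have e1 : (pairIndex n k r s ⟨k - 1, by omega⟩).val = r := by
      rw [pairIndex, if_pos (by simp only; omega)]
      exact Nat.mod_eq_of_lt (by simp only; omega)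
    have e2 : (pairIndex n k r s ⟨k, by omega⟩).val = s := by
      rw [pairIndex, if_neg (by simp only; omega), if_pos rfl]
      exact Nat.mod_eq_of_lt (by simp only; omega)
    rw [e1, e2]
    simp only
    rw [show k - 1 + 1 = k by omega]
  · intro m hm
    simp only [Finset.mem_erase, Finset.mem_univ, and_true, Ne, Fin.ext_iff] at hm
    rw [pairIndex, if_neg (by omega), if_neg (by omega)]
    exact hF _

/-- The polynomial of `flagOf_box` is a difference of two standard products, so its quantization is
obtained factor by factor. -/
theorem schubert_boxPerm (k : ℕ) (hk : 2 ≤ k) (hn : k + 2 ≤ n) :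
    schubert R (boxPerm n k hk hn) =
        elemSym R n k 2 * elemSym R n (k + 1) 2 - elemSym R n k 1 * elemSym R n (k + 1) 3 ∧
      quantumSchubert R (boxPerm n k hk hn) =
        quantumElem R n k 2 * quantumElem R n (k + 1) 2 -
          quantumElem R n k 1 * quantumElem R n (k + 1) 3 := by
  classical
  let α : ElemIndex n → R := Pi.single (pairIndex n k 2 2) 1 - Pi.single (pairIndex n k 1 3) 1
  have h1 : ∀ r s, r ≤ k → s ≤ k + 1 → elemProd R (pairIndex n k r s) =
      elemSym R n k r * elemSym R n (k + 1) s := fun r s hr hs =>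
    prod_pairIndex hk hn hr hs (fun m i => elemSym R n m i) elemSym_zero
  have h2 : ∀ r s, r ≤ k → s ≤ k + 1 → quantumElemProd R (pairIndex n k r s) =
      quantumElem R n k r * quantumElem R n (k + 1) s := fun r s hr hs =>
    prod_pairIndex hk hn hr hs (fun m i => quantumElem R n m i) fun m => by simp [quantumElem]
  have hα : ∑ I, α I • elemProd R I =
      elemSym R n k 2 * elemSym R n (k + 1) 2 - elemSym R n k 1 * elemSym R n (k + 1) 3 := by
    simp only [α, Pi.sub_apply, sub_smul, Finset.sum_sub_distrib, Pi.single_apply, ite_smul,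
      one_smul, zero_smul, Finset.sum_ite_eq', Finset.mem_univ, if_true]
    rw [h1 _ _ hk (by omega), h1 _ _ (by omega) (by omega)]
  obtain ⟨e1, e2⟩ := quantumSchubert_eq (w := boxPerm n k hk hn) (α := α) (by
    rw [hα]; exact flagOf_box k hk hn)
  refine ⟨by rw [e1, hα], ?_⟩
  rw [e2]
  have h3 : ∀ I, MvPolynomial.C (MvPolynomial.C (α I)) * quantumElemProd R I =
      (if I = pairIndex n k 2 2 then quantumElemProd R I else 0) -
        if I = pairIndex n k 1 3 then quantumElemProd R I else 0 := by
    intro I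
    simp only [α, Pi.sub_apply, Pi.single_apply, map_sub, sub_mul]
    congr 1 <;> split_ifs <;> simp
  rw [Finset.sum_congr rfl fun I _ => h3 I, Finset.sum_sub_distrib]
  simp only [Finset.sum_ite_eq', Finset.mem_univ, if_true]
  rw [h2 _ _ hk (by omega), h2 _ _ (by omega) (by omega)]

end BoxSchubert

/-! ### The Schur polynomial of the shape `(2, 2)` -/

section Schur

variable {R : Type} [CommRing R] {n : ℕ}

/-- Monomials are sorted by their last variable. -/
theorem elemSym_eq_sum (m i : ℕ) (hm : m ≤ n) : elemSym R n m (i + 1) =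
    ∑ c : Fin n, if c.val < m then MvPolynomial.X c * elemSym R n c.val i else 0 := by
  induction m with
  | zero => rw [elemSym_of_lt (by omega)]; simp
  | succ m ih =>
    rw [elemSym_succ hm, ih (by omega)]
    have h1 : ∀ c : Fin n, (if c.val < m + 1 then MvPolynomial.X c * elemSym R n c.val i else 0) =
        (if c.val < m then MvPolynomial.X c * elemSym R n c.val i else 0) +
          if c = ⟨m, hm⟩ then MvPolynomial.X c * elemSym R n c.val i else 0 := by
      intro c
      simp only [Fin.ext_iff]
      split_ifs <;> first | omega | simp
    rw [Finset.sum_congr rfl fun c _ => h1 c, Finset.sum_add_distrib]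
    simp

theorem rename_castLE_elemSym {k : ℕ} (hk : k ≤ n) (m i : ℕ) (hm : m ≤ k) :
    MvPolynomial.rename (Fin.castLE hk) (elemSym R k m i) = elemSym R n m i := by
  induction m generalizing i with
  | zero =>
    rcases i with _ | i
    · simp
    · rw [elemSym_of_lt (by omega), elemSym_of_lt (by omega), map_zero]
  | succ m ih =>
    rcases i with _ | i
    · simp
    · rw [elemSym_succ hm, elemSym_succ (by omega), map_add, map_mul, ih _ (by omega),
        ih _ (by omega), MvPolynomial.rename_X]
      rfl

end Schur

section SchurBox

variable {R : Type} [CommRing R] {k : ℕ}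

theorem mem_boxShape (i j : ℕ) : (i, j) ∈ boxShape.cells ↔ i < 2 ∧ j < 2 := by
  have h : (i, j) ∈ boxShape.cells ↔
      ∃ h : i < [2, 2].length, j < [2, 2][i] := YoungDiagram.mem_ofRowLens
  rw [h]
  constructor
  · rintro ⟨h1, h2⟩
    simp only [List.length_cons, List.length_nil] at h1
    rcases i with _ | _ | i
    · exact ⟨h1, h2⟩
    · exact ⟨h1, h2⟩
    · omega
  · rintro ⟨h1, h2⟩
    refine ⟨h1, ?_⟩
    rcases i with _ | _ | i
    · exact h2
    · exact h2
    · omega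

/-- The four cells of the shape `(2, 2)`. -/
def boxCells : Fin 4 ≃ boxShape.cells where
  toFun t := ⟨(t.val / 2, t.val % 2), (mem_boxShape _ _).2 (by omega)⟩
  invFun c := ⟨2 * c.1.1 + c.1.2, by have := (mem_boxShape c.1.1 c.1.2).1 c.2; omega⟩
  left_inv t := by ext; simp only; omega
  right_inv c := by
    have := (mem_boxShape c.1.1 c.1.2).1 c.2
    ext <;> simp only <;> omega

theorem isSemistandard_boxShape (T : boxShape.cells → Fin k) :
    IsSemistandard boxShape T ↔
      (T (boxCells 0) ≤ T (boxCells 1) ∧ T (boxCells 2) ≤ T (boxCells 3)) ∧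
        T (boxCells 0) < T (boxCells 2) ∧ T (boxCells 1) < T (boxCells 3) := by
  unfold IsSemistandard
  constructor
  · rintro ⟨h1, h2⟩
    exact ⟨⟨h1 _ _ rfl (by simp [boxCells]), h1 _ _ rfl (by simp [boxCells])⟩,
      h2 _ _ rfl (by simp [boxCells]), h2 _ _ rfl (by simp [boxCells])⟩
  · rintro ⟨⟨h1, h2⟩, h3, h4⟩
    constructor
    · intro c d
      obtain ⟨s, rfl⟩ := boxCells.surjective c
      obtain ⟨t, rfl⟩ := boxCells.surjective d
      intro h5 h6
      fin_cases s <;> fin_cases t <;> simp [boxCells] at h5 h6 <;>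
        first | exact le_rfl | exact h1 | exact h2
    · intro c d
      obtain ⟨s, rfl⟩ := boxCells.surjective c
      obtain ⟨t, rfl⟩ := boxCells.surjective d
      intro h5 h6
      fin_cases s <;> fin_cases t <;> simp [boxCells] at h5 h6 <;>
        first | exact h3 | exact h4

theorem sum_quadruples {M : Type} [AddCommMonoid M] {α : Type} [Fintype α] (f : α → α → α → α → M) :
    ∑ q : α × α × α × α, f q.1 q.2.1 q.2.2.1 q.2.2.2 = ∑ a, ∑ b, ∑ c, ∑ d, f a b c d := by
  simp only [Fintype.sum_prod_type]

/-- A term of e_2 e_2 is a pair of strictly increasing columns. The pairs that are not semistandard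
are matched bijectively, with equal monomials, to the terms of e_1 e_3. -/
theorem schur_boxShape : schur R k boxShape =
    elemSym R k k 2 * elemSym R k k 2 - elemSym R k k 1 * elemSym R k k 3 := by
  classical
  let m (a b c d : Fin k) : MvPolynomial (Fin k) R :=
    MvPolynomial.X a * MvPolynomial.X b * MvPolynomial.X c * MvPolynomial.X d
  have hS : schur R k boxShape = ∑ a, ∑ b, ∑ c, ∑ d,
      if (a ≤ b ∧ c ≤ d) ∧ a < c ∧ b < d then m a b c d else 0 := by
    unfold schur
    rw [Finset.sum_filter, ← sum_quadruples]
    refine Fintype.sum_equiv ⟨fun T => (T (boxCells 0), T (boxCells 1), T (boxCells 2),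
      T (boxCells 3)), fun q c => ![q.1, q.2.1, q.2.2.1, q.2.2.2] (boxCells.symm c), ?_, ?_⟩ _ _ ?_
    · intro T
      funext c
      obtain ⟨t, rfl⟩ := boxCells.surjective c
      simp only [Equiv.symm_apply_apply]
      fin_cases t <;> rfl
    · intro q
      simp
    · intro T
      simp only [Equiv.coe_fn_mk]
      refine if_congr (isSemistandard_boxShape T) ?_ rfl
      rw [← Equiv.prod_comp boxCells, Fin.prod_univ_four]
  have h1 : elemSym R k k 1 = ∑ p, MvPolynomial.X p := by
    rw [elemSym_eq_sum k 0 le_rfl]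
    exact Finset.sum_congr rfl fun c _ => by simp
  have h2 : elemSym R k k 2 = ∑ a, ∑ c, if a < c then MvPolynomial.X a * MvPolynomial.X c else 0 := by
    rw [elemSym_eq_sum k 1 le_rfl, Finset.sum_comm]
    refine Finset.sum_congr rfl fun c _ => ?_
    rw [if_pos c.isLt, elemSym_eq_sum _ 0 c.isLt.le, Finset.mul_sum]
    refine Finset.sum_congr rfl fun a _ => ?_
    simp only [Fin.lt_def, elemSym_zero, mul_one, mul_ite, mul_zero, mul_comm]
  have h3 : elemSym R k k 3 = ∑ x, ∑ y, ∑ z,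
      if x < y ∧ y < z then MvPolynomial.X x * MvPolynomial.X y * MvPolynomial.X z else 0 := by
    rw [elemSym_eq_sum k 2 le_rfl, Finset.sum_comm_cycle]
    refine Finset.sum_congr rfl fun z _ => ?_
    rw [if_pos z.isLt, elemSym_eq_sum _ 1 z.isLt.le, Finset.mul_sum, Finset.sum_comm]
    refine Finset.sum_congr rfl fun y _ => ?_
    rw [elemSym_eq_sum _ 0 y.isLt.le]
    by_cases hyz : y.val < z.val
    · rw [if_pos hyz, Finset.mul_sum, Finset.mul_sum]
      refine Finset.sum_congr rfl fun x _ => ?_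
      simp only [Fin.lt_def, hyz, and_true, elemSym_zero, mul_one, mul_ite, mul_zero]
      split_ifs
      · ring
      · rfl
    · rw [if_neg hyz, mul_zero]
      simp only [Fin.lt_def, hyz, and_false, if_false, Finset.sum_const_zero]
  have h22 : elemSym R k k 2 * elemSym R k k 2 = ∑ a, ∑ b, ∑ c, ∑ d,
      if a < c ∧ b < d then m a b c d else 0 := by
    rw [h2, Finset.sum_mul_sum]
    refine Finset.sum_congr rfl fun a _ => Finset.sum_congr rfl fun b _ => ?_
    rw [Finset.sum_mul_sum]
    refine Finset.sum_congr rfl fun c _ => Finset.sum_congr rfl fun d _ => ?_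
    by_cases e1 : a < c <;> by_cases e2 : b < d <;> simp [e1, e2, m]
    ring
  have h13 : elemSym R k k 1 * elemSym R k k 3 = ∑ p, ∑ x, ∑ y, ∑ z,
      if x < y ∧ y < z then m p x y z else 0 := by
    rw [h1, h3, Finset.sum_mul]
    refine Finset.sum_congr rfl fun p _ => ?_
    simp only [Finset.mul_sum]
    refine Finset.sum_congr rfl fun x _ => Finset.sum_congr rfl fun y _ =>
      Finset.sum_congr rfl fun z _ => ?_
    rw [mul_ite, mul_zero]
    refine if_congr Iff.rfl ?_ rfl
    ring
  -- Either the first row decreases, or it does not and the second row does; in the latter case a ≤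
  -- b < d < c.
  have hsplit : ∀ a b c d : Fin k, (if a < c ∧ b < d then m a b c d else 0) =
      (if (a ≤ b ∧ c ≤ d) ∧ a < c ∧ b < d then m a b c d else 0) +
      ((if b < a ∧ a < c ∧ b < d then m a b c d else 0) +
      if a ≤ b ∧ b < d ∧ d < c then m a b c d else 0) := by
    intro a b c d
    simp only [Fin.lt_def, Fin.le_def]
    split_ifs <;> first | omega | simp
  have hsplit' : ∀ p x y z : Fin k, (if x < y ∧ y < z then m p x y z else 0) =
      (if x < y ∧ y < z ∧ x < p then m p x y z else 0) +
      if p ≤ x ∧ x < y ∧ y < z then m p x y z else 0 := by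
    intro p x y z
    simp only [Fin.lt_def, Fin.le_def]
    split_ifs <;> first | omega | simp
  -- Here b < a < c is the new column of length three and d is the single entry, so the single entry
  -- exceeds the top of the column. The other failure gives the single entries that do not.
  have e1 : ∑ a, ∑ b, ∑ c, ∑ d, (if b < a ∧ a < c ∧ b < d then m a b c d else 0) =
      ∑ p, ∑ x, ∑ y, ∑ z, if x < y ∧ y < z ∧ x < p then m p x y z else 0 := by
    rw [← sum_quadruples, ← sum_quadruples]
    refine Fintype.sum_equiv ⟨fun q => (q.2.2.2, q.2.1, q.1, q.2.2.1),
      fun q => (q.2.2.1, q.2.1, q.2.2.2, q.1), fun _ => rfl, fun _ => rfl⟩ _ _ fun q => ?_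
    simp only [Equiv.coe_fn_mk, m]
    refine if_congr Iff.rfl ?_ rfl
    ring
  have e2 : ∑ a, ∑ b, ∑ c, ∑ d, (if a ≤ b ∧ b < d ∧ d < c then m a b c d else 0) =
      ∑ p, ∑ x, ∑ y, ∑ z, if p ≤ x ∧ x < y ∧ y < z then m p x y z else 0 := by
    refine Finset.sum_congr rfl fun a _ => Finset.sum_congr rfl fun b _ => ?_
    rw [Finset.sum_comm]
    refine Finset.sum_congr rfl fun d _ => Finset.sum_congr rfl fun c _ =>
      if_congr Iff.rfl ?_ rfl
    simp only [m]
    ring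
  rw [hS, h22, h13]
  simp only [hsplit, hsplit', Finset.sum_add_distrib]
  rw [e1, e2]
  ring

/-- Adding the variable x_{k+1} to the second factors adds x_{k+1} e_1 e_2 to both products. -/
theorem rename_schur_boxShape {n : ℕ} (hk : k < n) :
    MvPolynomial.rename (Fin.castLE hk.le) (schur R k boxShape) =
      elemSym R n k 2 * elemSym R n (k + 1) 2 - elemSym R n k 1 * elemSym R n (k + 1) 3 := by
  rw [schur_boxShape, map_sub, map_mul, map_mul, rename_castLE_elemSym _ _ _ le_rfl,
    rename_castLE_elemSym _ _ _ le_rfl, rename_castLE_elemSym _ _ _ le_rfl, elemSym_succ hk,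
    elemSym_succ hk]
  ring

end SchurBox

/-! ### The first three elementary symmetric polynomials in the Dunkl elements -/

section Pieri

variable {ι A : Type} [DecidableEq ι] [Ring A]

/-- The sum over pairs of distinct elements of `I`. -/
def sumTwo (I : Finset ι) (f : ι → ι → A) : A := ∑ a ∈ I, ∑ b ∈ I, if a ≠ b then f a b else 0

/-- The sum over triples of distinct elements of `I`. -/
def sumThree (I : Finset ι) (f : ι → ι → ι → A) : A :=
  ∑ a ∈ I, ∑ b ∈ I, ∑ c ∈ I, if a ≠ b ∧ a ≠ c ∧ b ≠ c then f a b c else 0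

variable {I : Finset ι}

theorem sumTwo_congr {f g : ι → ι → A} (h : ∀ a ∈ I, ∀ b ∈ I, a ≠ b → f a b = g a b) :
    sumTwo I f = sumTwo I g := by
  refine Finset.sum_congr rfl fun a ha => Finset.sum_congr rfl fun b hb => ?_
  split_ifs with hab
  · exact h a ha b hb hab
  · rfl

theorem sumThree_congr {f g : ι → ι → ι → A}
    (h : ∀ a ∈ I, ∀ b ∈ I, ∀ c ∈ I, a ≠ b → a ≠ c → b ≠ c → f a b c = g a b c) :
    sumThree I f = sumThree I g := by
  refine Finset.sum_congr rfl fun a ha => Finset.sum_congr rfl fun b hb =>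
    Finset.sum_congr rfl fun c hc => ?_
  split_ifs with hab
  · exact h a ha b hb c hc hab.1 hab.2.1 hab.2.2
  · rfl

theorem sumTwo_add (f g : ι → ι → A) :
    sumTwo I (fun a b => f a b + g a b) = sumTwo I f + sumTwo I g := by
  simp only [sumTwo, ← Finset.sum_add_distrib]
  refine Finset.sum_congr rfl fun a _ => Finset.sum_congr rfl fun b _ => ?_
  split_ifs <;> simp

theorem sumThree_add (f g : ι → ι → ι → A) :
    sumThree I (fun a b c => f a b c + g a b c) = sumThree I f + sumThree I g := by
  simp only [sumThree, ← Finset.sum_add_distrib]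
  refine Finset.sum_congr rfl fun a _ => Finset.sum_congr rfl fun b _ =>
    Finset.sum_congr rfl fun c _ => ?_
  split_ifs <;> simp

theorem sumTwo_neg (f : ι → ι → A) : sumTwo I (fun a b => - f a b) = - sumTwo I f := by
  simp only [sumTwo, ← Finset.sum_neg_distrib]
  refine Finset.sum_congr rfl fun a _ => Finset.sum_congr rfl fun b _ => ?_
  split_ifs <;> simp

theorem sumTwo_sub (f g : ι → ι → A) :
    sumTwo I (fun a b => f a b - g a b) = sumTwo I f - sumTwo I g := by
  simp only [sub_eq_add_neg, sumTwo_add, sumTwo_neg]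

theorem mul_sumTwo (y : A) (f : ι → ι → A) : y * sumTwo I f = sumTwo I fun a b => y * f a b := by
  simp only [sumTwo, Finset.mul_sum, mul_ite, mul_zero]

theorem sumTwo_swap (f : ι → ι → A) : sumTwo I (fun a b => f b a) = sumTwo I f := by
  rw [sumTwo, Finset.sum_comm]
  simp only [sumTwo, ne_comm]

theorem sumThree_swap_left (f : ι → ι → ι → A) :
    sumThree I (fun a b c => f b a c) = sumThree I f := by
  rw [sumThree, Finset.sum_comm]
  refine Finset.sum_congr rfl fun a _ => Finset.sum_congr rfl fun b _ =>
    Finset.sum_congr rfl fun c _ => if_congr ?_ rfl rfl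
  rw [ne_comm]; tauto

theorem sumThree_swap_right (f : ι → ι → ι → A) :
    sumThree I (fun a b c => f a c b) = sumThree I f := by
  refine Finset.sum_congr rfl fun a _ => ?_
  rw [Finset.sum_comm]
  refine Finset.sum_congr rfl fun b _ => Finset.sum_congr rfl fun c _ => if_congr ?_ rfl rfl
  rw [ne_comm (a := c) (b := b)]; tauto

theorem sumThree_rotate (f : ι → ι → ι → A) :
    sumThree I (fun a b c => f b c a) = sumThree I f := by
  rw [← sumThree_swap_right f, ← sumThree_swap_left (fun a b c => f a c b)]

theorem sumTwo_insert {m : ι} (hm : m ∉ I) (f : ι → ι → A) :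
    sumTwo (insert m I) f = sumTwo I f + ∑ a ∈ I, (f m a + f a m) := by
  have h1 : ∀ a ∈ I, a ≠ m := fun a ha h => hm (h ▸ ha)
  simp only [sumTwo, Finset.sum_insert hm, Finset.sum_add_distrib]
  rw [Finset.sum_congr rfl fun a ha => if_pos (h1 a ha).symm,
    Finset.sum_congr rfl fun a ha => if_pos (h1 a ha)]
  simp
  abel

theorem sumThree_insert {m : ι} (hm : m ∉ I) (f : ι → ι → ι → A) :
    sumThree (insert m I) f = sumThree I f +
      sumTwo I (fun a b => f m a b + f a m b + f a b m) := by
  have h1 : ∀ a ∈ I, a ≠ m := fun a ha h => hm (h ▸ ha)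
  rw [sumTwo_add, sumTwo_add]
  simp only [sumThree, sumTwo, Finset.sum_insert hm, Finset.sum_add_distrib]
  have e1 : ∀ a ∈ I, ∀ b ∈ I, (if m ≠ a ∧ m ≠ b ∧ a ≠ b then f m a b else 0) =
      if a ≠ b then f m a b else 0 := fun a ha b hb => by simp [(h1 a ha).symm, (h1 b hb).symm]
  have e2 : ∀ a ∈ I, ∀ b ∈ I, (if a ≠ m ∧ a ≠ b ∧ m ≠ b then f a m b else 0) =
      if a ≠ b then f a m b else 0 := fun a ha b hb => by simp [(h1 a ha), (h1 b hb).symm]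
  have e3 : ∀ a ∈ I, ∀ b ∈ I, (if a ≠ b ∧ a ≠ m ∧ b ≠ m then f a b m else 0) =
      if a ≠ b then f a b m else 0 := fun a ha b hb => by simp [(h1 a ha), (h1 b hb)]
  rw [Finset.sum_congr rfl fun a ha => Finset.sum_congr rfl (e1 a ha),
    Finset.sum_congr rfl fun a ha => Finset.sum_congr rfl (e2 a ha),
    Finset.sum_congr rfl fun a ha => Finset.sum_congr rfl (e3 a ha)]
  simp
  abel

theorem sum_mul_sum_eq (y z : ι → A) : (∑ a ∈ I, y a) * ∑ a ∈ I, z a =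
    sumTwo I (fun a b => y a * z b) + ∑ a ∈ I, y a * z a := by
  rw [Finset.sum_mul_sum, sumTwo, ← Finset.sum_add_distrib]
  refine Finset.sum_congr rfl fun a ha => ?_
  rw [← Finset.add_sum_erase _ _ ha, ← Finset.add_sum_erase _ (fun b => if a ≠ b then _ else _) ha]
  simp only [ne_eq, not_true_eq_false, if_false, zero_add]
  rw [add_comm]
  congr 1
  refine Finset.sum_congr rfl fun b hb => ?_
  rw [if_pos (Finset.mem_erase.1 hb).1.symm]

theorem sum_mul_sumTwo (y : ι → A) (f : ι → ι → A) : (∑ c ∈ I, y c) * sumTwo I f =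
    sumThree I (fun c a b => y c * f a b) + sumTwo I (fun a b => y a * f a b) +
      sumTwo I (fun a b => y b * f a b) := by
  have e1 : ∀ a b : ι, a ∈ I → b ∈ I → a ≠ b → (∑ c ∈ I, y c) * f a b =
      ∑ c ∈ I, (if c ≠ a ∧ c ≠ b ∧ a ≠ b then y c * f a b else 0) + (y a * f a b + y b * f a b) := by
    intro a b ha hb hab
    rw [Finset.sum_mul, ← Finset.add_sum_erase _ _ ha,
      ← Finset.add_sum_erase _ _ (Finset.mem_erase.2 ⟨hab.symm, hb⟩),
      ← Finset.add_sum_erase _ (fun c => if c ≠ a ∧ c ≠ b ∧ a ≠ b then _ else _) ha,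
      ← Finset.add_sum_erase _ (fun c => if c ≠ a ∧ c ≠ b ∧ a ≠ b then _ else _)
        (Finset.mem_erase.2 ⟨hab.symm, hb⟩),
      Finset.sum_congr rfl fun c hc => if_pos (c := c ≠ a ∧ c ≠ b ∧ a ≠ b)
        ⟨(Finset.mem_erase.1 (Finset.mem_erase.1 hc).2).1, (Finset.mem_erase.1 hc).1, hab⟩]
    simp
    abel
  rw [mul_sumTwo, sumTwo_congr fun a ha b hb hab => e1 a b ha hb hab, sumTwo_add, sumTwo_add,
    ← add_assoc]
  congr 2
  rw [← sumThree_rotate, ← sumThree_rotate]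
  refine Finset.sum_congr rfl fun a ha => Finset.sum_congr rfl fun b hb => ?_
  by_cases hab : a = b
  · simp [hab]
  · rw [if_pos hab]
    refine Finset.sum_congr rfl fun c hc => if_congr ?_ rfl rfl
    rw [ne_comm (a := c) (b := a), ne_comm (a := c) (b := b)]; tauto

/-- An antisymmetric family with the cyclic relations and the commutations of the Fomin–Kirillov
algebra. -/
structure CycRel (x : ι → ι → A) : Prop where
  anti : ∀ a b, x b a = - x a b
  comm : ∀ {a b c d}, a ≠ c → a ≠ d → b ≠ c → b ≠ d → x a b * x c d = x c d * x a b
  cyc : ∀ {a b c}, a ≠ b → b ≠ c → a ≠ c → x a b * x b c + x b c * x c a + x c a * x a b = 0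

variable (x : ι → ι → A) (L : Finset ι)

/-- `∑_{i ∈ L} x_{ai}`. -/
def lineSum (a : ι) : A := ∑ i ∈ L, x a i

/-- `∑_{i ∈ L} x_{ai} x_{bi}`. -/
def lineProd (a b : ι) : A := ∑ i ∈ L, x a i * x b i

/-- The part of `2 E_2` that belongs to two rows. -/
def linePair (a b : ι) : A := lineSum x L a * lineSum x L b + lineProd x L b a

/-- The part of `6 E_3` that belongs to three rows. -/
def lineTriple (a b c : ι) : A :=
  lineSum x L a * lineSum x L b * lineSum x L c + lineProd x L b a * lineSum x L c +
    lineSum x L a * lineProd x L c b + ∑ i ∈ L, x c i * lineSum x L b * x a i +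
    ∑ i ∈ L, (x b i * x c i * x a i + x c i * x a i * x b i)

variable {x L}

theorem lineSum_insert {m : ι} (hm : m ∉ L) (a : ι) :
    lineSum x (insert m L) a = x a m + lineSum x L a := Finset.sum_insert hm

theorem lineProd_insert {m : ι} (hm : m ∉ L) (a b : ι) :
    lineProd x (insert m L) a b = x a m * x b m + lineProd x L a b := Finset.sum_insert hm

section

variable (h : CycRel x)
include h

theorem CycRel.tri {a b m : ι} (hab : a ≠ b) (ham : a ≠ m) (hbm : b ≠ m) :
    x a m * x b m = x b m * x a b - x a b * x a m := by
  have h1 := h.cyc hbm.symm hab.symm ham.symm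
  rw [h.anti b m, h.anti a b] at h1
  simp only [neg_mul, mul_neg, neg_neg] at h1
  rw [← sub_eq_zero, ← neg_eq_zero, ← h1]
  abel

theorem CycRel.tri_line {a m i : ι} (ham : a ≠ m) (hai : a ≠ i) (hmi : m ≠ i) :
    x m i * x a m = x a i * x m i + x a m * x a i := by
  have h1 := h.cyc hmi.symm ham.symm hai.symm
  rw [h.anti m i, h.anti a m] at h1
  simp only [neg_mul, mul_neg, neg_neg] at h1
  rw [← sub_eq_zero, ← h1]
  abel

theorem CycRel.lineSum_commute {a b m : ι} (hab : a ≠ b) (ham : a ≠ m) (hb : b ∉ L) (hm : m ∉ L) :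
    lineSum x L a * x b m = x b m * lineSum x L a := by
  rw [lineSum, Finset.sum_mul, Finset.mul_sum]
  exact Finset.sum_congr rfl fun i hi => h.comm hab ham
    (fun e => hb (e ▸ hi)) (fun e => hm (e ▸ hi))

/-- The index m is about to change from a column to a row. Its line sum passes the old entry x_{am}
term by term through the triangle relation. -/
theorem CycRel.lineSum_mul_anchor {a m : ι} (ham : a ≠ m) (ha : a ∉ L) (hm : m ∉ L) :
    lineSum x L m * x a m = lineProd x L a m + x a m * lineSum x L a := by
  rw [lineSum, lineProd, lineSum, Finset.sum_mul, Finset.mul_sum, ← Finset.sum_add_distrib]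
  exact Finset.sum_congr rfl fun i hi => h.tri_line ham
    (fun e => ha (e ▸ hi)) (fun e => hm (e ▸ hi))

theorem CycRel.lineSum_swap {a b : ι} (hab : a ≠ b) (ha : a ∉ L) (hb : b ∉ L) :
    lineSum x L b * lineSum x L a =
      lineSum x L a * lineSum x L b + lineProd x L b a - lineProd x L a b := by
  have key : ∀ i ∈ L, x b i * lineSum x L a =
      lineSum x L a * x b i + x b i * x a i - x a i * x b i := by
    intro i hi
    rw [lineSum, ← Finset.add_sum_erase _ _ hi, mul_add, add_mul, Finset.mul_sum, Finset.sum_mul]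
    rw [Finset.sum_congr rfl fun j hj => h.comm (a := b) (b := i) (c := a) (d := j) hab.symm
      (fun e => hb (e ▸ (Finset.mem_erase.1 hj).2)) (fun e => ha (e ▸ hi))
      (Finset.mem_erase.1 hj).1.symm]
    abel
  conv_lhs => rw [lineSum, Finset.sum_mul, Finset.sum_congr rfl key]
  rw [Finset.sum_sub_distrib, Finset.sum_add_distrib, ← Finset.mul_sum]
  rfl

theorem CycRel.linePair_comm {a b : ι} (hab : a ≠ b) (ha : a ∉ L) (hb : b ∉ L) :
    linePair x L a b = linePair x L b a := by
  rw [linePair, linePair, h.lineSum_swap hab ha hb]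
  abel

theorem CycRel.mul_lineSum_mul {a b c : ι} (hac : a ≠ c) (ha : a ∉ L) (hc : c ∉ L) :
    ∑ i ∈ L, x b i * lineSum x L a * x c i =
      lineProd x L b c * lineSum x L a + ∑ i ∈ L, x b i * x a i * x c i -
        ∑ i ∈ L, x b i * x c i * x a i := by
  rw [lineProd, Finset.sum_mul, ← Finset.sum_add_distrib, ← Finset.sum_sub_distrib]
  refine Finset.sum_congr rfl fun i hi => ?_
  rw [mul_assoc, mul_assoc (x b i) (x c i), mul_assoc (x b i), mul_assoc (x b i), ← mul_add,
    ← mul_sub]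
  congr 1
  rw [lineSum, ← Finset.add_sum_erase _ _ hi, mul_add, add_mul, Finset.mul_sum, Finset.sum_mul]
  rw [Finset.sum_congr rfl fun j hj => h.comm (a := a) (b := j) (c := c) (d := i) hac
    (fun e => ha (e ▸ hi)) (fun e => hc (e ▸ (Finset.mem_erase.1 hj).2))
    (Finset.mem_erase.1 hj).1]
  abel

theorem CycRel.anchor_pair {a b m : ι} (hab : a ≠ b) (ham : a ≠ m) (hbm : b ≠ m) (ha : a ∉ L)
    (hb : b ∉ L) (hm : m ∉ L) : lineSum x L m * (x a m * x b m) =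
      ∑ i ∈ L, x a i * x b i * x m i + x b m * lineProd x L a b + x a m * x b m * lineSum x L a := by
  rw [← mul_assoc, h.lineSum_mul_anchor ham ha hm, add_mul, mul_assoc (x a m),
    h.lineSum_commute hab ham hb hm, ← mul_assoc]
  congr 1
  rw [lineProd, lineProd, Finset.sum_mul, Finset.mul_sum, ← Finset.sum_add_distrib]
  refine Finset.sum_congr rfl fun i hi => ?_
  have h1 : i ≠ a := fun e => ha (e ▸ hi)
  have h2 : i ≠ b := fun e => hb (e ▸ hi)
  have h3 : i ≠ m := fun e => hm (e ▸ hi)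
  rw [mul_assoc, h.tri_line hbm h2.symm h3.symm, mul_add, ← mul_assoc, ← mul_assoc (x a i),
    h.comm hab ham h2 h3, mul_assoc (x b m)]

/-- The right side is `lineSum x L m` times the pair sum that has m as an additional column. Moving
this line sum to the right past the entries in column m creates the triples in which m is a row. -/
theorem CycRel.pair_identity {a b m : ι} (hab : a ≠ b) (ham : a ≠ m) (hbm : b ≠ m) (ha : a ∉ L)
    (hb : b ∉ L) (hm : m ∉ L) :
    lineTriple x L m a b + x a m * linePair x L a b + x b m * linePair x L a b +
        x b m * (x a m * lineSum x L b) + x a m * (x b m * lineSum x L a) =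
      lineSum x L m * linePair x L a b + lineSum x L m * (x a m * lineSum x L b) +
        lineSum x L m * (x b m * lineSum x L a) + lineSum x L m * (x a m * x b m) +
          lineSum x L m * (x b m * x a m) := by
  rw [h.anchor_pair hab ham hbm ha hb hm, h.anchor_pair hab.symm hbm ham hb ha hm,
    ← mul_assoc (lineSum x L m) (x a m), ← mul_assoc (lineSum x L m) (x b m),
    h.lineSum_mul_anchor ham ha hm, h.lineSum_mul_anchor hbm hb hm, lineTriple,
    h.mul_lineSum_mul ham ha hm, Finset.sum_add_distrib]
  simp only [linePair, mul_add, add_mul, mul_assoc, h.lineSum_swap hab ha hb, mul_sub]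
  abel

theorem CycRel.linePair_insert {a b m : ι} (hab : a ≠ b) (ham : a ≠ m) (hb : b ∉ L) (hm : m ∉ L) :
    linePair x (insert m L) a b = linePair x L a b + x b m * lineSum x L a +
      x a m * lineSum x L b + x a m * x b m + x b m * x a m := by
  rw [linePair, linePair, lineSum_insert hm, lineSum_insert hm, lineProd_insert hm]
  simp only [mul_add, add_mul, h.lineSum_commute hab ham hb hm]
  abel

theorem CycRel.lineTriple_insert {a b c m : ι} (hab : a ≠ b) (hac : a ≠ c) (hbc : b ≠ c)
    (ham : a ≠ m) (hbm : b ≠ m) (hcm : c ≠ m) (ha : a ∉ L) (hb : b ∉ L) (hc : c ∉ L) (hm : m ∉ L) :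
    lineTriple x (insert m L) a b c = lineTriple x L a b c + x a m * linePair x L b c +
      x b m * linePair x L a c + x c m * linePair x L a b +
      (x a m * x b m + x b m * x a m) * lineSum x L c +
      (x b m * x c m + x c m * x b m) * lineSum x L a +
      (x a m * x c m + x c m * x a m) * lineSum x L b +
      (x a m * x b m * x c m + x b m * x a m * x c m + x a m * x c m * x b m +
        x c m * x b m * x a m + x b m * x c m * x a m + x c m * x a m * x b m) := by
  have e1 : ∑ i ∈ L, x c i * x b m * x a i = x b m * lineProd x L c a := by
    rw [lineProd, Finset.mul_sum]
    refine Finset.sum_congr rfl fun i hi => ?_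
    rw [h.comm hbc.symm hcm (fun e => hb (e ▸ hi)) (fun e => hm (e ▸ hi)), mul_assoc]
  have e2 : lineProd x L b a * x c m = x c m * lineProd x L b a := by
    rw [lineProd, Finset.mul_sum, Finset.sum_mul]
    refine Finset.sum_congr rfl fun i hi => ?_
    rw [mul_assoc, h.comm hac ham (fun e => hc (e ▸ hi)) (fun e => hm (e ▸ hi)), ← mul_assoc,
      h.comm hbc hbm (fun e => hc (e ▸ hi)) (fun e => hm (e ▸ hi)), mul_assoc]
  have ab := h.lineSum_commute hab ham hb hm
  have ac := h.lineSum_commute hac ham hc hm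
  have bc := h.lineSum_commute hbc hbm hc hm
  have ba := h.lineSum_commute hab.symm hbm ha hm
  have ac' : ∀ z, lineSum x L a * (x c m * z) = x c m * (lineSum x L a * z) := fun z => by
    rw [← mul_assoc, ac, mul_assoc]
  have e3 : ∑ i ∈ L, x c i * (x b m + lineSum x L b) * x a i =
      x b m * lineProd x L c a + ∑ i ∈ L, x c i * lineSum x L b * x a i := by
    rw [← e1, ← Finset.sum_add_distrib]
    exact Finset.sum_congr rfl fun i _ => by rw [mul_add, add_mul]
  rw [lineTriple, lineTriple, Finset.sum_insert hm, Finset.sum_insert hm, lineSum_insert hm,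
    lineSum_insert hm, lineSum_insert hm, lineProd_insert hm, lineProd_insert hm, e3]
  simp only [linePair, mul_add, add_mul, mul_assoc, ab, ac, bc, ac', ba, e2]
  abel

end

end Pieri

/-! ### Moving an index from the columns to the rows -/

section PieriStep

variable {ι A : Type} [DecidableEq ι] [Ring A] {x : ι → ι → A} {L I : Finset ι}

section

variable (h : CycRel x)
include h

theorem CycRel.lineSum_mul_entry {b c i : ι} (hbc : b ≠ c) (hb : b ∉ L) (hc : c ∉ L) (hi : i ∈ L) :
    lineSum x L b * x c i = x c i * lineSum x L b + x b i * x c i - x c i * x b i := by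
  rw [lineSum, ← Finset.add_sum_erase _ _ hi, mul_add, add_mul, Finset.mul_sum, Finset.sum_mul]
  rw [Finset.sum_congr rfl fun j hj => h.comm (a := b) (b := j) (c := c) (d := i) hbc
    (fun e => hb (e ▸ hi)) (fun e => hc (e ▸ (Finset.mem_erase.1 hj).2))
    (Finset.mem_erase.1 hj).1]
  abel

theorem CycRel.lineSum_mul_lineProd {a b c : ι} (hbc : b ≠ c) (hb : b ∉ L) (hc : c ∉ L) :
    lineSum x L b * lineProd x L c a = ∑ i ∈ L, x c i * lineSum x L b * x a i +
      ∑ i ∈ L, x b i * x c i * x a i - ∑ i ∈ L, x c i * x b i * x a i := by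
  rw [lineProd, Finset.mul_sum, ← Finset.sum_add_distrib, ← Finset.sum_sub_distrib]
  refine Finset.sum_congr rfl fun i hi => ?_
  rw [← mul_assoc, h.lineSum_mul_entry hbc hb hc hi, sub_mul, add_mul]

/-- The additional summands of `lineTriple` compensate the commutators of the line sums. This
symmetry allows the triples containing a given row to be collected with that row in front. -/
theorem CycRel.lineTriple_swap_left {a b c : ι} (hab : a ≠ b) (hac : a ≠ c) (hbc : b ≠ c)
    (ha : a ∉ L) (hb : b ∉ L) (hc : c ∉ L) : lineTriple x L b a c = lineTriple x L a b c := by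
  rw [lineTriple, lineTriple, h.lineSum_swap hab ha hb, h.lineSum_mul_lineProd hbc hb hc,
    h.lineSum_mul_lineProd hac ha hc]
  simp only [Finset.sum_add_distrib, add_mul, sub_mul]
  abel

theorem CycRel.lineTriple_swap_right {a b c : ι} (hab : a ≠ b) (hac : a ≠ c) (hbc : b ≠ c)
    (ha : a ∉ L) (hb : b ∉ L) (hc : c ∉ L) : lineTriple x L a c b = lineTriple x L a b c := by
  have e1 := h.mul_lineSum_mul (a := b) (b := c) (c := a) hab.symm hb ha
  have e2 := h.mul_lineSum_mul (a := c) (b := b) (c := a) hac.symm hc ha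
  rw [lineTriple, lineTriple, mul_assoc, h.lineSum_swap hbc hb hc, e1, e2]
  simp only [Finset.sum_add_distrib, mul_add, mul_sub, mul_assoc]
  abel

variable {m : ι} (hI : m ∉ I) (hL : m ∉ L) (hIL : ∀ a ∈ I, a ∉ L)
include hI hL hIL

omit h hIL in
theorem sum_lineSum_insert : ∑ a ∈ insert m I, lineSum x L a =
    ∑ a ∈ I, lineSum x (insert m L) a + (lineSum x L m - ∑ a ∈ I, x a m) := by
  rw [Finset.sum_insert hI, Finset.sum_congr rfl fun a _ => lineSum_insert hL a,
    Finset.sum_add_distrib]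
  abel

theorem CycRel.sumTwo_linePair_insert_right : sumTwo I (linePair x (insert m L)) =
    sumTwo I (linePair x L) + 2 • sumTwo I (fun a b => x a m * lineSum x L b) +
      2 • sumTwo I (fun a b => x a m * x b m) := by
  have hm : ∀ a ∈ I, a ≠ m := fun a ha e => hI (e ▸ ha)
  rw [sumTwo_congr fun a ha b hb hab => h.linePair_insert hab (hm a ha) (hIL b hb) hL]
  simp only [sumTwo_add]
  rw [sumTwo_swap (fun a b => x a m * lineSum x L b), sumTwo_swap (fun a b => x a m * x b m)]
  abel

/-- This is twice the recursion E_2^{m+1} = E_2^m + θ E_1^m + q. If I consists of the smaller and L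
of the larger indices, the bracket is the Dunkl element and the squares give the parameter. -/
theorem CycRel.sumTwo_linePair_insert : sumTwo (insert m I) (linePair x L) =
    sumTwo I (linePair x (insert m L)) +
      2 • ((lineSum x L m - ∑ a ∈ I, x a m) * ∑ a ∈ I, lineSum x (insert m L) a) +
      2 • ∑ a ∈ I, x a m * x a m := by
  have hm : ∀ a ∈ I, a ≠ m := fun a ha e => hI (e ▸ ha)
  rw [sumTwo_insert hI, h.sumTwo_linePair_insert_right hI hL hIL,
    Finset.sum_congr rfl fun a ha => by
      rw [h.linePair_comm (hm a ha) (hIL a ha) hL, ← two_nsmul], ← Finset.smul_sum,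
    Finset.sum_congr (g := fun a => x a m + lineSum x L a) rfl fun a _ => lineSum_insert hL a,
    Finset.sum_add_distrib, mul_add, sub_mul, sub_mul, sum_mul_sum_eq, sum_mul_sum_eq]
  have e : lineSum x L m * ∑ a ∈ I, x a m =
      ∑ a ∈ I, lineProd x L a m + ∑ a ∈ I, x a m * lineSum x L a := by
    rw [Finset.mul_sum, ← Finset.sum_add_distrib]
    exact Finset.sum_congr rfl fun a ha => h.lineSum_mul_anchor (hm a ha) (hIL a ha) hL
  simp only [e, linePair, Finset.sum_add_distrib, ← Finset.mul_sum]
  simp only [two_nsmul]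
  abel

theorem CycRel.sumThree_lineTriple_insert_right : sumThree I (lineTriple x (insert m L)) =
    sumThree I (lineTriple x L) + 3 • sumThree I (fun c a b => x c m * linePair x L a b) +
      6 • sumThree I (fun a b c => x a m * x b m * lineSum x L c) +
      6 • sumThree I (fun a b c => x a m * x b m * x c m) := by
  have hm : ∀ a ∈ I, a ≠ m := fun a ha e => hI (e ▸ ha)
  rw [sumThree_congr fun a ha b hb c hc hab hac hbc => h.lineTriple_insert hab hac hbc (hm a ha)
    (hm b hb) (hm c hc) (hIL a ha) (hIL b hb) (hIL c hc) hL]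
  simp only [sumThree_add, add_mul]
  have g1 : sumThree I (fun a b c => x b m * linePair x L a c) =
      sumThree I (fun c a b => x c m * linePair x L a b) :=
    sumThree_swap_left (fun c a b => x c m * linePair x L a b)
  have g2 : sumThree I (fun a b c => x c m * linePair x L a b) =
      sumThree I (fun c a b => x c m * linePair x L a b) := by
    rw [← g1]; exact sumThree_swap_right (fun a b c => x b m * linePair x L a c)
  have k1 : sumThree I (fun a b c => x b m * x a m * lineSum x L c) =
      sumThree I (fun a b c => x a m * x b m * lineSum x L c) :=
    sumThree_swap_left (fun a b c => x a m * x b m * lineSum x L c)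
  have k2 : sumThree I (fun a b c => x b m * x c m * lineSum x L a) =
      sumThree I (fun a b c => x a m * x b m * lineSum x L c) :=
    sumThree_rotate (fun a b c => x a m * x b m * lineSum x L c)
  have k3 : sumThree I (fun a b c => x a m * x c m * lineSum x L b) =
      sumThree I (fun a b c => x a m * x b m * lineSum x L c) :=
    sumThree_swap_right (fun a b c => x a m * x b m * lineSum x L c)
  have k4 : sumThree I (fun a b c => x c m * x a m * lineSum x L b) =
      sumThree I (fun a b c => x a m * x b m * lineSum x L c) := by
    rw [← k1]; exact sumThree_swap_right (fun a b c => x b m * x a m * lineSum x L c)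
  have k5 : sumThree I (fun a b c => x c m * x b m * lineSum x L a) =
      sumThree I (fun a b c => x a m * x b m * lineSum x L c) := by
    rw [← k2]; exact sumThree_swap_right (fun a b c => x b m * x c m * lineSum x L a)
  have t1 : sumThree I (fun a b c => x b m * x a m * x c m) =
      sumThree I (fun a b c => x a m * x b m * x c m) :=
    sumThree_swap_left (fun a b c => x a m * x b m * x c m)
  have t2 : sumThree I (fun a b c => x b m * x c m * x a m) =
      sumThree I (fun a b c => x a m * x b m * x c m) :=
    sumThree_rotate (fun a b c => x a m * x b m * x c m)
  have t3 : sumThree I (fun a b c => x a m * x c m * x b m) =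
      sumThree I (fun a b c => x a m * x b m * x c m) :=
    sumThree_swap_right (fun a b c => x a m * x b m * x c m)
  have t4 : sumThree I (fun a b c => x c m * x a m * x b m) =
      sumThree I (fun a b c => x a m * x b m * x c m) := by
    rw [← t1]; exact sumThree_swap_right (fun a b c => x b m * x a m * x c m)
  have t5 : sumThree I (fun a b c => x c m * x b m * x a m) =
      sumThree I (fun a b c => x a m * x b m * x c m) := by
    rw [← t2]; exact sumThree_swap_right (fun a b c => x b m * x c m * x a m)
  rw [g1, g2, k1, k2, k3, k4, k5, t1, t2, t3, t4, t5]
  abel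

theorem CycRel.sumThree_lineTriple_insert_left : sumThree (insert m I) (lineTriple x L) =
    sumThree I (lineTriple x L) + 3 • sumTwo I (lineTriple x L m) := by
  have hm : ∀ a ∈ I, a ≠ m := fun a ha e => hI (e ▸ ha)
  rw [sumThree_insert hI, sumTwo_congr (g := fun a b => lineTriple x L m a b +
    lineTriple x L m a b + lineTriple x L m a b), sumTwo_add, sumTwo_add]
  · abel
  · intro a ha b hb hab
    rw [← h.lineTriple_swap_right hab (hm a ha) (hm b hb) (hIL a ha) (hIL b hb) hL,
      ← h.lineTriple_swap_left (hm a ha) hab (hm b hb).symm (hIL a ha) hL (hIL b hb)]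

omit hIL hL in
-- The triangle relation is applied to the last two letters and to the first two. The leftover words
-- have opposite signs after exchanging a and b, and averaging without division explains the factor
-- 2.
theorem CycRel.sumTwo_anchor (hcent : ∀ a ∈ I, ∀ z, Commute (x a m * x a m) z) :
    2 • sumTwo I (fun a b => x b m * x a m * x b m) =
      2 • sumTwo I (fun a b => x a m * x a m * x b a) := by
  have hm : ∀ a ∈ I, a ≠ m := fun a ha e => hI (e ▸ ha)
  have e1 : sumTwo I (fun a b => x b m * x a m * x b m) =
      sumTwo I (fun a b => x b m * x b m * x a b) - sumTwo I (fun a b => x b m * x a b * x a m) := by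
    rw [← sumTwo_sub]
    refine sumTwo_congr fun a ha b hb hab => ?_
    rw [mul_assoc, h.tri hab (hm a ha) (hm b hb), mul_sub, mul_assoc, mul_assoc]
  have e2 : sumTwo I (fun a b => x b m * x a m * x b m) =
      sumTwo I (fun a b => x b m * x b m * x a b) + sumTwo I (fun a b => x b m * x a b * x a m) := by
    rw [← sumTwo_swap (fun a b => x b m * x a b * x a m), ← sumTwo_add]
    refine sumTwo_congr fun a ha b hb hab => ?_
    rw [h.tri hab.symm (hm b hb) (hm a ha), sub_mul, h.anti a b, mul_assoc (- x a b),
      neg_mul, (hcent b hb (x a b)).eq]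
    abel
  rw [two_nsmul]
  nth_rw 1 [e1]
  rw [e2, ← sumTwo_swap (fun a b => x b m * x b m * x a b)]
  abel

/-- This is six times the recursion E_3^{m+1} = E_3^m + θ E_2^m + q E_1^{m-1}. The last sum becomes
the q-term once only one square survives. -/
theorem CycRel.sumThree_lineTriple_insert (hcent : ∀ a ∈ I, ∀ z, Commute (x a m * x a m) z) :
    sumThree (insert m I) (lineTriple x L) = sumThree I (lineTriple x (insert m L)) +
      3 • ((lineSum x L m - ∑ a ∈ I, x a m) * sumTwo I (linePair x (insert m L))) +
      6 • sumTwo I (fun a b => x a m * x a m * (lineSum x L b + x b m + x b a)) := by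
  have hm : ∀ a ∈ I, a ≠ m := fun a ha e => hI (e ▸ ha)
  -- `pair_identity` summed over all pairs, with equal sums collected by exchanging a and b.
  have key : sumTwo I (lineTriple x L m) + sumTwo I (fun a b => x a m * linePair x L a b) +
      sumTwo I (fun a b => x b m * linePair x L a b) +
      2 • sumTwo I (fun a b => x b m * (x a m * lineSum x L b)) =
      lineSum x L m * sumTwo I (linePair x L) +
      2 • (lineSum x L m * sumTwo I fun a b => x a m * lineSum x L b) +
      2 • (lineSum x L m * sumTwo I fun a b => x a m * x b m) := by
    have := sumTwo_congr (I := I) fun a ha b hb hab =>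
      h.pair_identity hab (hm a ha) (hm b hb) (hIL a ha) (hIL b hb) hL
    simp only [sumTwo_add, ← mul_sumTwo] at this
    rw [sumTwo_swap (fun a b => x b m * (x a m * lineSum x L b)),
      sumTwo_swap (fun a b => x a m * lineSum x L b), sumTwo_swap (fun a b => x a m * x b m)] at this
    rw [two_nsmul, two_nsmul, two_nsmul]
    simp only [← add_assoc]
    exact this
  have anch := h.sumTwo_anchor hI hcent
  rw [h.sumThree_lineTriple_insert_left hI hL hIL, h.sumThree_lineTriple_insert_right hI hL hIL,
    h.sumTwo_linePair_insert_right hI hL hIL, sub_mul, mul_add, mul_add, mul_add, mul_add,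
    mul_smul_comm, mul_smul_comm, mul_smul_comm, mul_smul_comm, sum_mul_sumTwo, sum_mul_sumTwo,
    sum_mul_sumTwo]
  simp only [mul_add, sumTwo_add]
  simp only [← mul_assoc] at key anch ⊢
  linear_combination (norm := module) (3 : ℤ) • key + (3 : ℤ) • anch

end

end PieriStep

/-! ### The elementary polynomials at the Dunkl elements as sums of words -/

section ElemRec

variable {S : Type} [CommRing S] {n : ℕ} {q : Fin (n - 1) → S}

theorem cycRel_sgen (p : Fin n → Fin n → S) : CycRel (sgen p) where
  anti a b := sgen_neg p a b
  comm h1 h2 h3 h4 := (sgen_comm p h1 h2 h3 h4).eq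
  cyc h1 h2 h3 := sgen_cyc p h1 h2 h3

theorem sgen_of_lt (p : Fin n → Fin n → S) {i j : Fin n} (h : i < j) : sgen p i j = gen p i j := by
  rw [sgen, gen_zero p h.not_gt, sub_zero]

theorem sgen_self (p : Fin n → Fin n → S) (i : Fin n) : sgen p i i = 0 := sub_self _

theorem gen_sq (p : Fin n → Fin n → S) {i j : Fin n} (h : i < j) :
    gen p i j * gen p i j = algebraMap S _ (p i j) := by
  rw [gen_eq p h, ← map_mul]
  exact (RingQuot.mkAlgHom_rel S (Rel.square h)).trans (AlgHom.commutes _ _)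

/-- The indices below `m`. -/
def below (n m : ℕ) : Finset (Fin n) := Finset.univ.filter fun a => a.val < m

/-- The indices from `m` on. -/
def above (n m : ℕ) : Finset (Fin n) := Finset.univ.filter fun a => m ≤ a.val

theorem mem_below {m : ℕ} {a : Fin n} : a ∈ below n m ↔ a.val < m := by simp [below]
theorem mem_above {m : ℕ} {a : Fin n} : a ∈ above n m ↔ m ≤ a.val := by simp [above]

theorem below_succ {m : ℕ} (hm : m < n) : below n (m + 1) = insert ⟨m, hm⟩ (below n m) := by
  ext a
  simp only [Finset.mem_insert, mem_below, Fin.ext_iff]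
  omega

theorem above_eq_insert {m : ℕ} (hm : m < n) : above n m = insert ⟨m, hm⟩ (above n (m + 1)) := by
  ext a
  simp only [Finset.mem_insert, mem_above, Fin.ext_iff]
  omega

theorem below_zero : below n 0 = ∅ := by ext a; simp [mem_below]

theorem dunkl_eq_sub (p : Fin n → Fin n → S) {m : ℕ} (hm : m < n) : dunkl p ⟨m, hm⟩ =
    lineSum (sgen p) (above n (m + 1)) ⟨m, hm⟩ - ∑ a ∈ below n m, sgen p a ⟨m, hm⟩ := by
  have h1 : (Finset.univ : Finset (Fin n)) =
      insert ⟨m, hm⟩ (above n (m + 1)) ∪ below n m := by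
    ext a
    simp only [Finset.mem_univ, Finset.mem_union, Finset.mem_insert, mem_above, mem_below,
      Fin.ext_iff, true_iff]
    omega
  rw [dunkl_eq, h1, Finset.sum_union, Finset.sum_insert (by simp [mem_above]), sgen_self, zero_add,
    sub_eq_add_neg, ← Finset.sum_neg_distrib]
  · congr 1
    exact Finset.sum_congr rfl fun a _ => sgen_neg p _ _
  · rw [Finset.disjoint_left]
    intro a ha hb
    simp only [Finset.mem_insert, mem_above, mem_below, Fin.ext_iff] at ha hb
    omega

variable (q) in
/-- The recursion of the quantum elementary polynomials, at the Dunkl elements. -/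
structure ElemRec (E : ℕ → ℕ → FKAlgebra S (qParam (n := n) q)) : Prop where
  zero_right : ∀ m, E m 0 = 1
  zero_left : ∀ i, E 0 (i + 1) = 0
  one_left : ∀ i, E 1 (i + 2) = 0
  succ_one : ∀ m (hm : m < n), E (m + 1) 1 = E m 1 + dunkl (qParam q) ⟨m, hm⟩
  succ_succ : ∀ m i (hm : m + 1 < n), E (m + 2) (i + 2) = E (m + 1) (i + 2) +
    dunkl (qParam q) ⟨m + 1, hm⟩ * E (m + 1) (i + 1) + q ⟨m, by omega⟩ • E m i

/-- Among the squares in the column m + 1 only the one with the neighbouring row m has a nonzero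
parameter. -/
theorem sum_below_sgen_sq {m : ℕ} (hm : m + 1 < n) (f : Fin n → FKAlgebra S (qParam (n := n) q)) :
    ∑ a ∈ below n (m + 1), sgen (qParam q) a ⟨m + 1, hm⟩ * sgen (qParam q) a ⟨m + 1, hm⟩ * f a =
      q ⟨m, by omega⟩ • f ⟨m, by omega⟩ := by
  have h1 : ∀ a ∈ below n (m + 1),
      sgen (qParam q) a ⟨m + 1, hm⟩ * sgen (qParam q) a ⟨m + 1, hm⟩ =
        algebraMap S (FKAlgebra S (qParam (n := n) q)) (qParam q a ⟨m + 1, hm⟩) := by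
    intro a ha
    have : a < ⟨m + 1, hm⟩ := mem_below.1 ha
    rw [sgen_of_lt _ this, gen_sq _ this]
  rw [Finset.sum_congr rfl fun a ha => by rw [h1 a ha],
    Finset.sum_eq_single_of_mem (⟨m, by omega⟩ : Fin n) (mem_below.2 (Nat.lt_succ_self m))]
  · rw [qParam, dif_pos rfl, Algebra.smul_def]
  · intro a _ hne
    rw [qParam, dif_neg, map_zero, zero_mul]
    rw [ne_eq, Fin.ext_iff] at hne
    simp only at hne ⊢
    omega

namespace ElemRec

variable {E : ℕ → ℕ → FKAlgebra S (qParam (n := n) q)} (hE : ElemRec q E)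
include hE

theorem eq_sum_lineSum {m : ℕ} (hm : m ≤ n) :
    E m 1 = ∑ a ∈ below n m, lineSum (sgen (qParam q)) (above n m) a := by
  induction m with
  | zero => rw [below_zero, Finset.sum_empty, hE.zero_left]
  | succ m ih =>
    rw [hE.succ_one m hm, ih (by omega), below_succ hm, sum_lineSum_insert, ← above_eq_insert,
      ← dunkl_eq_sub]
    · simp [mem_below]
    · simp [mem_above]

theorem eq_sumTwo {m : ℕ} (hm : m ≤ n) :
    2 • E m 2 = sumTwo (below n m) (linePair (sgen (qParam q)) (above n m)) := by
  induction m with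
  | zero => rw [below_zero, hE.zero_left, sumTwo, Finset.sum_empty, smul_zero]
  | succ m ih =>
    rw [below_succ hm, (cycRel_sgen _).sumTwo_linePair_insert, ← above_eq_insert, ← dunkl_eq_sub,
      ← ih (by omega), ← hE.eq_sum_lineSum (by omega)]
    · cases m with
      | zero => simp [hE.one_left, hE.zero_left, below_zero]
      | succ m =>
        have h1 := sum_below_sgen_sq (q := q) hm (fun _ => 1)
        simp only [mul_one] at h1
        rw [h1, hE.succ_succ m 0 hm, hE.zero_right, smul_add, smul_add]
    · simp [mem_below]
    · simp [mem_above]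
    · intro a h1 h2
      rw [mem_below] at h1; rw [mem_above] at h2; omega

/-- The columns m and m + 1 are split off from E_1^m, which is the shape in which the correction of
`sumThree_lineTriple_insert` appears. -/
theorem eq_sum_lineSum_add {m : ℕ} (hm : m + 1 < n) :
    E m 1 = ∑ b ∈ below n m, (lineSum (sgen (qParam q)) (above n (m + 2)) b +
      sgen (qParam q) b ⟨m + 1, hm⟩ + sgen (qParam q) b ⟨m, by omega⟩) := by
  rw [hE.eq_sum_lineSum (by omega), above_eq_insert (m := m) (by omega), above_eq_insert hm]
  refine Finset.sum_congr rfl fun b _ => ?_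
  rw [lineSum_insert, lineSum_insert]
  · abel
  · simp [mem_above]
  · simp [mem_above]

theorem eq_sumThree {m : ℕ} (hm : m ≤ n) :
    6 • E m 3 = sumThree (below n m) (lineTriple (sgen (qParam q)) (above n m)) := by
  induction m with
  | zero => rw [below_zero, hE.zero_left, sumThree, Finset.sum_empty, smul_zero]
  | succ m ih =>
    rw [below_succ hm, (cycRel_sgen _).sumThree_lineTriple_insert, ← above_eq_insert,
      ← dunkl_eq_sub, ← ih (by omega), ← hE.eq_sumTwo (by omega)]
    · cases m with
      | zero => simp [hE.one_left, hE.zero_left, below_zero, sumTwo]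
      | succ m =>
        -- The condition a ≠ b is kept inside the inner sum, so that the surviving square fixes a =
        -- m and leaves the rows below m.
        have h1 := sum_below_sgen_sq (q := q) hm fun a => ∑ b ∈ below n (m + 1),
          if a ≠ b then (lineSum (sgen (qParam q)) (above n (m + 2)) b +
            sgen (qParam q) b ⟨m + 1, hm⟩ + sgen (qParam q) b a) else 0
        simp only [Finset.mul_sum, mul_ite, mul_zero] at h1
        rw [sumTwo, h1, below_succ (by omega), Finset.sum_insert (by simp [mem_below]),
          if_neg (by simp), zero_add, Finset.sum_congr rfl fun b hb => if_pos ?_,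
          ← hE.eq_sum_lineSum_add, hE.succ_succ m 1 hm]
        · rw [mul_smul_comm, smul_smul, smul_add, smul_add]
          rfl
        · rintro rfl
          simp [mem_below] at hb
    · simp [mem_below]
    · simp [mem_above]
    · intro a h1 h2
      rw [mem_below] at h1; rw [mem_above] at h2; omega
    · intro a ha z
      have : a < ⟨m, hm⟩ := mem_below.1 ha
      rw [sgen_of_lt _ this, gen_sq _ this]
      exact Algebra.commutes _ _

end ElemRec

end ElemRec

/-! ### The expansion of E_2^k E_2^{k+1} - E_1^k E_3^{k+1} -/

section BoxExpansion

variable {S : Type} [CommRing S] {n : ℕ}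

/-- The generators `x_{ij}` with `i` below and `j` above `k`. -/
def boxGen (p : Fin n → Fin n → S) (k : ℕ) (a : {a : Fin n // a.val < k})
    (i : {i : Fin n // k ≤ i.val}) : FKAlgebra S p := sgen p a i

theorem boxGen_eq (p : Fin n → Fin n → S) {k : ℕ} (a : {a : Fin n // a.val < k})
    (i : {i : Fin n // k ≤ i.val}) : boxGen p k a i = gen p a i :=
  sgen_of_lt p (Fin.lt_def.2 (lt_of_lt_of_le a.2 i.2))

/-- Rows lie below k and columns do not, so row and column indices never coincide. The only
generator of the box that joins neighbouring indices is x_{k,k+1}, hence products of different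
squares vanish. -/
theorem boxRel_boxGen (q : Fin (n - 1) → S) (k : ℕ) :
    BoxRel (boxGen (qParam (n := n) q) k) (fun a b => sgen (qParam q) a b)
      (fun a i => algebraMap S _ (qParam q a i)) where
  comm_x {a b i j} hab hij := (sgen_comm _ (mt Subtype.ext hab)
    (fun h => absurd a.2 (h ▸ not_lt.2 j.2)) (fun h => absurd b.2 (h ▸ not_lt.2 i.2))
    (mt Subtype.ext hij)).eq
  anti a b := sgen_neg _ _ _
  comm_e {a b c} i hca hcb := (sgen_comm _ (mt Subtype.ext hca.symm)
    (fun h => absurd a.2 (h ▸ not_lt.2 i.2)) (mt Subtype.ext hcb.symm)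
    (fun h => absurd b.2 (h ▸ not_lt.2 i.2))).eq
  tri {a b} i hab := (cycRel_sgen _).tri (mt Subtype.ext hab)
    (fun h => absurd a.2 (h ▸ not_lt.2 i.2)) (fun h => absurd b.2 (h ▸ not_lt.2 i.2))
  sq a i := by
    rw [boxGen_eq, gen_sq _ (Fin.lt_def.2 (lt_of_lt_of_le a.2 i.2))]
  central a i y := Algebra.commutes _ _
  ortho {a b i j} h := by
    rw [← map_mul]
    by_cases h1 : a.1.val + 1 = i.1.val
    · by_cases h2 : b.1.val + 1 = j.1.val
      · exfalso
        have := a.2; have := i.2; have := b.2; have := j.2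
        rcases h with h | h <;> refine h (Subtype.ext (Fin.ext ?_)) <;> omega
      · rw [qParam.eq_1 q b.1 j.1, dif_neg h2, mul_zero, map_zero]
    · rw [qParam.eq_1 q a.1 i.1, dif_neg h1, zero_mul, map_zero]

theorem rowSum_boxGen (p : Fin n → Fin n → S) {k : ℕ} (a : {a : Fin n // a.val < k}) :
    rowSum (boxGen p k) a = lineSum (sgen p) (above n k) a :=
  (Finset.sum_subtype _ (fun _ => mem_above) fun i => sgen p a i).symm

theorem rowProd_boxGen (p : Fin n → Fin n → S) {k : ℕ} (a b : {a : Fin n // a.val < k}) :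
    rowProd (boxGen p k) a b = lineProd (sgen p) (above n k) a b :=
  (Finset.sum_subtype _ (fun _ => mem_above) fun i => sgen p a i * sgen p b i).symm

theorem sum_rowSum_boxGen (p : Fin n → Fin n → S) (k : ℕ) : ∑ a, rowSum (boxGen p k) a =
    ∑ a ∈ below n k, lineSum (sgen p) (above n k) a := by
  simp only [rowSum_boxGen]
  exact (Finset.sum_subtype _ (fun _ => mem_below) fun a => lineSum (sgen p) (above n k) a).symm

theorem offTwo_boxGen (p : Fin n → Fin n → S) (k : ℕ) : offTwo (pairSum (boxGen p k)) =
    sumTwo (below n k) (linePair (sgen p) (above n k)) := by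
  have e : ∀ a b, pairSum (boxGen p k) a b = linePair (sgen p) (above n k) a b := fun a b => by
    rw [pairSum, linePair, rowSum_boxGen, rowSum_boxGen, rowProd_boxGen]
  rw [offTwo_eq_ite, sumTwo, Finset.sum_subtype _ fun _ => mem_below]
  refine Finset.sum_congr rfl fun a _ => ?_
  rw [Finset.sum_subtype _ fun _ => mem_below]
  refine Finset.sum_congr rfl fun b _ => ?_
  by_cases h : a = b
  · simp [h]
  · rw [if_neg h, if_pos (mt Subtype.ext h), e]

theorem offThree_boxGen (p : Fin n → Fin n → S) (k : ℕ) : offThree (tripleSum (boxGen p k)) =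
    sumThree (below n k) (lineTriple (sgen p) (above n k)) := by
  have e : ∀ a b c, tripleSum (boxGen p k) a b c = lineTriple (sgen p) (above n k) a b c := by
    intro a b c
    rw [tripleSum, lineTriple, rowSum_boxGen, rowSum_boxGen, rowSum_boxGen, rowProd_boxGen,
      rowProd_boxGen, Finset.sum_subtype _ fun _ => mem_above,
      Finset.sum_subtype (above n k) fun _ => mem_above]
    rfl
  rw [offThree_eq_ite, sumThree, Finset.sum_subtype _ fun _ => mem_below]
  refine Finset.sum_congr rfl fun a _ => ?_
  rw [Finset.sum_subtype _ fun _ => mem_below]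
  refine Finset.sum_congr rfl fun b _ => ?_
  rw [Finset.sum_subtype _ fun _ => mem_below]
  refine Finset.sum_congr rfl fun c _ => ?_
  by_cases h : a = b ∨ b = c ∨ a = c
  · rw [if_pos h, if_neg]
    rcases h with h | h | h <;> simp [h]
  · rw [if_neg h, if_pos, e]
    simp only [not_or] at h
    exact ⟨mt Subtype.ext h.1, mt Subtype.ext h.2.2, mt Subtype.ext h.2.1⟩

/-- Words as pairs of index sequences. -/
def wordEquiv (n k : ℕ) :
    (Fin 4 → {a : Fin n // a.val < k}) × (Fin 4 → {i : Fin n // k ≤ i.val}) ≃ Word n k where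
  toFun w t := ⟨(w.1 t, w.2 t), (w.1 t).2, (w.2 t).2⟩
  invFun u := (fun t => ⟨(u t).1.1, (u t).2.1⟩, fun t => ⟨(u t).1.2, (u t).2.2⟩)
  left_inv _ := rfl
  right_inv _ := rfl

theorem sum_word_eq_weightedSum (p : Fin n → Fin n → S) (k : ℕ) (f : EqMat → EqMat → ℤ) :
    ∑ u : Word n k, f (eqMat u.row) (eqMat u.col) • monomial p u = weightedSum (boxGen p k) f := by
  rw [weightedSum, ← Fintype.sum_prod_type', ← (wordEquiv n k).sum_comp]
  refine Finset.sum_congr rfl fun w _ => ?_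
  have e1 : eqMat (wordEquiv n k w).row = eqMat w.1 := by
    funext s t
    simp only [eqMat, Word.row, wordEquiv, Equiv.coe_fn_mk, Subtype.ext_iff]
    congr
  have e2 : eqMat (wordEquiv n k w).col = eqMat w.2 := by
    funext s t
    simp only [eqMat, Word.col, wordEquiv, Equiv.coe_fn_mk, Subtype.ext_iff]
    congr
  rw [e1, e2, monomial, wordProd]
  simp only [boxGen_eq]
  congr 1
  simp [List.ofFn_succ, mul_assoc, Word.row, Word.col, wordEquiv]

theorem prod_ofFn_swap {A : Type} [Ring A] (g : Fin 4 → A) {s t : Fin 4} (hst : s.val + 1 = t.val)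
    (h : g s * g t = g t * g s) :
    (List.ofFn g).prod = (List.ofFn fun i => g (Equiv.swap s t i)).prod := by
  have e : ∀ f : Fin 4 → A, (List.ofFn f).prod = f 0 * (f 1 * (f 2 * f 3)) := fun f => by
    simp [List.ofFn_succ]
  rw [e, e]
  have h3 : s = 0 ∧ t = 1 ∨ s = 1 ∧ t = 2 ∨ s = 2 ∧ t = 3 := by omega
  rcases h3 with ⟨rfl, rfl⟩ | ⟨rfl, rfl⟩ | ⟨rfl, rfl⟩
  · rw [← mul_assoc, h, mul_assoc]
    rfl
  · rw [← mul_assoc (g 1), h, mul_assoc]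
    rfl
  · rw [h]
    rfl

theorem monomial_commStep (p : Fin n → Fin n → S) {k : ℕ} {u v : Word n k} (h : CommStep u v) :
    monomial p u = monomial p v := by
  obtain ⟨s, t, hst, hrow, hcol, rfl⟩ := h
  have hc : gen p (u.row s) (u.col s) * gen p (u.row t) (u.col t) =
      gen p (u.row t) (u.col t) * gen p (u.row s) (u.col s) :=
    (gen_comm p hrow (fun h => absurd (u s).2.1 (not_lt.2 (le_of_le_of_eq (u t).2.2
      (congrArg Fin.val h).symm))) (fun h => absurd (u t).2.1 (not_lt.2 (le_of_le_of_eq (u s).2.2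
      (congrArg Fin.val h)))) hcol).eq
  exact prod_ofFn_swap (fun i => gen p (u.row i) (u.col i)) hst hc

/-- By `BoxRel.weightedSum_wordWeight` the class sum is 12 (E_2^k E_2^k - E_1^k E_3^k) plus 12 q_k
(E_2^k - E_1^k E_1^{k-1}). The recursion turns the left side into the same expression once the terms
containing the Dunkl element cancel. -/
theorem ElemRec.box_expansion {q : Fin (n - 1) → S} {E : ℕ → ℕ → FKAlgebra S (qParam (n := n) q)}
    (hE : ElemRec q E) (hcomm : ∀ m i m' i', Commute (E m i) (E m' i')) {k : ℕ} (hk : 2 ≤ k)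
    (hn : k + 2 ≤ n) :
    (12 : ℤ) • (E k 2 * E (k + 1) 2 - E k 1 * E (k + 1) 3) =
      (12 : ℤ) • classSum (fun u : Word n k => monomial (qParam q) u) := by
  rw [classSum_eq _ fun u v => monomial_commStep _,
    sum_word_eq_weightedSum (qParam (n := n) q) k wordWeight, (boxRel_boxGen q k).weightedSum_wordWeight,
    offTwo_boxGen, offThree_boxGen, sum_rowSum_boxGen, ← hE.eq_sum_lineSum (by omega),
    ← hE.eq_sumTwo (by omega), ← hE.eq_sumThree (by omega)]
  obtain ⟨m, rfl⟩ : ∃ m, k = m + 1 := ⟨k - 1, by omega⟩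
  have hm : m + 1 < n := by omega
  let a₀ : {a : Fin n // a.val < m + 1} := ⟨⟨m, by omega⟩, Nat.lt_succ_self m⟩
  let i₀ : {i : Fin n // m + 1 ≤ i.val} := ⟨⟨m + 1, hm⟩, le_rfl⟩
  -- Only the corner of the box with neighbouring indices has a nonzero parameter.
  have hq : ∀ f : {a : Fin n // a.val < m + 1} → FKAlgebra S (qParam (n := n) q),
      ∑ a, ∑ i : {i : Fin n // m + 1 ≤ i.val}, algebraMap S _ (qParam q a.1 i.1) * f a =
        q ⟨m, by omega⟩ • f a₀ := by
    intro f
    rw [Fintype.sum_eq_single a₀, Fintype.sum_eq_single i₀, qParam, dif_pos rfl, Algebra.smul_def]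
    · intro i hi
      rw [qParam, dif_neg, map_zero, zero_mul]
      intro h
      exact hi (Subtype.ext (Fin.ext h.symm))
    · intro a ha
      refine Finset.sum_eq_zero fun i _ => ?_
      rw [qParam, dif_neg, map_zero, zero_mul]
      intro h
      have h1 := a.2
      have h2 := i.2
      exact ha (Subtype.ext (Fin.ext (show a.1.val = m by omega)))
  -- Without the last row, and with that row's index counted among the columns, the line sums add up
  -- to E_1^{k-1}.
  have hE1 : ∑ c ∈ Finset.univ.erase a₀, (rowSum (boxGen (qParam q) (m + 1)) c +
      sgen (qParam q) c.1 a₀.1) = E m 1 := by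
    have h1 := Finset.add_sum_erase Finset.univ (fun c => rowSum (boxGen (qParam q) (m + 1)) c +
      sgen (qParam q) c.1 a₀.1) (Finset.mem_univ a₀)
    have h2 := Finset.sum_subtype (F := inferInstance) (below n (m + 1)) (fun _ => mem_below)
      fun c => lineSum (sgen (qParam q)) (above n (m + 1)) c + sgen (qParam q) c a₀.1
    simp only [rowSum_boxGen] at h1
    rw [← h2, below_succ (by omega), Finset.sum_insert (by simp [mem_below])] at h1
    simp only [rowSum_boxGen]
    rw [add_left_cancel h1, hE.eq_sum_lineSum (by omega), above_eq_insert (m := m) (by omega)]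
    refine Finset.sum_congr rfl fun b _ => ?_
    rw [lineSum_insert, add_comm]
    simp [mem_above]
  rw [hq, hE1, hE.succ_succ m 0 hm, hE.succ_succ m 1 hm, hE.zero_right]
  have hθ : dunkl (qParam q) ⟨m + 1, hm⟩ = E (m + 2) 1 - E (m + 1) 1 := by
    rw [hE.succ_one (m + 1) hm]; abel
  -- The Dunkl element is a difference of two E_1, so it commutes with everything here, and the two
  -- mixed terms agree.
  have h1 : E (m + 1) 2 * (dunkl (qParam q) ⟨m + 1, hm⟩ * E (m + 1) 1) =
      E (m + 1) 1 * (dunkl (qParam q) ⟨m + 1, hm⟩ * E (m + 1) 2) := by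
    have c1 : Commute (E (m + 1) 2) (dunkl (qParam q) ⟨m + 1, hm⟩) := by
      rw [hθ]; exact (hcomm _ _ _ _).sub_right (hcomm _ _ _ _)
    have c2 : Commute (E (m + 1) 1) (dunkl (qParam q) ⟨m + 1, hm⟩) := by
      rw [hθ]; exact (hcomm _ _ _ _).sub_right (hcomm _ _ _ _)
    rw [← mul_assoc, c1.eq, mul_assoc, (hcomm _ _ _ _).eq, ← mul_assoc, ← c2.eq, mul_assoc]
  simp only [zero_add, Nat.reduceAdd] at h1 ⊢
  simp only [mul_add, h1, mul_smul_comm, smul_mul_assoc, mul_one, smul_sub]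
  module

end BoxExpansion

/-! ### The classical and quantum expansions over the complex numbers -/

section Evaluation

theorem commute_evalHom_evalHom {R A : Type} [CommRing R] [Ring A] [Algebra R A] {m : ℕ}
    {θ : Fin m → A} (hθ : ∀ i j, Commute (θ i) (θ j)) (f g : MvPolynomial (Fin m) R) :
    Commute (evalHom θ hθ f) (evalHom θ hθ g) := by
  rw [Commute, SemiconjBy, ← map_mul, ← map_mul, mul_comm]

theorem eq_of_twelve_zsmul {K A : Type} [Field K] [CharZero K] [AddCommGroup A] [Module K A] {x y : A}
    (h : (12 : ℤ) • x = (12 : ℤ) • y) : x = y := by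
  have h1 : ∀ z : A, ((1 / 12 : K) * (12 : ℤ)) • z = z := fun z => by norm_num
  rw [← h1 x, ← h1 y, mul_smul, mul_smul, Int.cast_smul_eq_zsmul, Int.cast_smul_eq_zsmul, h]

variable (R : Type) [CommRing R] (n : ℕ)

theorem elemRec_elemSym : ElemRec (n := n) (0 : Fin (n - 1) → R) fun m i =>
    evalHom (dunkl (qParam 0)) (dunkl_commute _) (elemSym R n m i) where
  zero_right m := by rw [elemSym_zero, map_one]
  zero_left i := by rw [elemSym_of_lt (by omega), map_zero]
  one_left i := by rw [elemSym_of_lt (by omega), map_zero]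
  succ_one m hm := by rw [elemSym_succ hm, elemSym_zero, mul_one, map_add, evalHom_X]
  succ_succ m i hm := by
    rw [elemSym_succ hm, map_add, map_mul, evalHom_X, Pi.zero_apply, zero_smul, add_zero]

theorem elemRec_quantumElem : ElemRec (n := n) (MvPolynomial.X : Fin (n - 1) → QCoeff R n)
    fun m i => evalHom (dunkl (qParam MvPolynomial.X)) (dunkl_commute _) (quantumElem R n m i) where
  zero_right m := by rw [quantumElem, map_one]
  zero_left i := by rw [quantumElem, map_zero]
  one_left i := by rw [quantumElem, map_zero]
  succ_one m hm := by rw [quantumElem, map_add, xVar, dif_pos hm, evalHom_X]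
  succ_succ m i hm := by
    rw [quantumElem, map_add, map_add, map_mul, map_mul, xVar, dif_pos hm, evalHom_X, qVar,
      dif_pos (by omega), ← MvPolynomial.algebraMap_eq, AlgHom.commutes, Algebra.smul_def]

variable {n}

theorem evalHom_schubert_boxPerm [IsDomain R] (k : ℕ) (hk : 2 ≤ k) (hn : k + 2 ≤ n) :
    (12 : ℤ) • evalHom (dunkl (qParam (0 : Fin (n - 1) → R))) (dunkl_commute _)
        (schubert R (boxPerm n k hk hn)) =
      (12 : ℤ) • classSum fun u : Word n k => monomial (qParam (0 : Fin (n - 1) → R)) u := by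
  rw [← (elemRec_elemSym R n).box_expansion (fun _ _ _ _ => commute_evalHom_evalHom _ _ _) hk hn,
    (schubert_boxPerm k hk hn).1, map_sub, map_mul, map_mul]

theorem evalHom_quantumSchubert_boxPerm [IsDomain R] (k : ℕ) (hk : 2 ≤ k) (hn : k + 2 ≤ n) :
    (12 : ℤ) • evalHom (dunkl (qParam (MvPolynomial.X : Fin (n - 1) → QCoeff R n)))
        (dunkl_commute _) (quantumSchubert R (boxPerm n k hk hn)) =
      (12 : ℤ) • classSum fun u : Word n k =>
        monomial (qParam (MvPolynomial.X : Fin (n - 1) → QCoeff R n)) u := by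
  rw [← (elemRec_quantumElem R n).box_expansion (fun _ _ _ _ => commute_evalHom_evalHom _ _ _) hk hn,
    (schubert_boxPerm k hk hn).2, map_sub, map_mul, map_mul]

theorem classicalParam_eq (n : ℕ) : classicalParam n = qParam 0 := by
  funext i j
  simp [classicalParam, qParam]

theorem evalAt_schubert_boxPerm (n k : ℕ) (hk : 2 ≤ k) (hn : k + 2 ≤ n) :
    evalAt (dunkl (classicalParam n)) (schubert ℂ (boxPerm n k hk hn)) =
      classSum fun u : Word n k => monomial (classicalParam n) u := by
  rw [evalAt_eq (dunkl_commute _)]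
  apply eq_of_twelve_zsmul (K := ℂ)
  rw [classicalParam_eq]
  exact evalHom_schubert_boxPerm ℂ k hk hn

theorem evalAt_schur_boxShape (n k : ℕ) (hk : 2 ≤ k) (hn : k + 2 ≤ n) (hkn : k ≤ n) :
    evalAt (dunkl (classicalParam n)) (schubert ℂ (boxPerm n k hk hn)) =
      evalAt (fun i : Fin k => dunkl (classicalParam n) (Fin.castLE hkn i))
        (schur ℂ k boxShape) := by
  have hk' : k < n := by omega
  have h := evalHom_ext (R := ℂ) (fun i j => dunkl_commute (classicalParam n)
      (Fin.castLE hk'.le i) (Fin.castLE hk'.le j))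
    ((evalHom (dunkl (classicalParam n)) (dunkl_commute _)).comp
      (MvPolynomial.rename (Fin.castLE hk'.le))) (fun i => by simp)
  rw [evalAt_eq (dunkl_commute _), evalAt_eq (fun i j => dunkl_commute _ _ _), ← h,
    AlgHom.comp_apply, rename_schur_boxShape hk', (schubert_boxPerm k hk hn).1]

theorem evalAt_quantumSchubert_boxPerm (n k : ℕ) (hk : 2 ≤ k) (hn : k + 2 ≤ n) :
    evalAt (dunkl (quantumParam n)) (quantumSchubert ℂ (boxPerm n k hk hn)) =
      classSum fun u : Word n k => monomial (quantumParam n) u := by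
  rw [evalAt_eq (dunkl_commute _)]
  -- The constants of ℂ[q] make the quantum algebra a complex vector space, in which 12 can be
  -- cancelled.
  let : Module ℂ (FKAlgebra (QCoeff ℂ n) (quantumParam n)) :=
    Module.compHom _ (MvPolynomial.C : ℂ →+* QCoeff ℂ n)
  apply eq_of_twelve_zsmul (K := ℂ)
  exact evalHom_quantumSchubert_boxPerm ℂ k hk hn

end Evaluation

/-! ### Quantum elementary products span the quantum cohomology ring -/

section Spanning

variable {R : Type} [CommRing R] {n : ℕ}

theorem quantumElem_of_lt {m i : ℕ} (h : m < i) : quantumElem R n m i = 0 := by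
  induction m using Nat.strong_induction_on generalizing i with
  | _ m ih =>
  match m, i, h with
  | 0, i + 1, _ => rw [quantumElem]
  | 1, i + 2, _ => rw [quantumElem]
  | m + 2, i + 2, h =>
    rw [quantumElem, ih (m + 1) (by omega) (by omega), ih (m + 1) (by omega) (by omega),
      ih m (by omega) (by omega), mul_zero, mul_zero, add_zero, add_zero]
  | m + 2, 1, h => omega

variable (R n) in
/-- The part of `E_{b+1}^{m+2}` that contains `q_{m+1}`. -/
def quantumTail (m : ℕ) : ℕ → MvPolynomial (Fin n) (QCoeff R n)
  | 0 => 0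
  | b + 1 => qVar R n m * quantumElem R n m b

theorem quantumElem_succ_succ (m b : ℕ) : quantumElem R n (m + 2) (b + 1) =
    quantumElem R n (m + 1) (b + 1) + xVar R n (m + 1) * quantumElem R n (m + 1) b +
      quantumTail R n m b := by
  cases b with
  | zero =>
    rw [quantumTail, quantumElem.eq_1 R n (m + 1), mul_one, add_zero, zero_add, quantumElem]
  | succ b => rw [quantumElem, quantumTail]

/-- As in the classical case the products with the new variable cancel; the recursion only adds the
two q-tails. -/
theorem quantumElem_mul_straighten (m a b : ℕ) :
    quantumElem R n (m + 1) a * quantumElem R n (m + 1) (b + 1) =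
      quantumElem R n (m + 1) (a + 1) * quantumElem R n (m + 1) b +
      quantumElem R n (m + 1) a * quantumElem R n (m + 2) (b + 1) -
      quantumElem R n (m + 1) b * quantumElem R n (m + 2) (a + 1) -
      quantumElem R n (m + 1) a * quantumTail R n m b +
      quantumElem R n (m + 1) b * quantumTail R n m a := by
  rw [quantumElem_succ_succ, quantumElem_succ_succ]
  ring

variable (R n) in
/-- The ideal of relations in the quantum cohomology ring. -/
def quantumIdeal : Ideal (MvPolynomial (Fin n) (QCoeff R n)) :=
  Ideal.span (Set.range fun i : Fin n => quantumElem R n n (i.val + 1))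

variable (R n) in
/-- The span of the products `E_{i_1, …, i_{n-1}}` and the ideal of relations. -/
def quantumSpan : Submodule (QCoeff R n) (MvPolynomial (Fin n) (QCoeff R n)) :=
  Submodule.span (QCoeff R n) (Set.range (quantumElemProd R (n := n))) ⊔
    (quantumIdeal R n).restrictScalars (QCoeff R n)

theorem mem_quantumSpan_of_mem {f : MvPolynomial (Fin n) (QCoeff R n)} (h : f ∈ quantumIdeal R n) :
    f ∈ quantumSpan R n := Submodule.mem_sup_right h

theorem qVar_mul_mem {f : MvPolynomial (Fin n) (QCoeff R n)} (h : f ∈ quantumSpan R n) (m : ℕ) :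
    qVar R n m * f ∈ quantumSpan R n := by
  unfold qVar
  split_ifs with hm
  · rw [← MvPolynomial.smul_eq_C_mul]
    exact Submodule.smul_mem _ _ h
  · rw [zero_mul]
    exact Submodule.zero_mem _

variable (R) in
/-- A product of quantum elementary polynomials with unrestricted lower indices. -/
def quantumProd (g : Fin (n - 1) → ℕ) : MvPolynomial (Fin n) (QCoeff R n) :=
  ∏ m : Fin (n - 1), quantumElem R n (m.val + 1) (g m)

theorem quantumProd_mem (g : Fin (n - 1) → ℕ) : quantumProd R g ∈ quantumSpan R n := by
  by_cases h : ∀ m, g m < m.val + 2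
  · exact Submodule.mem_sup_left (Submodule.subset_span ⟨fun m => ⟨g m, h m⟩, rfl⟩)
  · push Not at h
    obtain ⟨m, hm⟩ := h
    rw [quantumProd, Finset.prod_eq_zero (Finset.mem_univ m) (quantumElem_of_lt (by omega))]
    exact Submodule.zero_mem _

theorem quantumProd_update (g : Fin (n - 1) → ℕ) (i : Fin (n - 1)) (a : ℕ) :
    quantumProd R (Function.update g i a) =
      (∏ m ∈ Finset.univ.erase i, quantumElem R n (m.val + 1) (g m)) *
        quantumElem R n (i.val + 1) a := by
  rw [quantumProd, ← Finset.prod_erase_mul _ _ (Finset.mem_univ i), Function.update_self]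
  congr 1
  refine Finset.prod_congr rfl fun m hm => ?_
  rw [Function.update_of_ne (Finset.mem_erase.1 hm).1]

theorem sum_update (g : Fin (n - 1) → ℕ) (i : Fin (n - 1)) (a : ℕ) :
    ∑ m, Function.update g i a m + g i = ∑ m, g m + a := by
  rw [← Finset.sum_erase_add _ _ (Finset.mem_univ i), ← Finset.sum_erase_add _ g (Finset.mem_univ i),
    Function.update_self, Finset.sum_congr rfl fun m hm =>
      Function.update_of_ne (Finset.mem_erase.1 hm).1 a g]
  ring

/-- The extra factor is straightened against the factor with equally many variables. The tails carry
a q and a smaller sum of lower indices; the other terms have either a smaller b or an extra factor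
in one variable more. With all n variables that factor lies in the ideal. -/
theorem quantumProd_mul_mem (d : ℕ) : ∀ (g : Fin (n - 1) → ℕ) (b m : ℕ), m ≤ n →
    ∑ i, g i + b ≤ d → quantumProd R g * quantumElem R n m b ∈ quantumSpan R n := by
  induction d using Nat.strong_induction_on with
  | _ d ihd =>
  suffices h : ∀ t m, m + t = n → ∀ b (g : Fin (n - 1) → ℕ), ∑ i, g i + b ≤ d →
      quantumProd R g * quantumElem R n m b ∈ quantumSpan R n from
    fun g b m hm => h (n - m) m (by omega) b g
  intro t
  induction t with
  | zero =>
    intro m hm b g _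
    obtain rfl : m = n := by omega
    cases b with
    | zero => rw [quantumElem, mul_one]; exact quantumProd_mem g
    | succ b =>
      by_cases hb : b < m
      · exact mem_quantumSpan_of_mem (Ideal.mul_mem_left _ _
          (Ideal.subset_span ⟨⟨b, hb⟩, rfl⟩))
      · rw [quantumElem_of_lt (by omega), mul_zero]; exact Submodule.zero_mem _
  | succ t iht =>
    intro m hm b
    rcases m with _ | m
    · intro g _
      cases b with
      | zero => rw [quantumElem, mul_one]; exact quantumProd_mem g
      | succ b => rw [quantumElem, mul_zero]; exact Submodule.zero_mem _
    induction b with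
    | zero => intro g _; rw [quantumElem, mul_one]; exact quantumProd_mem g
    | succ b ihb =>
      intro g hg
      -- The factor of the product that has m + 1 variables, as many as the extra one.
      let i : Fin (n - 1) := ⟨m, by omega⟩
      set Q := ∏ l ∈ Finset.univ.erase i, quantumElem R n (l.val + 1) (g l) with hQ
      have hup : ∀ a, Q * quantumElem R n (m + 1) a = quantumProd R (Function.update g i a) :=
        fun a => (quantumProd_update g i a).symm
      have hg' : quantumProd R g = Q * quantumElem R n (m + 1) (g i) := by
        rw [hup, Function.update_eq_self]
      have htail : ∀ a c, ∑ l, Function.update g i a l + c < d + 1 →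
          Q * quantumElem R n (m + 1) a * quantumTail R n m c ∈ quantumSpan R n := by
        intro a c h
        cases c with
        | zero => rw [quantumTail, mul_zero]; exact Submodule.zero_mem _
        | succ c =>
          rw [quantumTail, hup, mul_left_comm]
          exact qVar_mul_mem (ihd _ (by omega) _ c m (by omega) le_rfl) m
      have s0 := sum_update g i (g i)
      have s1 := sum_update g i (g i + 1)
      have s2 := sum_update g i b
      have e : quantumProd R g * quantumElem R n (m + 1) (b + 1) =
          quantumProd R (Function.update g i (g i + 1)) * quantumElem R n (m + 1) b +
          quantumProd R g * quantumElem R n (m + 2) (b + 1) -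
          quantumProd R (Function.update g i b) * quantumElem R n (m + 2) (g i + 1) -
          Q * quantumElem R n (m + 1) (g i) * quantumTail R n m b +
          Q * quantumElem R n (m + 1) b * quantumTail R n m (g i) := by
        rw [← hup, ← hup, hg', mul_assoc Q, quantumElem_mul_straighten]
        ring
      rw [e]
      refine Submodule.add_mem _ (Submodule.sub_mem _ (Submodule.sub_mem _ (Submodule.add_mem _
        ?_ ?_) ?_) ?_) ?_
      · exact ihb _ (by omega)
      · exact iht (m + 2) (by omega) _ _ hg
      · exact iht (m + 2) (by omega) _ _ (by omega)
      · exact htail _ _ (by omega)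
      · exact htail _ _ (by omega)

/-- A variable is a difference of two E_1, so `quantumProd_mul_mem` makes the span closed under
multiplication by variables; it also contains 1. -/
theorem quantumSpan_eq_top : quantumSpan R n = ⊤ := by
  rw [eq_top_iff]
  intro f _
  have h1 : (1 : MvPolynomial (Fin n) (QCoeff R n)) ∈ quantumSpan R n := by
    have : quantumProd R (fun _ : Fin (n - 1) => 0) = 1 :=
      Finset.prod_eq_one fun m _ => by rw [quantumElem]
    rw [← this]
    exact quantumProd_mem _
  have h2 : ∀ (i : Fin n) f, f ∈ quantumSpan R n → f * MvPolynomial.X i ∈ quantumSpan R n := by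
    intro i f hf
    obtain ⟨u, hu, v, hv, rfl⟩ := Submodule.mem_sup.1 hf
    rw [add_mul]
    refine Submodule.add_mem _ ?_ (mem_quantumSpan_of_mem (Ideal.mul_mem_right _ _ hv))
    clear hf
    induction hu using Submodule.span_induction with
    | mem u hu =>
      obtain ⟨I, rfl⟩ := hu
      have hX : (MvPolynomial.X i : MvPolynomial (Fin n) (QCoeff R n)) =
          quantumElem R n (i.val + 1) 1 - quantumElem R n i.val 1 := by
        have : quantumElem R n (i.val + 1) 1 = quantumElem R n i.val 1 + xVar R n i.val := by
          rw [quantumElem]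
        rw [this, xVar, dif_pos i.isLt]
        ring
      rw [hX, mul_sub]
      exact Submodule.sub_mem _
        (quantumProd_mul_mem _ (fun m => (I m).val) 1 (i.val + 1) i.isLt le_rfl)
        (quantumProd_mul_mem _ (fun m => (I m).val) 1 i.val i.isLt.le le_rfl)
    | zero => rw [zero_mul]; exact Submodule.zero_mem _
    | add u u' _ _ h h' =>
      rw [add_mul]
      exact Submodule.add_mem _ h h'
    | smul r u _ h =>
      rw [smul_mul_assoc]
      exact Submodule.smul_mem _ _ h
  induction f using MvPolynomial.induction_on with
  | C r =>
    rw [← mul_one (MvPolynomial.C r), ← MvPolynomial.smul_eq_C_mul]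
    exact Submodule.smul_mem _ _ h1
  | add p q hp hq => exact Submodule.add_mem _ (hp trivial) (hq trivial)
  | mul_X p i hp => exact h2 i p (hp trivial)

end Spanning

/-! ### The action of the quantum cohomology ring -/

section QuantumCohomology

variable (R : Type) [CommRing R] (n : ℕ)

/-- The value of a polynomial in the Dunkl operators at the identity permutation. -/
def quantumFlag : MvPolynomial (Fin n) (QCoeff R n) →ₗ[QCoeff R n] FlagModule n (QCoeff R n) :=
  (LinearMap.applyₗ (flag 1 1)).comp
    (polyOp (n := n) (MvPolynomial.X : Fin (n - 1) → QCoeff R n)).toLinearMap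

variable {R n} [IsDomain R]

theorem quantumFlag_apply (f : MvPolynomial (Fin n) (QCoeff R n)) :
    quantumFlag R n f = polyOp MvPolynomial.X f (flag 1 1) := rfl

theorem quantumFlag_mul (f g : MvPolynomial (Fin n) (QCoeff R n)) :
    quantumFlag R n (f * g) = polyOp MvPolynomial.X f (quantumFlag R n g) := by
  rw [quantumFlag_apply, map_mul, Module.End.mul_apply, quantumFlag_apply]

theorem quantumFlag_schubert (w : Equiv.Perm (Fin n)) :
    quantumFlag R n (quantumSchubert R w) = flag w 1 :=
  polyOp_quantumSchubert w (exists_elemProd_expansion w)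

theorem quantumFlag_eq_zero_of_mem {f : MvPolynomial (Fin n) (QCoeff R n)}
    (hf : f ∈ quantumIdeal R n) : quantumFlag R n f = 0 := by
  induction hf using Submodule.span_induction with
  | mem f hf =>
    obtain ⟨i, rfl⟩ := hf
    exact polyOp_quantumElem_top i
  | zero => exact map_zero _
  | add f g _ _ hf hg => rw [map_add, hf, hg, add_zero]
  | smul f g _ hg => rw [smul_eq_mul, quantumFlag_mul, hg, map_zero]

/-- Modulo the ideal every polynomial is a combination of the n! standard products. On their
coefficients the map to the flag module is surjective, as quantum Schubert polynomials reach all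
permutations, hence it is injective. A polynomial with zero vector is therefore congruent to zero.
-/
theorem mem_quantumIdeal_iff {f : MvPolynomial (Fin n) (QCoeff R n)} :
    f ∈ quantumIdeal R n ↔ quantumFlag R n f = 0 := by
  refine ⟨quantumFlag_eq_zero_of_mem, fun hf => ?_⟩
  have hsplit : ∀ g : MvPolynomial (Fin n) (QCoeff R n), ∃ α : ElemIndex n → QCoeff R n,
      ∃ j ∈ quantumIdeal R n, ∑ I, α I • quantumElemProd R I + j = g := by
    intro g
    have hg : g ∈ quantumSpan R n := by
      rw [quantumSpan_eq_top]
      exact Submodule.mem_top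
    obtain ⟨u, hu, j, hj, rfl⟩ := Submodule.mem_sup.1 hg
    obtain ⟨α, rfl⟩ := (Submodule.mem_span_range_iff_exists_fun _).1 hu
    exact ⟨α, j, hj, rfl⟩
  let φ : (ElemIndex n → QCoeff R n) →ₗ[QCoeff R n] FlagModule n (QCoeff R n) :=
    (quantumFlag R n).comp (Fintype.linearCombination (QCoeff R n) (quantumElemProd R))
  have hφ : ∀ α, φ α = quantumFlag R n (∑ I, α I • quantumElemProd R I) := fun _ => rfl
  have hinj : Function.Injective φ := injective_of_surjective φ <| surjective_of_flag φ fun w => by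
    obtain ⟨α, j, hj, h⟩ := hsplit (quantumSchubert R w)
    refine ⟨α, ?_⟩
    rw [hφ, ← quantumFlag_schubert, ← h, map_add, quantumFlag_eq_zero_of_mem hj, add_zero]
  obtain ⟨α, j, hj, rfl⟩ := hsplit f
  rw [map_add, quantumFlag_eq_zero_of_mem hj, add_zero, ← hφ, ← map_zero φ] at hf
  rw [hinj hf]
  simpa using hj

theorem map_classSum {M N : Type} [AddCommMonoid M] [AddCommMonoid N] {k : ℕ} (f : M →+ N)
    (F : Word n k → M) : f (classSum F) = classSum fun u => f (F u) := by
  simp only [classSum, map_sum, map_nsmul]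

theorem bruhatMonomial_apply {k : ℕ} (u : Word n k) (v : SchubertModule n) :
    bruhatMonomial u v = stepHom (MvPolynomial.X : Fin (n - 1) → QCoeff ℤ n)
      (monomial (qParam MvPolynomial.X) u) v := by
  have hlt : ∀ t, u.row t < u.col t := fun t =>
    Fin.lt_def.2 (lt_of_lt_of_le (u t).2.1 (u t).2.2)
  have e1 : bruhatMonomial u v = bruhatOp (u.row 0) (u.col 0) (bruhatOp (u.row 1) (u.col 1)
      (bruhatOp (u.row 2) (u.col 2) (bruhatOp (u.row 3) (u.col 3) v))) := by
    simp [bruhatMonomial, List.ofFn_succ]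
  have e2 : monomial (qParam (n := n) (MvPolynomial.X : Fin (n - 1) → QCoeff ℤ n)) u =
      gen _ (u.row 0) (u.col 0) * (gen _ (u.row 1) (u.col 1) *
      (gen _ (u.row 2) (u.col 2) * gen _ (u.row 3) (u.col 3))) := by
    simp [monomial, List.ofFn_succ]
  rw [e1, e2, map_mul, map_mul, map_mul, stepHom_gen _ (hlt 0), stepHom_gen _ (hlt 1),
    stepHom_gen _ (hlt 2), stepHom_gen _ (hlt 3), bruhatOp_apply (hlt 0), bruhatOp_apply (hlt 1),
    bruhatOp_apply (hlt 2), bruhatOp_apply (hlt 3)]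
  rfl

theorem flagModule_eq_of_zsmul {u v : FlagModule n (QCoeff ℤ n)} (h : (12 : ℤ) • u = (12 : ℤ) • v) :
    u = v := by
  refine flagModule_ext fun w => ?_
  have h1 := congrArg (coord w) h
  rw [map_zsmul, map_zsmul, zsmul_eq_mul, zsmul_eq_mul] at h1
  refine mul_left_cancel₀ ?_ h1
  norm_num

/-- Quantum Schubert polynomials lift a formal combination of permutations to a polynomial that
`quantumFlag` sends back to it. -/
theorem toQH_eq_mk (v : SchubertModule n) : ∃ f : MvPolynomial (Fin n) (QCoeff ℤ n),
    toQH n v = Ideal.Quotient.mk _ f ∧ quantumFlag ℤ n f = v := by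
  refine ⟨Finsupp.linearCombination (QCoeff ℤ n) (fun w => quantumSchubert ℤ w) v, ?_, ?_⟩
  · have : toQH n = (Ideal.Quotient.mkₐ (QCoeff ℤ n) _).toLinearMap.comp
        (Finsupp.linearCombination (QCoeff ℤ n) fun w => quantumSchubert ℤ w) := by
      refine Finsupp.lhom_ext' fun w => LinearMap.ext_ring ?_
      simp [toQH, schubertClass]
    rw [this]
    rfl
  · have : (quantumFlag ℤ n).comp
        (Finsupp.linearCombination (QCoeff ℤ n) fun w => quantumSchubert ℤ w) =
        (LinearMap.id : SchubertModule n →ₗ[QCoeff ℤ n] SchubertModule n) := by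
      refine Finsupp.lhom_ext' fun w => LinearMap.ext_ring ?_
      simp only [LinearMap.comp_apply, Finsupp.lsingle_apply, Finsupp.linearCombination_single,
        one_smul, quantumFlag_schubert]
      rfl
    exact congrArg (fun f => f v) this

/-- By `mem_quantumIdeal_iff` it is enough to compare vectors. The product of polynomials acts on
the identity by first producing π and then applying the quantum Schubert polynomial of w at the
Dunkl operators, where its expansion into words is known. The factor 12 cancels since ℤ[q] has no
torsion. -/
theorem schubertClass_boxPerm_mul {k : ℕ} (hk : 2 ≤ k) (hn : k + 2 ≤ n) (π : Equiv.Perm (Fin n)) :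
    schubertClass (boxPerm n k hk hn) * schubertClass π =
      classSum fun u : Word n k => toQH n (bruhatMonomial u (Finsupp.single π 1)) := by
  refine Eq.trans ?_ (map_classSum (toQH n).toAddMonoidHom
    fun u : Word n k => bruhatMonomial u (Finsupp.single π 1))
  obtain ⟨f, hf, hv⟩ := toQH_eq_mk
    (classSum fun u : Word n k => bruhatMonomial u (Finsupp.single π 1))
  refine Eq.trans ?_ hf.symm
  rw [schubertClass, schubertClass, ← map_mul, Ideal.Quotient.mk_eq_mk_iff_sub_mem]
  refine mem_quantumIdeal_iff.2 ?_
  rw [map_sub, sub_eq_zero, hv, quantumFlag_mul, quantumFlag_schubert, polyOp_eq_stepHom]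
  apply flagModule_eq_of_zsmul
  have h1 := congrArg (fun y => stepHom MvPolynomial.X y (flag π 1))
    (evalHom_quantumSchubert_boxPerm ℤ k hk hn)
  simp only [map_zsmul, LinearMap.smul_apply] at h1
  rw [h1]
  congr 1
  have h2 := map_classSum ((LinearMap.applyₗ (flag π 1)).comp (stepHom (n := n)
    (MvPolynomial.X : Fin (n - 1) → QCoeff ℤ n)).toLinearMap).toAddMonoidHom
    (fun u : Word n k => monomial (qParam (MvPolynomial.X : Fin (n - 1) → QCoeff ℤ n)) u)
  refine h2.trans ?_
  congr 1
  funext u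
  exact (bruhatMonomial_apply u (Finsupp.single π 1)).symm

end QuantumCohomology

end FominKirillov

end

open FominKirillov in
theorem theorem5p4 (n k : ℕ) (hk : 2 ≤ k) (hn : k + 2 ≤ n) :
    -- the Schubert polynomial is evaluated at the Dunkl elements of the classical algebra
    evalAt (dunkl (classicalParam n)) (schubert ℂ (boxPerm n k hk hn)) =
        evalAt (fun i : Fin k => dunkl (classicalParam n) (Fin.castLE (by omega) i))
          (schur ℂ k boxShape) ∧
    evalAt (fun i : Fin k => dunkl (classicalParam n) (Fin.castLE (by omega) i))
          (schur ℂ k boxShape) =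
        classSum (fun u : Word n k => monomial (classicalParam n) u) ∧
    -- the quantum Schubert polynomial has the same expansion in the quantum algebra
    evalAt (dunkl (quantumParam n)) (quantumSchubert ℂ (boxPerm n k hk hn)) =
        classSum (fun u : Word n k => monomial (quantumParam n) u) ∧
    -- products in the quantum cohomology ring of the flag manifold
    ∀ π : Equiv.Perm (Fin n),
      schubertClass (boxPerm n k hk hn) * schubertClass π =
        classSum (fun u : Word n k => toQH n (bruhatMonomial u (Finsupp.single π 1))) := by
  refine ⟨evalAt_schur_boxShape n k hk hn _, ?_, evalAt_quantumSchubert_boxPerm n k hk hn,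
    schubertClass_boxPerm_mul hk hn⟩
  rw [← evalAt_schur_boxShape n k hk hn _]
  exact evalAt_schubert_boxPerm n k hk hn
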